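/- **Theorem.** Let $n\ge 4$, and let $\mathbb Z[\delta]$ be the polynomial ring in one indeterminate $\delta$. *Algebras by generators and relations.* Let $(W(D_n),S)$ be the Coxeter system with generators $s_{\bar 1},s_1,\dots,s_{n-1}$ whose Coxeter graph has the (unlabelled) edges $s_i - s_{i+1}$ ($1\le i\le n-2$) and $s_{\bar 1} - s_2$. Let $\mathrm{TL}(D_n)$ be the unital associative $\mathbb Z[\delta]$-algebra with generators $b_{\bar 1},b_1,\dots,b_{n-1}$ and relations $b_i^2=\delta b_i$; $b_ib_j=b_jb_i$ if $s_i,s_j$ are not joined in the graph; $b_ib_jb_i=b_i$ if they are joined. Let $\mathrm{PFTL}(D_n)$ be its quotient by the additional relation $b_1b_{\bar 1}=0$, and let $\bar b_i$ be the image of $b_i$. An element $w\in W(D_n)$ is *fully commutative* if any two of its reduced expressions are related by a sequence of moves $st\mapsto ts$ with $s,t$ commuting distinct generators. A fully commutative $w$ (or its heap) is of *type I* if some reduced expression of $w$ has $s_{\bar 1}s_1$ as a consecutive subword, and of *type II* otherwise. For $w$ fully commutative with reduced expression $s_{x_1}\cdots s_{x_m}$ put $\bar b_w=\bar b_{x_1}\cdots\bar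 b_{x_m}$. *Diagram algebras.* Consider planar diagrams in a rectangle with nodes $1,\dots,n$ on the north face and $1',\dots,n'$ on the south face: finitely many disjoint edges, each of which is an arc joining two nodes or a closed loop, every node being the end of exactly one arc; each edge carries finitely many decorations $\bullet$. Such a diagram is *L-decorated* if (a) it has no decorations when no two nodes of the north face are joined, and (b) all decorations can be moved simultaneously to the left wall without crossing an edge. Up to isotopy, the L-decorated diagrams are a $\mathbb Z[\delta]$-basis of an algebra in which $dd'$ is the diagram obtained by placing $d$ on top of $d'$. Let $\widehat{\mathcal P}^L_n(\bullet)$ be its quotient by the relations: an undecorated loop equals the factor $\delta$; two decorations on the same edge cancel; in the presence of a loop with a single decoration, a decoration may be removed from any other edge. Let $d_i$ ($1\le i\le n-1$) be the undecorated diagram with the edges $\{i,i+1\}$, $\{i',(i+1)'\}$ and $\{j,j'\}$ for $j\ne i,i+1$, and let $d_{\bar 1}$ be $d_1$ with one decoration on each of the edges $\{1,2\}$ and $\{1',2'\}$. Let $\mathrm{DTL}(D_n)$ be the unital subalgebra of $\widehat{\mathcal P}^L_n(\bullet)$ generated by $d_{\bar 1},d_1,\dots,d_{n-1}$, let $\mathrm{LFD}(D_n)$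 be its quotient by the relation that a loop with a decoration equals $0$, and let $\bar d_i$ be the image of $d_i$. A *type II $D$-admissible diagram* is an L-decorated diagram without loops, with at most one decoration on each edge and with an even total number of decorations. *Claim.* There is an isomorphism of $\mathbb Z[\delta]$-algebras $\varphi:\mathrm{PFTL}(D_n)\to\mathrm{LFD}(D_n)$ with $\varphi(\bar b_i)=\bar d_i$ for all $i\in\{\bar 1,1,\dots,n-1\}$. Moreover, $\bar b_w$ does not depend on the reduced expression, the $\bar b_w$ with $w$ fully commutative of type II form a $\mathbb Z[\delta]$-basis of $\mathrm{PFTL}(D_n)$ (the monomial basis), and there is a bijection $w\mapsto D_w$ from the type II fully commutative elements onto the type II $D$-admissible diagrams such that $D_w$ represents an element of $\mathrm{DTL}(D_n)$ whose image in $\mathrm{LFD}(D_n)$ is $\varphi(\bar b_w)$. -/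

import Mathlib

open Polynomial

noncomputable section

namespace TypeD

/-! ## The Coxeter group of type `D_n` and its fully commutative elements

The generators are indexed by `Fin n`: the index `0` stands for `s_{\bar 1}`, and the index
`i` with `1 ≤ i ≤ n - 1` stands for `s_i`. -/

/-- Adjacency in the Coxeter graph of type `D_n`: `s_i` is joined to `s_{i+1}` for `i ≥ 1`,
and `s_{\bar 1}` is joined to `s_2`. -/
def Joined {n : ℕ} (i j : Fin n) : Prop :=
  (1 ≤ i.val ∧ j.val = i.val + 1) ∨ (1 ≤ j.val ∧ i.val = j.val + 1) ∨
    (i.val = 0 ∧ j.val = 2) ∨ (j.val = 0 ∧ i.val = 2)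

instance {n : ℕ} (i j : Fin n) : Decidable (Joined i j) := by
  unfold Joined; infer_instance

/-- The Coxeter matrix of type `D_n`. -/
def coxMatrix (n : ℕ) : CoxeterMatrix (Fin n) where
  M := Matrix.of fun i j => if i = j then 1 else if Joined i j then 3 else 2
  isSymm := by
    ext i j
    have h : Joined j i ↔ Joined i j := by unfold Joined; omega
    simp only [Matrix.transpose_apply, Matrix.of_apply, h, eq_comm (a := j)]
  diagonal := by simp
  off_diagonal := by
    intro i j h
    simp only [Matrix.of_apply, h, if_false]
    split_ifs <;> decide

/-- The Coxeter group `W(D_n)`. -/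
abbrev W (n : ℕ) : Type := (coxMatrix n).Group

/-- The Coxeter system of type `D_n`. -/
abbrev cs (n : ℕ) : CoxeterSystem (coxMatrix n) (W n) := (coxMatrix n).toCoxeterSystem

/-- `ω` is a reduced expression for `w`. -/
def IsReducedExpr {n : ℕ} (ω : List (Fin n)) (w : W n) : Prop :=
  (cs n).IsReduced ω ∧ (cs n).wordProd ω = w

/-- A single commutation move `st ↦ ts` with `m(s,t) = 2`. -/
def CommMove {n : ℕ} (ω ω' : List (Fin n)) : Prop :=
  ∃ (l r : List (Fin n)) (s t : Fin n), coxMatrix n s t = 2 ∧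
    ω = l ++ [s, t] ++ r ∧ ω' = l ++ [t, s] ++ r

/-- `w` is fully commutative: its reduced expressions form a single commutation class. -/
def IsFC {n : ℕ} (w : W n) : Prop :=
  ∀ ω ω' : List (Fin n), IsReducedExpr ω w → IsReducedExpr ω' w →
    Relation.ReflTransGen CommMove ω ω'

/-- The heap of `w` is of type I: some reduced expression of `w` has `s_{\bar 1} s_1` as a
(consecutive) subword. -/
def HeapTypeI {n : ℕ} (w : W n) : Prop :=
  ∃ (ω : List (Fin n)) (i j : Fin n), i.val = 0 ∧ j.val = 1 ∧
    IsReducedExpr ω w ∧ [i, j] <:+: ω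

/-- The fully commutative elements whose heap is of type II. A fully commutative heap is the heap
of exactly one fully commutative element, so this is also the set of type II heaps. -/
def FCII (n : ℕ) : Type := {w : W n // IsFC w ∧ ¬ HeapTypeI w}

/-! ## The algebras `TL(D_n)` and `PFTL(D_n)` over `ℤ[δ]`

The indeterminate `δ` is `Polynomial.X : ℤ[X]`. -/

/-- The defining relations of `TL(D_n)`. -/
inductive TLRel (n : ℕ) : FreeAlgebra ℤ[X] (Fin n) → FreeAlgebra ℤ[X] (Fin n) → Prop
  | sq (i : Fin n) :
      TLRel n (FreeAlgebra.ι ℤ[X] i * FreeAlgebra.ι ℤ[X] i)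
        ((X : ℤ[X]) • FreeAlgebra.ι ℤ[X] i)
  | comm (i j : Fin n) (h : ¬ Joined i j) :
      TLRel n (FreeAlgebra.ι ℤ[X] i * FreeAlgebra.ι ℤ[X] j)
        (FreeAlgebra.ι ℤ[X] j * FreeAlgebra.ι ℤ[X] i)
  | braid (i j : Fin n) (h : Joined i j) :
      TLRel n (FreeAlgebra.ι ℤ[X] i * FreeAlgebra.ι ℤ[X] j * FreeAlgebra.ι ℤ[X] i)
        (FreeAlgebra.ι ℤ[X] i)

/-- The Temperley--Lieb algebra of type `D_n`. -/
abbrev TL (n : ℕ) : Type := RingQuot (TLRel n)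

/-- The generator `b_i` of `TL(D_n)`. -/
def TL.b {n : ℕ} (i : Fin n) : TL n :=
  RingQuot.mkAlgHom ℤ[X] (TLRel n) (FreeAlgebra.ι ℤ[X] i)

/-- The additional relation `b_1 b_{\bar 1} = 0`. -/
inductive PairRel (n : ℕ) : TL n → TL n → Prop
  | pair (i j : Fin n) (hi : i.val = 1) (hj : j.val = 0) : PairRel n (TL.b i * TL.b j) 0

/-- The pair-free Temperley--Lieb algebra of type `D_n`. -/
abbrev PFTL (n : ℕ) : Type := RingQuot (PairRel n)

/-- The generator `\bar b_i` of `PFTL(D_n)`. -/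
def PFTL.b {n : ℕ} (i : Fin n) : PFTL n :=
  RingQuot.mkAlgHom ℤ[X] (PairRel n) (TL.b i)

/-! ## Decorated diagrams -/

/-- The nodes of the standard `k`-box: `Sum.inl i` is the node `i + 1` of the north face and
`Sum.inr i` is the node `(i + 1)'` of the south face. -/
abbrev Node (k : ℕ) : Type := Fin k ⊕ Fin k

/-- The combinatorial record of a decorated picture in the `k`-box: its finite set `E` of edges
(connected components, that is arcs and loops), the edge that ends at each node, and the number of
decorations on each edge. An edge at which no node lies is a loop. The conditions that make such a
record a diagram are imposed in `IsPseudo` and `IsLDecorated` below. -/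
structure Picture (k : ℕ) : Type 1 where
  E : Type
  [fin : Fintype E]
  edgeAt : Node k → E
  dec : E → ℕ

attribute [instance] Picture.fin

open Classical in
/-- `push f w c` is the total weight of the points that `f` sends to `c`. -/
def push {A C : Type} [Fintype A] (f : A → C) (w : A → ℕ) (c : C) : ℕ :=
  ∑ a with f a = c, w a

namespace Picture

variable {k : ℕ}

/-- Two pictures are equivalent if there is a bijection between their edges that respects the
end points and the numbers of decorations. A planar matching in the box is determined up to isotopy
by its end points; the place of a loop is not recorded, as it plays no role in the relations that
are imposed later: an undecorated loop may be removed wherever it lies, and all the decorated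
edges and loops of an `L`-decorated diagram lie along the region at the left wall. -/
def Equivalent (P Q : Picture k) : Prop :=
  ∃ σ : P.E ≃ Q.E, (∀ x, σ (P.edgeAt x) = Q.edgeAt x) ∧ ∀ e, Q.dec (σ e) = P.dec e

/-- The node `i'` of the upper picture is glued to the node `i` of the lower one. -/
inductive Glue (P Q : Picture k) : P.E ⊕ Q.E → P.E ⊕ Q.E → Prop
  | glue (i : Fin k) :
      Glue P Q (Sum.inl (P.edgeAt (Sum.inr i))) (Sum.inr (Q.edgeAt (Sum.inl i)))

/-- Concatenation, with `P` on top of `Q`. The edges of the result are the connected components of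
the glued picture, and each carries all the decorations of the edges that it is made of. -/
def comp (P Q : Picture k) : Picture k where
  E := Quot (Glue P Q)
  fin := Fintype.ofFinite _
  edgeAt := Sum.elim (fun i => Quot.mk _ (Sum.inl (P.edgeAt (Sum.inl i))))
    (fun i => Quot.mk _ (Sum.inr (Q.edgeAt (Sum.inr i))))
  dec c := push (fun e => Quot.mk (Glue P Q) (Sum.inl e)) P.dec c +
    push (fun e => Quot.mk (Glue P Q) (Sum.inr e)) Q.dec c

/-- The picture with `k` undecorated vertical edges. -/
def ident (k : ℕ) : Picture k where
  E := Fin k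
  edgeAt := Sum.elim id id
  dec _ := 0

end Picture

section push

variable {A B C : Type} [Fintype A] [Fintype B]

theorem push_push (f : A → B) (g : B → C) (w : A → ℕ) (c : C) :
    push g (push f w) c = push (fun a => g (f a)) w c := by
  classical
  have h : ∀ b, (if g b = c then push f w b else 0) =
      ∑ a, if f a = b then (if g (f a) = c then w a else 0) else 0 := by
    intro b
    unfold push
    rw [Finset.sum_filter]
    split_ifs with hb
    · refine Finset.sum_congr rfl fun a _ => ?_
      by_cases h : f a = b
      · subst h; simp [hb]
      · simp [h]
    · refine (Finset.sum_eq_zero fun a _ => ?_).symm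
      by_cases h : f a = b
      · subst h; simp [hb]
      · simp [h]
  calc push g (push f w) c = ∑ b, if g b = c then push f w b else 0 := by
        rw [push, Finset.sum_filter]
    _ = _ := by
        simp_rw [h]
        rw [Finset.sum_comm]
        simp [push, Finset.sum_filter]

theorem push_add (f : A → C) (w w' : A → ℕ) (c : C) :
    push f (fun a => w a + w' a) c = push f w c + push f w' c := by
  unfold push; exact Finset.sum_add_distrib

theorem push_zero (f : A → C) (c : C) : push f (fun _ => 0) c = 0 := by
  simp [push]

theorem push_inj {C' : Type} (h : C → C') (hh : Function.Injective h) (f : A → C) (w : A → ℕ)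
    (c : C) : push (fun a => h (f a)) w (h c) = push f w c := by
  classical
  simp only [push, Finset.sum_filter, hh.eq_iff]

theorem push_equiv (σ : A ≃ C) (w : A → ℕ) (a : A) : push σ w (σ a) = w a := by
  classical
  simp [push, Finset.sum_filter]

theorem push_reindex (σ : A ≃ B) (f : B → C) (w : A → ℕ) (w' : B → ℕ)
    (hw : ∀ a, w' (σ a) = w a) (c : C) : push (fun a => f (σ a)) w c = push f w' c := by
  rw [← push_push (f := σ) (g := f)]
  congr 1
  funext b
  obtain ⟨a, rfl⟩ := σ.surjective b
  rw [push_equiv, hw]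

end push

namespace Picture

variable {k : ℕ}

theorem equivalent_equivalence : Equivalence (Equivalent (k := k)) where
  refl P := ⟨Equiv.refl _, fun _ => rfl, fun _ => rfl⟩
  symm := by
    rintro P Q ⟨σ, h, h'⟩
    refine ⟨σ.symm, fun x => by rw [← h, σ.symm_apply_apply], fun e => ?_⟩
    rw [← h', σ.apply_symm_apply]
  trans := by
    rintro P Q R ⟨σ, h, h'⟩ ⟨τ, g, g'⟩
    exact ⟨σ.trans τ, fun x => by simp [h, g], fun e => by simp [h', g']⟩

instance setoid (k : ℕ) : Setoid (Picture k) := ⟨Equivalent, equivalent_equivalence⟩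

theorem comp_congr {P P' Q Q' : Picture k} (hP : Equivalent P P') (hQ : Equivalent Q Q') :
    Equivalent (comp P Q) (comp P' Q') := by
  obtain ⟨σ, h, h'⟩ := hP
  obtain ⟨τ, g, g'⟩ := hQ
  let f : Quot (Glue P Q) → Quot (Glue P' Q') :=
    Quot.map (Sum.map σ τ) (by
      rintro _ _ ⟨i⟩
      simp only [Sum.map_inl, Sum.map_inr, h, g]
      exact .glue i)
  let f' : Quot (Glue P' Q') → Quot (Glue P Q) :=
    Quot.map (Sum.map σ.symm τ.symm) (by
      rintro _ _ ⟨i⟩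
      simp only [Sum.map_inl, Sum.map_inr, ← h, ← g, Equiv.symm_apply_apply]
      exact .glue i)
  have e1 : Function.LeftInverse f' f := by rintro ⟨e | e⟩ <;> simp [f, f', Quot.map]
  have e2 : Function.RightInverse f' f := by rintro ⟨e | e⟩ <;> simp [f, f', Quot.map]
  refine ⟨⟨f, f', e1, e2⟩, ?_, ?_⟩
  · rintro (i | i)
    · exact congrArg (fun z => Quot.mk (Glue P' Q') (Sum.inl z)) (h (Sum.inl i))
    · exact congrArg (fun z => Quot.mk (Glue P' Q') (Sum.inr z)) (g (Sum.inr i))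
  · intro c
    exact congrArg₂ (· + ·)
      ((push_reindex σ (fun e => Quot.mk (Glue P' Q') (Sum.inl e)) P.dec P'.dec h' (f c)).symm.trans
        (push_inj f e1.injective (fun e => Quot.mk (Glue P Q) (Sum.inl e)) P.dec c))
      ((push_reindex τ (fun e => Quot.mk (Glue P' Q') (Sum.inr e)) Q.dec Q'.dec g' (f c)).symm.trans
        (push_inj f e1.injective (fun e => Quot.mk (Glue P Q) (Sum.inr e)) Q.dec c))

theorem comp_assoc (P Q R : Picture k) :
    Equivalent (comp (comp P Q) R) (comp P (comp Q R)) := by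
  let f : Quot (Glue (comp P Q) R) → Quot (Glue P (comp Q R)) :=
    Quot.lift (Sum.elim
      (Quot.lift (Sum.elim (fun p => Quot.mk _ (Sum.inl p))
        (fun q => Quot.mk _ (Sum.inr (Quot.mk _ (Sum.inl q))))) (by
          rintro _ _ ⟨i⟩
          exact Quot.sound (Glue.glue (P := P) (Q := comp Q R) i)))
      (fun r => Quot.mk _ (Sum.inr (Quot.mk _ (Sum.inr r))))) (by
        rintro _ _ ⟨i⟩
        exact congrArg (fun z => Quot.mk (Glue P (comp Q R)) (Sum.inr z))
          (Quot.sound (Glue.glue (P := Q) (Q := R) i)))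
  let f' : Quot (Glue P (comp Q R)) → Quot (Glue (comp P Q) R) :=
    Quot.lift (Sum.elim
      (fun p => Quot.mk _ (Sum.inl (Quot.mk _ (Sum.inl p))))
      (Quot.lift (Sum.elim (fun q => Quot.mk _ (Sum.inl (Quot.mk _ (Sum.inr q))))
        (fun r => Quot.mk _ (Sum.inr r))) (by
          rintro _ _ ⟨i⟩
          exact Quot.sound (Glue.glue (P := comp P Q) (Q := R) i)))) (by
        rintro _ _ ⟨i⟩
        exact congrArg (fun z => Quot.mk (Glue (comp P Q) R) (Sum.inl z))
          (Quot.sound (Glue.glue (P := P) (Q := Q) i)))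
  have e1 : Function.LeftInverse f' f := by
    rintro ⟨c | e⟩
    · obtain ⟨e | e⟩ : Quot (Glue P Q) := c <;> rfl
    · rfl
  have e2 : Function.RightInverse f' f := by
    rintro ⟨e | c⟩
    · rfl
    · obtain ⟨e | e⟩ : Quot (Glue Q R) := c <;> rfl
  refine ⟨⟨f, f', e1, e2⟩, ?_, ?_⟩
  · rintro (i | i) <;> rfl
  · intro c
    have h1 : ∀ d, push (fun e => Quot.mk (Glue P (comp Q R)) (Sum.inr e)) (comp Q R).dec d =
        push (fun e => f (Quot.mk _ (Sum.inl (Quot.mk _ (Sum.inr e))))) Q.dec d +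
          push (fun e => f (Quot.mk _ (Sum.inr e))) R.dec d := fun d =>
      (push_add _ _ _ d).trans (congrArg₂ (· + ·) (push_push _ _ _ d) (push_push _ _ _ d))
    have h2 : ∀ d, push (fun e => Quot.mk (Glue (comp P Q) R) (Sum.inl e)) (comp P Q).dec d =
        push (fun e => Quot.mk _ (Sum.inl (Quot.mk _ (Sum.inl e)))) P.dec d +
          push (fun e => Quot.mk _ (Sum.inl (Quot.mk _ (Sum.inr e)))) Q.dec d := fun d =>
      (push_add _ _ _ d).trans (congrArg₂ (· + ·) (push_push _ _ _ d) (push_push _ _ _ d))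
    refine (congrArg₂ (· + ·) ?_ ((h1 (f c)).trans (congrArg₂ (· + ·)
      (push_inj f e1.injective
        (fun e => Quot.mk (Glue (comp P Q) R) (Sum.inl (Quot.mk (Glue P Q) (Sum.inr e)))) Q.dec c)
      (push_inj f e1.injective
        (fun e => Quot.mk (Glue (comp P Q) R) (Sum.inr e)) R.dec c)))).trans
        ((add_assoc _ _ _).symm.trans (congrArg (· + _) (h2 c).symm))
    exact push_inj f e1.injective
      (fun e => Quot.mk (Glue (comp P Q) R) (Sum.inl (Quot.mk (Glue P Q) (Sum.inl e)))) P.dec c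

theorem ident_comp (P : Picture k) : Equivalent (comp (ident k) P) P := by
  let f : Quot (Glue (ident k) P) → P.E :=
    Quot.lift (Sum.elim (fun i : Fin k => P.edgeAt (Sum.inl i)) id) (by rintro _ _ ⟨i⟩; rfl)
  have e1 : Function.LeftInverse (fun e => Quot.mk (Glue (ident k) P) (Sum.inr e)) f := by
    rintro ⟨i | e⟩
    · exact (Quot.sound (Glue.glue (P := ident k) (Q := P) i)).symm
    · rfl
  have e2 : Function.RightInverse (fun e => Quot.mk (Glue (ident k) P) (Sum.inr e)) f :=
    fun e => rfl
  refine ⟨⟨f, _, e1, e2⟩, ?_, ?_⟩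
  · rintro (i | i) <;> rfl
  · intro c
    exact ((congrArg₂ (· + ·) (push_zero _ c) ((push_inj f e1.injective
      (fun e => Quot.mk (Glue (ident k) P) (Sum.inr e)) P.dec c).symm.trans
        (push_equiv (Equiv.refl _) P.dec (f c)))).trans (zero_add _)).symm

theorem comp_ident (P : Picture k) : Equivalent (comp P (ident k)) P := by
  let f : Quot (Glue P (ident k)) → P.E :=
    Quot.lift (Sum.elim id (fun i : Fin k => P.edgeAt (Sum.inr i))) (by rintro _ _ ⟨i⟩; rfl)
  have e1 : Function.LeftInverse (fun e => Quot.mk (Glue P (ident k)) (Sum.inl e)) f := by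
    rintro ⟨e | i⟩
    · rfl
    · exact Quot.sound (Glue.glue (P := P) (Q := ident k) i)
  have e2 : Function.RightInverse (fun e => Quot.mk (Glue P (ident k)) (Sum.inl e)) f :=
    fun e => rfl
  refine ⟨⟨f, _, e1, e2⟩, ?_, ?_⟩
  · rintro (i | i) <;> rfl
  · intro c
    exact ((congrArg₂ (· + ·) ((push_inj f e1.injective
      (fun e => Quot.mk (Glue P (ident k)) (Sum.inl e)) P.dec c).symm.trans
        (push_equiv (Equiv.refl _) P.dec (f c))) (push_zero _ c)).trans (add_zero _)).symm

end Picture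

/-- Equivalence classes of pictures. -/
def Diagram (k : ℕ) : Type 1 := Quotient (Picture.setoid k)

/-- The diagram of a picture. -/
def Diagram.mk {k : ℕ} (P : Picture k) : Diagram k := Quotient.mk _ P

/-- Diagrams form a monoid under concatenation; `D * D'` has `D` on top of `D'`. -/
instance (k : ℕ) : Monoid (Diagram k) where
  mul := Quotient.map₂ Picture.comp fun _ _ h _ _ h' => Picture.comp_congr h h'
  one := Diagram.mk (Picture.ident k)
  mul_assoc := by
    rintro ⟨P⟩ ⟨Q⟩ ⟨R⟩
    exact Quotient.sound (Picture.comp_assoc P Q R)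
  one_mul := by
    rintro ⟨P⟩
    exact Quotient.sound (Picture.ident_comp P)
  mul_one := by
    rintro ⟨P⟩
    exact Quotient.sound (Picture.comp_ident P)

/-! ### `L`-decorated pseudo diagrams -/

/-- The place of a node on the boundary of the box, read clockwise from the left wall:
`1, 2, …, k` along the north face, then `k', …, 2', 1'` along the south face. -/
def Node.pos {k : ℕ} : Node k → ℕ
  | Sum.inl i => i.val
  | Sum.inr i => 2 * k - 1 - i.val

namespace Picture

variable {k : ℕ}

/-- A loop is an edge without end points. -/
def IsLoop (P : Picture k) (e : P.E) : Prop := ∀ x, P.edgeAt x ≠ e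

/-- Pseudo `k`-diagrams: every edge is a loop or has exactly two end points, and the edges can be
drawn in the box without crossings. -/
def IsPseudo (P : Picture k) : Prop :=
  (∀ e, P.IsLoop e ∨ Nat.card {x // P.edgeAt x = e} = 2) ∧
  ∀ a b c d : Node k, a.pos < b.pos → b.pos < c.pos → c.pos < d.pos →
    P.edgeAt a = P.edgeAt c → P.edgeAt b = P.edgeAt d → P.edgeAt a = P.edgeAt b

/-- The number of non-propagating edges in the north face. -/
def aValue (P : Picture k) : ℕ :=
  Nat.card {e // ∃ i j : Fin k, i ≠ j ∧ P.edgeAt (Sum.inl i) = e ∧ P.edgeAt (Sum.inl j) = e}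

/-- The edge `e` can be deformed to the left wall without crossing another edge: no arc separates
it from the left wall. -/
def LeftExposed (P : Picture k) (e : P.E) : Prop :=
  ¬ ∃ a b c : Node k, a.pos < b.pos ∧ b.pos < c.pos ∧ P.edgeAt b = e ∧ P.edgeAt a = P.edgeAt c

/-- `L`-decorated pseudo `k`-diagrams: a diagram of `a`-value `0` is undecorated, and all
decorations are left exposed. -/
def IsLDecorated (P : Picture k) : Prop :=
  P.IsPseudo ∧ (P.aValue = 0 → ∀ e, P.dec e = 0) ∧ ∀ e, P.dec e ≠ 0 → P.LeftExposed e

/-- Add one loop that carries `r` decorations. -/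
def addLoop (P : Picture k) (r : ℕ) : Picture k where
  E := Option P.E
  edgeAt x := some (P.edgeAt x)
  dec e := e.elim r P.dec

open Classical in
/-- Add `r` decorations to the edge `e`. -/
def decorate (P : Picture k) (e : P.E) (r : ℕ) : Picture k where
  E := P.E
  edgeAt := P.edgeAt
  dec := Function.update P.dec e (P.dec e + r)

/-- None of the defining relations can be applied: no undecorated loop, at most one decoration on
each edge, and no decoration besides a decorated loop. -/
def IsIrreducible (P : Picture k) : Prop :=
  (∀ e, P.IsLoop e → P.dec e ≠ 0) ∧ (∀ e, P.dec e ≤ 1) ∧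
    ∀ e e', P.IsLoop e → P.dec e ≠ 0 → e' ≠ e → P.dec e' = 0

end Picture

/-- The set of `L`-decorated pseudo `k`-diagrams. -/
def LDiagram (k : ℕ) : Type 1 := {D : Diagram k // ∃ P, Diagram.mk P = D ∧ P.IsLDecorated}

/-- The `L`-decorated diagram of a picture. -/
def LDiagram.mk {k : ℕ} (P : Picture k) (h : P.IsLDecorated) : LDiagram k :=
  ⟨Diagram.mk P, P, rfl, h⟩

/-- `D`-admissible diagrams of type II: irreducible `L`-decorated diagrams without loops and with an
even total number of decorations. -/
def AdmissibleII (n : ℕ) : Type 1 :=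
  {D : LDiagram n // ∃ (P : Picture n) (h : P.IsLDecorated), D = LDiagram.mk P h ∧
    P.IsIrreducible ∧ (∀ e, ¬ P.IsLoop e) ∧ Even (∑ e, P.dec e)}

/-! ### The diagram algebras -/

/-- The algebra of `L`-decorated pseudo `k`-diagrams with concatenation as multiplication: the
subalgebra spanned by these diagrams. (It is written as the subalgebra that they generate, inside
the monoid algebra of all diagrams.) -/
def PL (k : ℕ) : Subalgebra ℤ[X] (MonoidAlgebra ℤ[X] (Diagram k)) :=
  Algebra.adjoin ℤ[X] (Set.range fun D : LDiagram k => MonoidAlgebra.of ℤ[X] (Diagram k) D.1)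

/-- An `L`-decorated diagram as an element of the algebra. -/
def PL.of {k : ℕ} (D : LDiagram k) : PL k :=
  ⟨MonoidAlgebra.of ℤ[X] (Diagram k) D.1, Algebra.subset_adjoin ⟨D, rfl⟩⟩

/-- The defining relations: an undecorated loop is replaced by the factor `δ`; two decorations on
the same edge cancel; beside a loop with a single decoration, a decoration on any other edge (arc
or loop) can be removed. -/
inductive HatRel (k : ℕ) : PL k → PL k → Prop
  | loop (P : Picture k) (h : (P.addLoop 0).IsLDecorated) (h' : P.IsLDecorated) :
      HatRel k (PL.of (.mk _ h)) ((X : ℤ[X]) • PL.of (.mk _ h'))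
  | cancel (P : Picture k) (e : P.E) (h : (P.decorate e 2).IsLDecorated) (h' : P.IsLDecorated) :
      HatRel k (PL.of (.mk _ h)) (PL.of (.mk _ h'))
  | absorb (P : Picture k) (e : P.E) (h : ((P.decorate e 1).addLoop 1).IsLDecorated)
      (h' : (P.addLoop 1).IsLDecorated) :
      HatRel k (PL.of (.mk _ h)) (PL.of (.mk _ h'))

/-- The quotient of the algebra of `L`-decorated diagrams by the defining relations. -/
abbrev PHat (k : ℕ) : Type 1 := RingQuot (HatRel k)

/-- The class of an `L`-decorated diagram. -/
def PHat.of {k : ℕ} (D : LDiagram k) : PHat k :=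
  RingQuot.mkAlgHom ℤ[X] (HatRel k) (PL.of D)

/-- The leftmost node (counted from `0`) of the two adjacent nodes that the `i`-th simple diagram
joins in each face: `d_{\bar 1}` and `d_1` join the first two nodes, and `d_i` joins the
nodes `i` and `i + 1` (counted from `1`). -/
def leftNode {n : ℕ} (i : Fin n) : ℕ := if i.val = 0 then 0 else i.val - 1

/-- The simple diagram `d_i` in the `n`-box (`d_{\bar 1}` for the index `0`). With `c` the left one
of the two nodes that are joined, its edge number `c` is the non-propagating edge in the north
face, its edge number `c + 1` is the one in the south face, and its edge number `x` for any other
`x` is vertical. The two non-propagating edges of `d_{\bar 1}` carry one decoration each, and there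
are no other decorations. -/
def simplePicture {n : ℕ} (hn : 4 ≤ n) (i : Fin n) : Picture n where
  E := Fin n
  edgeAt
    | Sum.inl x => if x.val = leftNode i + 1 then
        ⟨leftNode i, by unfold leftNode; split_ifs <;> omega⟩ else x
    | Sum.inr x => if x.val = leftNode i then
        ⟨leftNode i + 1, by unfold leftNode; split_ifs <;> omega⟩ else x
  dec e := if i.val = 0 ∧ (e.val = 0 ∨ e.val = 1) then 1 else 0

theorem leftNode_lt {n : ℕ} (hn : 4 ≤ n) (i : Fin n) : leftNode i + 1 < n := by
  unfold leftNode; split_ifs <;> omega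

theorem isLDecorated_of_val {n : ℕ} (P : Picture n) (m : ℕ) (v : P.E → ℕ)
    (hE : ∀ e e', e = e' ↔ v e = v e') (hv : ∀ e, v e < n) (hc : m + 1 < n)
    (hl : ∀ x : Fin n, v (P.edgeAt (Sum.inl x)) = if x.val = m + 1 then m else x.val)
    (hr : ∀ x : Fin n, v (P.edgeAt (Sum.inr x)) = if x.val = m then m + 1 else x.val)
    (hd : ∀ e, P.dec e ≠ 0 → m = 0 ∧ (v e = 0 ∨ v e = 1)) : P.IsLDecorated := by
  refine ⟨⟨fun e => Or.inr ?_, ?_⟩, ?_, ?_⟩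
  · obtain ⟨x, y, hxy, hS⟩ : ∃ x y : Node n, x ≠ y ∧
        ∀ z, P.edgeAt z = e ↔ z = x ∨ z = y := by
      by_cases h1 : v e = m
      · refine ⟨Sum.inl ⟨m, by omega⟩, Sum.inl ⟨m + 1, hc⟩, by simp, ?_⟩
        rintro (z | z) <;>
          simp only [hE, hl, hr, Sum.inl.injEq, reduceCtorEq, Fin.ext_iff,
            or_self, iff_false] <;> split_ifs <;> omega
      · by_cases h2 : v e = m + 1
        · refine ⟨Sum.inr ⟨m, by omega⟩, Sum.inr ⟨m + 1, hc⟩, by simp, ?_⟩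
          rintro (z | z) <;>
            simp only [hE, hl, hr, Sum.inr.injEq, reduceCtorEq, Fin.ext_iff,
            or_self, iff_false] <;>
            split_ifs <;> omega
        · refine ⟨Sum.inl ⟨v e, hv e⟩, Sum.inr ⟨v e, hv e⟩, by simp, ?_⟩
          rintro (z | z) <;>
            simp only [hE, hl, hr, Sum.inl.injEq, Sum.inr.injEq, reduceCtorEq, Fin.ext_iff,
            or_false, false_or] <;>
            split_ifs <;> omega
    have hS' : {z | P.edgeAt z = e} = {x, y} := Set.ext hS
    change Nat.card ({z | P.edgeAt z = e} : Set (Node n)) = 2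
    rw [hS', Nat.card_coe_set_eq, Set.ncard_pair hxy]
  · rintro (a | a) (b | b) (c | c) (d | d) <;>
      simp only [Node.pos, hE, hl, hr] <;> intros <;> split_ifs at * <;> omega
  · intro h
    exfalso
    have hf : Finite {e // ∃ i j : Fin n, i ≠ j ∧ P.edgeAt (Sum.inl i) = e ∧
        P.edgeAt (Sum.inl j) = e} := Subtype.finite
    refine Nat.card_ne_zero.2 ⟨⟨⟨P.edgeAt (Sum.inl ⟨m, by omega⟩), ⟨m, by omega⟩, ⟨m + 1, hc⟩,
      by simp, rfl, ?_⟩⟩, hf⟩ h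
    rw [hE, hl, hl]; simp
  · intro e he
    obtain ⟨rfl, he'⟩ := hd e he
    rintro ⟨a | a, b | b, c | c, h⟩ <;>
      simp only [Node.pos, hE, hl, hr] at h <;> split_ifs at h <;> first | omega | exact h.2.2.2.elim

theorem simplePicture_isLDecorated {n : ℕ} (hn : 4 ≤ n) (i : Fin n) :
    (simplePicture hn i).IsLDecorated := by
  refine isLDecorated_of_val (simplePicture hn i) (leftNode i) (fun e : Fin n => e.val)
    (fun e e' => Fin.ext_iff) (fun e => Fin.isLt e) (leftNode_lt hn i) ?_ ?_ ?_
  · intro x; simp only [simplePicture]; split_ifs <;> rfl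
  · intro x; simp only [simplePicture]; split_ifs <;> rfl
  · intro e he
    have h : i.val = 0 ∧ (Fin.val e = 0 ∨ Fin.val e = 1) := by
      by_contra hne
      exact he (if_neg hne)
    exact ⟨by simp [leftNode, h.1], h.2⟩

/-- The simple diagram `d_i` as an element of the quotient algebra. -/
def simpleHat {n : ℕ} (hn : 4 ≤ n) (i : Fin n) : PHat n :=
  PHat.of (.mk _ (simplePicture_isLDecorated hn i))

/-- The diagram algebra of type `D_n`, generated by the simple diagrams. -/
abbrev DTL {n : ℕ} (hn : 4 ≤ n) : Subalgebra ℤ[X] (PHat n) :=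
  Algebra.adjoin ℤ[X] (Set.range (simpleHat hn))

/-- The additional relation: a decorated loop is zero. -/
inductive LoopRel {n : ℕ} (hn : 4 ≤ n) : DTL hn → DTL hn → Prop
  | decorated (P : Picture n) (h : (P.addLoop 1).IsLDecorated)
      (hD : PHat.of (.mk _ h) ∈ DTL hn) : LoopRel hn ⟨PHat.of (.mk _ h), hD⟩ 0

/-- The loop-free diagram algebra of type `D_n`. -/
abbrev LFD {n : ℕ} (hn : 4 ≤ n) : Type 1 := RingQuot (LoopRel hn)

/-- The element `\bar d_i` of the loop-free diagram algebra. -/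
def LFD.d {n : ℕ} (hn : 4 ≤ n) (i : Fin n) : LFD hn :=
  RingQuot.mkAlgHom ℤ[X] (LoopRel hn) ⟨simpleHat hn i, Algebra.subset_adjoin ⟨i, rfl⟩⟩

/-- `x` is the image in the loop-free diagram algebra of the diagram `D` (which then belongs to the
diagram algebra of type `D_n`). -/
def IsImage {n : ℕ} (hn : 4 ≤ n) (D : LDiagram n) (x : LFD hn) : Prop :=
  ∃ hD : PHat.of D ∈ DTL hn, x = RingQuot.mkAlgHom ℤ[X] (LoopRel hn) ⟨PHat.of D, hD⟩

end TypeD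

end

/-! Everything is indexed by one combinatorial set, the normal lists of rows: products of descending
rows `row i j` whose tops `i` increase strictly and whose bottoms `j` increase strictly, except that
1 may be followed by 0. Three bijections or bases meet there.

Spanning. A normal word followed by a letter is, up to commutations, again normal or contains one of
the factors `ss`, `sts`, `01`, `10` (`Normal.append_letter`). In `PFTL` such a factor shortens the
monomial, up to a power of δ, or kills it; hence the normal monomials span (`mon_eq`, `span_mon`).

Diagrams. A loop-free diagram is encoded by a partner function on the 2n boundary positions, and
multiplication by a simple diagram from below becomes a `splice`. The top of the last row is the
last node that does not lie on an undecorated vertical arc; its bottom is the place of the rightmost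
undecorated south cup, or 0 if only a decorated cup at the left wall is available (`LastRow`). A
letter can be undone by another splice (`splice_splice`). So a normal list is recovered from its
pattern (`run_injective`), and every pattern with an even number of decorated arcs arises from a
normal list (`exists_normal`).

Independence. The simple diagrams satisfy the defining relations, which gives the homomorphism. To a
picture one assigns its arcs with the parities of their decorations, weighted by δ for each evenly
and by 0 for each oddly decorated loop. This is compatible with all diagram relations and so is
defined on `LFD` (`exists_value`), where it sends the images of normal monomials to distinct basis
vectors. These images are therefore independent, and basis and isomorphism follow (`exists_basis`).

Group elements. At δ = 2 the assignment `s_i ↦ 1 - b_i` is a representation of the Coxeter group,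
and the image of a word is, up to sign, its monomial plus monomials of shorter words. Comparing the
coefficient of a normal monomial shows that a word for the same group element that is not longer is
commutation equivalent to the normal word (`commEq_of_wordProd_eq`). So normal words are reduced,
fully commutative, of type II and pairwise distinct in the group. Conversely, a forbidden factor
cannot occur in the commutation class of a reduced expression of a fully commutative element of type
II (`exists_normalList`). -/

noncomputable section

namespace TypeD

section

/-! ## Normal forms of words -/

/-- Adjacency in the Coxeter graph, for generators indexed by natural numbers. -/
def Adj (i j : ℕ) : Prop :=
  (1 ≤ i ∧ j = i + 1) ∨ (1 ≤ j ∧ i = j + 1) ∨ (i = 0 ∧ j = 2) ∨ (j = 0 ∧ i = 2)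

/-- A single commutation move on words of natural numbers. -/
def CommStep (ω ω' : List ℕ) : Prop :=
  ∃ (l r : List ℕ) (s t : ℕ), s ≠ t ∧ ¬ Adj s t ∧ ω = l ++ [s, t] ++ r ∧ ω' = l ++ [t, s] ++ r

/-- Commutation equivalence of words. -/
def CommEq : List ℕ → List ℕ → Prop := Relation.ReflTransGen CommStep

theorem Adj.symm {i j : ℕ} (h : Adj i j) : Adj j i := by unfold Adj at *; omega

theorem CommStep.symm {ω ω' : List ℕ} (h : CommStep ω ω') : CommStep ω' ω := by
  obtain ⟨l, r, s, t, h1, h2, h3, h4⟩ := h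
  exact ⟨l, r, t, s, h1.symm, fun h => h2 h.symm, h4, h3⟩

namespace CommEq

theorem refl (ω : List ℕ) : CommEq ω ω := Relation.ReflTransGen.refl

theorem trans {ω ω' ω'' : List ℕ} (h : CommEq ω ω') (h' : CommEq ω' ω'') : CommEq ω ω'' :=
  Relation.ReflTransGen.trans h h'

theorem symm {ω ω' : List ℕ} (h : CommEq ω ω') : CommEq ω' ω := by
  induction h with
  | refl => exact refl _
  | tail _ h ih => exact Relation.ReflTransGen.head h.symm ih

theorem append {ω ω' : List ℕ} (h : CommEq ω ω') (l r : List ℕ) :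
    CommEq (l ++ ω ++ r) (l ++ ω' ++ r) := by
  induction h with
  | refl => exact refl _
  | tail _ h ih =>
    obtain ⟨a, b, s, t, h1, h2, rfl, rfl⟩ := h
    exact ih.tail ⟨l ++ a, b ++ r, s, t, h1, h2, by simp, by simp⟩

theorem append_right {ω ω' : List ℕ} (h : CommEq ω ω') (r : List ℕ) :
    CommEq (ω ++ r) (ω' ++ r) := h.append [] r

theorem append_left {ω ω' : List ℕ} (h : CommEq ω ω') (l : List ℕ) :
    CommEq (l ++ ω) (l ++ ω') := by simpa using h.append l []

theorem perm {ω ω' : List ℕ} (h : CommEq ω ω') : ω.Perm ω' := by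
  induction h with
  | refl => exact List.Perm.refl _
  | tail _ h ih =>
    obtain ⟨a, b, s, t, h1, h2, rfl, rfl⟩ := h
    exact ih.trans (((List.Perm.swap t s []).append_left a).append_right b)

/-- A letter moves across a word with all of whose letters it commutes. -/
theorem move {s : ℕ} {C : List ℕ} (h : ∀ t ∈ C, s ≠ t ∧ ¬ Adj s t) :
    CommEq ([s] ++ C) (C ++ [s]) := by
  induction C with
  | nil => exact refl _
  | cons t C ih =>
    have h1 : CommEq ([s] ++ t :: C) ([t] ++ ([s] ++ C)) :=
      Relation.ReflTransGen.single ⟨[], C, s, t, (h t (by simp)).1, (h t (by simp)).2, rfl, rfl⟩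
    exact h1.trans ((ih fun x hx => h x (by simp [hx])).append_left [t])

end CommEq

/-- The words that are not reduced expressions of type II fully commutative elements. -/
def Forbidden (x : List ℕ) : Prop :=
  (∃ s, x = [s, s]) ∨ (∃ s t, Adj s t ∧ x = [s, t, s]) ∨ x = [0, 1] ∨ x = [1, 0]

/-- A word is reducible if some word in its commutation class has a forbidden factor. -/
def Reducible (ω : List ℕ) : Prop :=
  ∃ l x r, Forbidden x ∧ CommEq ω (l ++ x ++ r)

theorem Reducible.congr {ω ω' : List ℕ} (h : Reducible ω) (h' : CommEq ω' ω) : Reducible ω' := by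
  obtain ⟨l, x, r, hx, h⟩ := h
  exact ⟨l, x, r, hx, h'.trans h⟩

theorem Reducible.append {ω : List ℕ} (h : Reducible ω) (l r : List ℕ) :
    Reducible (l ++ ω ++ r) := by
  obtain ⟨a, x, b, hx, h⟩ := h
  exact ⟨l ++ a, x, b ++ r, hx, by simpa using h.append l r⟩

theorem Reducible.append_right {ω : List ℕ} (h : Reducible ω) (r : List ℕ) :
    Reducible (ω ++ r) := h.append [] r

theorem Reducible.append_left {ω : List ℕ} (h : Reducible ω) (l : List ℕ) :
    Reducible (l ++ ω) := by simpa using h.append l []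

theorem Forbidden.reducible {x : List ℕ} (h : Forbidden x) : Reducible x :=
  ⟨[], x, [], h, by simpa using CommEq.refl x⟩

/-- The letter that precedes `j` in a descending row. -/
def up (j : ℕ) : ℕ := if j < 2 then 2 else j + 1

theorem up_eq (j : ℕ) : (j < 2 ∧ up j = 2) ∨ (2 ≤ j ∧ up j = j + 1) := by
  unfold up; split_ifs <;> omega

theorem adj_up (j : ℕ) : Adj (up j) j := by
  have := up_eq j; unfold Adj; omega

/-- The descending row `i, i - 1, …, j`, where both `0` and `1` may follow `2`. -/
def row (i j : ℕ) : List ℕ :=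
  if up j ≤ i then row i (up j) ++ [j] else [j]
termination_by i + 1 - up j
decreasing_by have := up_eq j; have := up_eq (up j); omega

theorem row_of_le {i j : ℕ} (h : up j ≤ i) : row i j = row i (up j) ++ [j] := by
  rw [row, if_pos h]

theorem row_of_lt {i j : ℕ} (h : i < up j) : row i j = [j] := by
  rw [row, if_neg (by omega)]

/-- Induction along a row, from its first letter to its last one. -/
theorem row_induction {i : ℕ} {P : ℕ → Prop} (h0 : ∀ j, i < up j → P j)
    (h1 : ∀ j, up j ≤ i → P (up j) → P j) (j : ℕ) : P j :=
  if h : up j ≤ i then h1 j h (row_induction h0 h1 (up j)) else h0 j (by omega)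
termination_by i + 1 - up j
decreasing_by have := up_eq j; have := up_eq (up j); omega

/-- The bound on the earlier letters is what lets a letter `s` with `up s = j` pass all of them and
come to stand next to `j`. -/
theorem exists_row_eq_append (i j : ℕ) : ∃ C, row i j = C ++ [j] ∧ ∀ t ∈ C, up j ≤ t := by
  induction j using row_induction (i := i) with
  | h0 j h => exact ⟨[], by rw [row_of_lt h]; rfl, by simp⟩
  | h1 j h ih =>
    obtain ⟨C, hC, hC'⟩ := ih
    refine ⟨row i (up j), row_of_le h, fun t ht => ?_⟩
    rw [hC] at ht
    have := up_eq (up j)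
    have := up_eq j
    rcases List.mem_append.1 ht with ht | ht
    · have := hC' t ht; omega
    · simp at ht; omega

theorem le_of_mem_row {i j t : ℕ} (ht : t ∈ row i j) : j ≤ t := by
  obtain ⟨C, hC, hC'⟩ := exists_row_eq_append i j
  rw [hC] at ht
  rcases List.mem_append.1 ht with ht | ht
  · have := hC' t ht; have := up_eq j; omega
  · simp at ht; omega

theorem mem_row_le {i j t : ℕ} (hj : j ≤ i) (ht : t ∈ row i j) : t ≤ i := by
  induction j using row_induction (i := i) with
  | h0 j h => rw [row_of_lt h] at ht; simp at ht; omega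
  | h1 j h ih =>
    rw [row_of_le h] at ht
    rcases List.mem_append.1 ht with ht | ht
    · exact ih h ht
    · simp at ht; omega

/-- The letter `s` already occurs in the row, followed by a lower neighbour `t`. The appended `s`
commutes with everything after `t`, so it moves back and produces the factor `s t s`. -/
theorem row_append_reducible {i j s : ℕ} (h1 : up j ≤ s) (h2 : s ≤ i) :
    Reducible (row i j ++ [s]) := by
  induction j using row_induction (i := i) with
  | h0 j h => omega
  | h1 j h ih =>
    have := up_eq j
    rcases h1.eq_or_lt with rfl | h1
    · obtain ⟨C, hC, -⟩ := exists_row_eq_append i (up j)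
      rw [row_of_le h, hC]
      have : Forbidden [up j, j, up j] := Or.inr (Or.inl ⟨_, _, adj_up j, rfl⟩)
      simpa using this.reducible.append_left C
    · have h3 : up (up j) ≤ s := by have := up_eq (up j); omega
      rw [row_of_le h]
      refine ((ih h3).append_right [j]).congr ?_
      have : CommEq [j, s] [s, j] :=
        Relation.ReflTransGen.single ⟨[], [], j, s, by omega, by unfold Adj; omega, rfl, rfl⟩
      simpa using this.append_left (row i (up j))

/-- `RowAfter t i j`: the row from `i` to `j` may follow the rows `t`, listed from the last to the
first. -/
def RowAfter : List (ℕ × ℕ) → ℕ → ℕ → Prop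
  | [], _, _ => True
  | (i', j') :: _, i, j => i' < i ∧ (j' < j ∨ (j' = 1 ∧ j = 0))

/-- Normal lists of rows, listed from the last to the first. -/
def Normal (n : ℕ) : List (ℕ × ℕ) → Prop
  | [] => True
  | (i, j) :: t => 1 ≤ i ∧ i < n ∧ j ≤ i ∧ RowAfter t i j ∧ Normal n t

/-- The word that consists of the given rows. -/
def rowsWord : List (ℕ × ℕ) → List ℕ
  | [] => []
  | (i, j) :: t => rowsWord t ++ row i j

theorem Normal.pred {n i j : ℕ} {t : List (ℕ × ℕ)} (h : Normal n ((i, j) :: t)) (hu : up j ≤ i) :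
    Normal n ((i, up j) :: t) := by
  obtain ⟨h1, h2, h3, h4, h5⟩ := h
  refine ⟨h1, h2, hu, ?_, h5⟩
  have := up_eq j
  match t with
  | [] => trivial
  | (i', j') :: t => exact ⟨h4.1, by have := h4.2; omega⟩

theorem rowsWord_up {i j : ℕ} {t : List (ℕ × ℕ)} (hu : up j ≤ i) :
    rowsWord ((i, j) :: t) = rowsWord ((i, up j) :: t) ++ [j] := by
  simp [rowsWord, row_of_le hu]

theorem rowsWord_single {i j : ℕ} {t : List (ℕ × ℕ)} (hu : i < up j) :
    rowsWord ((i, j) :: t) = rowsWord t ++ [j] := by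
  simp [rowsWord, row_of_lt hu]

/-- A normal word followed by a letter is reducible or equivalent to a normal word. -/
theorem Normal.append_letter {n : ℕ} (hn : 2 ≤ n) {L : List (ℕ × ℕ)} (hL : Normal n L) {s : ℕ}
    (hs : s < n) : Reducible (rowsWord L ++ [s]) ∨ ∃ L', Normal n L' ∧
      CommEq (rowsWord L ++ [s]) (rowsWord L') ∧
      ∀ i j, RowAfter L i j → s < j → 2 ≤ j → j ≤ i → RowAfter L' i j := by
  induction L with
  | nil =>
    -- Tops of rows are at least 1, so the single letter 0 is recorded as the row from 1 to 0.
    refine Or.inr ⟨[(max s 1, s)], ⟨by omega, by omega, by omega, trivial, trivial⟩, ?_, ?_⟩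
    · rw [rowsWord_single (by have := up_eq s; omega)]; exact CommEq.refl _
    · intro i j _ h1 h2 h3; exact ⟨by omega, by omega⟩
  | cons ij t ih =>
    obtain ⟨i, j⟩ := ij
    obtain ⟨h1, h2, h3, h4, h5⟩ := hL
    have hj := up_eq j
    have hus := up_eq s
    rcases lt_or_ge i s with his | his
    · refine Or.inr ⟨(s, s) :: (i, j) :: t, ⟨by omega, hs, le_rfl, ⟨his, by omega⟩,
        h1, h2, h3, h4, h5⟩, ?_, ?_⟩
      · rw [rowsWord_single (i := s) (by omega)]; exact CommEq.refl _
      · intro i j _ h1 h2 h3; exact ⟨by omega, by omega⟩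
    obtain ⟨C, hC, hC'⟩ := exists_row_eq_append i j
    by_cases hsj : s = j ∨ (s < 2 ∧ j < 2)
    · left
      have : Forbidden [j, s] := by
        by_cases h : s = j
        · exact Or.inl ⟨s, by rw [h]⟩
        · have : (j = 0 ∧ s = 1) ∨ (j = 1 ∧ s = 0) := by omega
          rcases this with ⟨rfl, rfl⟩ | ⟨rfl, rfl⟩
          · exact Or.inr (Or.inr (Or.inl rfl))
          · exact Or.inr (Or.inr (Or.inr rfl))
      have := this.reducible.append_left (rowsWord t ++ C)
      simpa [rowsWord, hC] using this
    by_cases hus' : up j ≤ s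
    · left
      have := (row_append_reducible hus' his).append_left (rowsWord t)
      simpa [rowsWord] using this
    by_cases hsu : up s = j
    · by_cases hok : RowAfter t i s
      · refine Or.inr ⟨(i, s) :: t, ⟨h1, h2, his, hok, h5⟩, ?_, ?_⟩
        · rw [rowsWord_up (j := s) (by omega), hsu]; exact CommEq.refl _
        · intro i' j' h h' _ _; exact ⟨h.1, Or.inl h'⟩
      -- The extended row is refused only if the preceding row also ends in `s`. All letters of the
      -- current row before `j` commute with `s`, so that earlier `s` moves up to `j` and the factor
      -- `s j s` appears.
      · left
        match t, h4, hok with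
        | [], _, hok => exact (hok trivial).elim
        | (i', j') :: t, h4, hok =>
          have hj' : j' = s := by
            simp only [RowAfter] at h4 hok
            omega
          subst hj'
          obtain ⟨C', hC1, -⟩ := exists_row_eq_append i' j'
          have hm : CommEq ([j'] ++ C) (C ++ [j']) := CommEq.move fun x hx => by
            have := hC' x hx
            unfold Adj
            omega
          have hf : Forbidden [j', j, j'] := Or.inr (Or.inl ⟨_, _, hsu ▸ (adj_up j').symm, rfl⟩)
          have h6 := hm.append (rowsWord t ++ C') [j, j']
          have h7 := hf.reducible.append_left (rowsWord t ++ C' ++ C)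
          refine Reducible.congr (by simpa using h7) (ω := rowsWord t ++ C' ++ (C ++ [j']) ++ [j, j'])
            (ω' := rowsWord ((i, j) :: (i', j') :: t) ++ [j']) ?_
          simpa [rowsWord, hC, hC1] using h6
    -- Here `s` lies below the last row and commutes with all of it, so it is inserted into the
    -- earlier rows. The final clause of the induction hypothesis ensures that the last row may
    -- still follow them.
    · have hm : CommEq (rowsWord t ++ row i j ++ [s]) (rowsWord t ++ [s] ++ row i j) := by
        have : CommEq ([s] ++ row i j) (row i j ++ [s]) := CommEq.move fun x hx => by
          have := le_of_mem_row hx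
          unfold Adj
          omega
        simpa using this.symm.append_left (rowsWord t)
      rcases ih h5 with h | ⟨L', hL', hc, hr⟩
      · exact Or.inl ((h.append_right (row i j)).congr hm)
      · refine Or.inr ⟨(i, j) :: L', ⟨h1, h2, h3, hr i j h4 (by omega) (by omega) h3, hL'⟩, ?_, ?_⟩
        · exact hm.trans (hc.append_right _)
        · intro i' j' h _ _ _; exact h

theorem reducible_or_normal {n : ℕ} (hn : 2 ≤ n) (ω : List ℕ) (hω : ∀ s ∈ ω, s < n) :
    Reducible ω ∨ ∃ L, Normal n L ∧ CommEq ω (rowsWord L) := by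
  induction ω using List.reverseRecOn with
  | nil => exact Or.inr ⟨[], trivial, CommEq.refl _⟩
  | append_singleton ω s ih =>
    rcases ih fun x hx => hω x (by simp [hx]) with h | ⟨L, hL, hc⟩
    · exact Or.inl (h.append_right _)
    · rcases hL.append_letter hn (hω s (by simp)) with h | ⟨L', hL', hc', -⟩
      · exact Or.inl (h.congr (hc.append_right _))
      · exact Or.inr ⟨L', hL', (hc.append_right _).trans hc'⟩

theorem Normal.lt_of_mem {n : ℕ} {L : List (ℕ × ℕ)} (hL : Normal n L) {s : ℕ}
    (hs : s ∈ rowsWord L) : s < n := by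
  induction L with
  | nil => simp [rowsWord] at hs
  | cons ij t ih =>
    obtain ⟨h1, h2, h3, -, h5⟩ := hL
    rcases List.mem_append.1 hs with hs | hs
    · exact ih h5 hs
    · have := mem_row_le h3 hs; omega

end

section

/-! ## Arc patterns

A loop-free diagram in the `n`-box is recorded on the positions `0, …, 2 * n - 1` of its nodes. -/

/-- The partner of each position, and the positions whose arc is decorated. -/
@[ext]
structure ArcData where
  p : ℕ → ℕ
  q : ℕ → Bool

namespace ArcData

/-- Noncrossing patterns on `0, …, 2 * n - 1` whose decorated arcs are exposed to the left. -/
structure Valid (n : ℕ) (r : ArcData) : Prop where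
  inv : ∀ x, r.p (r.p x) = x
  lt : ∀ x, x < 2 * n → r.p x < 2 * n
  ne : ∀ x, x < 2 * n → r.p x ≠ x
  out_p : ∀ x, 2 * n ≤ x → r.p x = x
  out_q : ∀ x, 2 * n ≤ x → r.q x = false
  q_p : ∀ x, r.q (r.p x) = r.q x
  nc : ∀ x y, ¬ (x < y ∧ y < r.p x ∧ r.p x < r.p y)
  ex : ∀ x y, r.q y = true → ¬ (x < y ∧ y < r.p x)

/-- Joins the partners of `u` and `v` with each other, and `u` with `v`. If `ε` holds, both new
arcs receive one more decoration. -/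
def splice (r : ArcData) (u v : ℕ) (ε : Bool) : ArcData where
  p x := if x = u then v else if x = v then u else if x = r.p u then r.p v else
    if x = r.p v then r.p u else r.p x
  q x := if x = u ∨ x = v then ε else if x = r.p u ∨ x = r.p v then r.q u ^^ r.q v ^^ ε else r.q x

variable {n : ℕ} {r : ArcData}

/-- The field `nc` excludes crossings only for one order of the four ends. Applied to every choice
of ends of the two arcs, it says that an arc has both or none of its ends under another arc. -/
theorem Valid.side (hr : r.Valid n) {x y : ℕ} (h1 : y ≠ x) (h2 : y ≠ r.p x) :
    (x < y ∧ y < r.p x ∨ r.p x < y ∧ y < x) ↔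
      (x < r.p y ∧ r.p y < r.p x ∨ r.p x < r.p y ∧ r.p y < x) := by
  have ix := hr.inv x
  have iy := hr.inv y
  have a1 := hr.nc x y
  have a2 := hr.nc y x
  have a3 := hr.nc x (r.p y)
  have a4 := hr.nc (r.p y) x
  have a5 := hr.nc (r.p x) y
  have a6 := hr.nc y (r.p x)
  have a7 := hr.nc (r.p x) (r.p y)
  have a8 := hr.nc (r.p y) (r.p x)
  rw [ix] at a5 a6 a7 a8
  rw [iy] at a3 a4 a7 a8
  have b1 : r.p y ≠ x := fun h => h2 (by rw [← h, iy])
  have b2 : r.p y ≠ r.p x := fun h => h1 (by rw [← iy, h, ix])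
  omega

/-- All case distinctions about a splice go through this list. The third and fourth cases arise only
when `u` and `v` are not already joined; the recorded disequalities are there for `omega`. -/
theorem Valid.splice_cases (hr : r.Valid n) {u v : ℕ} (ε : Bool) (huv : u ≠ v) (x : ℕ) :
    (x = u ∧ (r.splice u v ε).p x = v) ∨ (x = v ∧ (r.splice u v ε).p x = u) ∨
    (x ≠ u ∧ x ≠ v ∧ x = r.p u ∧ r.p x = u ∧ r.p u ≠ v ∧ r.p v ≠ u ∧ r.p v ≠ r.p u ∧
      (r.splice u v ε).p x = r.p v) ∨
    (x ≠ u ∧ x ≠ v ∧ x = r.p v ∧ r.p x = v ∧ r.p u ≠ v ∧ r.p v ≠ u ∧ r.p v ≠ r.p u ∧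
      (r.splice u v ε).p x = r.p u) ∨
    (x ≠ u ∧ x ≠ v ∧ x ≠ r.p u ∧ x ≠ r.p v ∧ (r.splice u v ε).p x = r.p x ∧
      r.p x ≠ u ∧ r.p x ≠ v ∧ r.p x ≠ r.p u ∧ r.p x ≠ r.p v) := by
  have iu := hr.inv u
  have iv := hr.inv v
  have ix := hr.inv x
  have inj : ∀ a b, r.p a = r.p b → a = b := fun a b h => by rw [← hr.inv a, h, hr.inv]
  have h1 : r.p v ≠ r.p u := fun h => huv (inj _ _ h).symm
  simp only [splice]
  by_cases hxu : x = u
  · left; simp [hxu]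
  by_cases hxv : x = v
  · right; left; simp [hxv, huv.symm]
  by_cases hxa : x = r.p u
  · right; right; left
    have h2 : r.p u ≠ v := fun h => hxv (by rw [hxa, h])
    have h3 : r.p v ≠ u := fun h => h2 (by rw [← h, iv])
    refine ⟨hxu, hxv, hxa, by rw [hxa, iu], h2, h3, h1, ?_⟩
    rw [← hxa]; simp [hxu, hxv]
  by_cases hxb : x = r.p v
  · right; right; right; left
    have h3 : r.p v ≠ u := fun h => hxu (by rw [hxb, h])
    have h2 : r.p u ≠ v := fun h => h3 (by rw [← h, iu])
    refine ⟨hxu, hxv, hxb, by rw [hxb, iv], h2, h3, h1, by simp [hxu, hxv, hxa, ← hxb]⟩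
  · right; right; right; right
    refine ⟨hxu, hxv, hxa, hxb, by simp [hxu, hxv, hxa, hxb], ?_, ?_, ?_, ?_⟩
    · intro h; exact hxa (by rw [← h, ix])
    · intro h; exact hxb (by rw [← h, ix])
    · intro h; exact hxu (inj _ _ h)
    · intro h; exact hxv (inj _ _ h)

theorem Valid.bound (hr : r.Valid n) (x : ℕ) :
    (x < 2 * n ∧ r.p x < 2 * n ∧ r.p x ≠ x) ∨ (2 * n ≤ x ∧ r.p x = x) := by
  rcases lt_or_ge x (2 * n) with h | h
  · exact Or.inl ⟨h, hr.lt x h, hr.ne x h⟩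
  · exact Or.inr ⟨h, hr.out_p x h⟩

/-- The interval between `u` and `v` is a union of undecorated arcs. -/
def Closed (r : ArcData) (u v : ℕ) : Prop :=
  ∀ x, u < x → x < v → u < r.p x ∧ r.p x < v ∧ r.q x = false

theorem Valid.closed_iff (hr : r.Valid n) {u v : ℕ} (h : r.Closed u v) (x : ℕ) :
    (u < x ∧ x < v) ↔ (u < r.p x ∧ r.p x < v) := by
  have h1 := h x
  have h2 := h (r.p x)
  rw [hr.inv] at h2
  exact ⟨fun h => ⟨(h1 h.1 h.2).1, (h1 h.1 h.2).2.1⟩, fun h => ⟨(h2 h.1 h.2).1, (h2 h.1 h.2).2.1⟩⟩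

/-- Nothing crosses the new arc from `u` to `v`, because the interval between them is a union of
arcs. The other new arc runs along the two old arcs at `u` and `v`, so a third arc that separates
its ends would have to cross one of these or enter the interval; `side` excludes both. -/
theorem Valid.splice_nc (hr : r.Valid n) {u v : ℕ} (ε : Bool) (huv : u < v)
    (hin : r.Closed u v) (x y : ℕ) : ¬ (x < y ∧ y < (r.splice u v ε).p x ∧
      (r.splice u v ε).p x < (r.splice u v ε).p y) := by
  rintro ⟨h1, h2, h3⟩
  have hc := hr.splice_cases ε huv.ne
  have iu := hr.inv u
  have iv := hr.inv v
  have hin' := hr.closed_iff hin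
  have ia := hin' (r.p u)
  have ib := hin' (r.p v)
  rcases hc x with h | h | h | h | h
  · have := hin' y
    rcases hc y with h' | h' | h' | h' | h' <;> omega
  · omega
  · rcases hc y with h' | h' | h' | h' | h'
    any_goals omega
    have s1 := hr.side h'.1 h'.2.2.1
    have s2 := hr.side h'.2.1 h'.2.2.2.1
    have s3 := hin' y
    omega
  · rcases hc y with h' | h' | h' | h' | h'
    any_goals omega
    have s1 := hr.side h'.1 h'.2.2.1
    have s2 := hr.side h'.2.1 h'.2.2.2.1
    have s3 := hin' y
    omega
  · have s3 := hin' x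
    rcases hc y with h' | h' | h' | h' | h'
    any_goals omega
    · have s1 := hr.side h.1 h.2.2.1
      have s2 := hr.side h.2.1 h.2.2.2.1
      omega
    · have s1 := hr.side h.1 h.2.2.1
      have s2 := hr.side h.2.1 h.2.2.2.1
      omega
    · have := hr.nc x y
      omega

/-- If the arc from `u` to `v` is decorated, it ends at the last position and nothing covers it. An
arc over the other new arc would cover both old arcs, one of which is decorated unless the
decoration comes from `ε`. An old decorated arc lies outside the closed interval; a new arc that
covers it would force an old arc at `u` or `v` to cover it too. -/
theorem Valid.splice_ex (hr : r.Valid n) {u v : ℕ} {ε : Bool} (huv : u < v)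
    (hin : r.Closed u v) (hε : ε = true → v + 1 = 2 * n) (x y : ℕ)
    (hq : (r.splice u v ε).q y = true) : ¬ (x < y ∧ y < (r.splice u v ε).p x) := by
  rintro ⟨h1, h2⟩
  have hc := hr.splice_cases ε huv.ne x
  have iu := hr.inv u
  have iv := hr.inv v
  have hin' := hr.closed_iff hin
  have ia := hin' (r.p u)
  have ib := hin' (r.p v)
  have ix := hin' x
  have bu := hr.bound u
  have bv := hr.bound v
  have bx := hr.bound x
  simp only [ArcData.splice] at hq
  by_cases hy1 : y = u ∨ y = v
  · rw [if_pos hy1] at hq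
    have := hε hq
    omega
  rw [if_neg hy1] at hq
  by_cases hy2 : y = r.p u ∨ y = r.p v
  · rw [if_pos hy2] at hq
    have hd : r.q u = true ∨ r.q v = true ∨ ε = true := by
      by_contra hh
      simp only [not_or, Bool.not_eq_true] at hh
      simp [hh.1, hh.2.1, hh.2.2] at hq
    rcases hc with h | h | h | h | h
    any_goals omega
    have s1 := hr.side h.1 h.2.2.1
    have s2 := hr.side h.2.1 h.2.2.2.1
    rcases hd with hd | hd | hd
    · have := hr.ex x u hd
      have := hr.ex x (r.p u) (by rw [hr.q_p, hd])
      omega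
    · have := hr.ex x v hd
      have := hr.ex x (r.p v) (by rw [hr.q_p, hd])
      omega
    · have := hε hd
      omega
  · rw [if_neg hy2] at hq
    have hyi : ¬ (u < y ∧ y < v) := fun h => by
      have := (hin y h.1 h.2).2.2
      rw [hq] at this; exact Bool.noConfusion this
    have e5 := hr.ex x y hq
    have e6 := hr.ex u y hq
    have e7 := hr.ex v y hq
    have e8 := hr.ex (r.p u) y hq
    have e9 := hr.ex (r.p v) y hq
    omega

theorem Valid.valid_splice (hr : r.Valid n) {u v : ℕ} {ε : Bool} (huv : u < v) (hv : v < 2 * n)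
    (hin : r.Closed u v) (hε : ε = true → v + 1 = 2 * n) : (r.splice u v ε).Valid n := by
  have hc := hr.splice_cases ε huv.ne
  have bu := hr.bound u
  have bv := hr.bound v
  refine ⟨fun x => ?_, fun x hx => ?_, fun x hx => ?_, fun x hx => ?_, fun x hx => ?_, fun x => ?_,
    hr.splice_nc ε huv hin, hr.splice_ex huv hin hε⟩
  · have hcx := hc x
    have hcpx := hc ((r.splice u v ε).p x)
    have ix := hr.inv x
    have iu := hr.inv u
    have iv := hr.inv v
    rcases hcx with h | h | h | h | h
    · rw [h.2] at hcpx ⊢; omega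
    · rw [h.2] at hcpx ⊢; omega
    · rw [h.2.2.2.2.2.2.2] at hcpx ⊢; omega
    · rw [h.2.2.2.2.2.2.2] at hcpx ⊢; omega
    · rw [h.2.2.2.2.1] at hcpx ⊢; omega
  · have := hc x; have := hr.bound x; omega
  · have := hc x; have := hr.bound x; omega
  · have := hc x; have := hr.bound x; omega
  · have := hr.out_q x hx
    simp only [ArcData.splice]
    rw [if_neg (by omega), if_neg (by omega), this]
  · have hqx := hr.q_p x
    have hx := hc x
    simp only [ArcData.splice] at hx ⊢
    rcases hx with h | h | h | h | h
    · rw [h.2, h.1]; simp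
    · rw [h.2, h.1]; simp
    · rw [h.2.2.2.2.2.2.2, if_neg (by omega), if_pos (by omega), if_neg (by omega),
        if_pos (by omega)]
    · rw [h.2.2.2.2.2.2.2, if_neg (by omega), if_pos (by omega), if_neg (by omega),
        if_pos (by omega)]
    · rw [h.2.2.2.2.1, if_neg (by omega), if_neg (by omega), if_neg (by omega),
        if_neg (by omega), hqx]

/-- A zigzag is pulled straight: the second splice rejoins `w` with its old partner, and the
decorations added on the way cancel in pairs. This is the relation `b_i b_j b_i = b_i`, and it is
also the means by which a letter is undone. -/
theorem Valid.splice_splice (hr : r.Valid n) {u v w : ℕ} {ε ε' : Bool} (huv : u ≠ v)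
    (huw : u ≠ w) (hvw : v ≠ w) (hp : r.p u = v) (hq : r.q u = ε) (hw : w < 2 * n) :
    (r.splice v w ε').splice u v ε = r := by
  have hv : r.p v = u := by rw [← hp, hr.inv]
  have hqv : r.q v = ε := by rw [← hp, hr.q_p, hq]
  have iw := hr.inv w
  have hnw := hr.ne w hw
  have hqw := hr.q_p w
  have w1 : r.p w ≠ u := fun h => hvw (by rw [← hp, ← h, iw])
  have w2 : r.p w ≠ v := fun h => huw (by rw [← hv, ← h, iw])
  have hc := hr.splice_cases ε' hvw
  have eu : (r.splice v w ε').p u = r.p w := by have := hc u; omega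
  have ev : (r.splice v w ε').p v = w := by have := hc v; omega
  have qu : (r.splice v w ε').q u = (ε ^^ r.q w ^^ ε') := by
    simp only [ArcData.splice]; rw [if_neg (by omega), if_pos (by omega), hqv]
  have qv : (r.splice v w ε').q v = ε' := by
    simp [ArcData.splice]
  ext x
  · show (if x = u then v else if x = v then u else if x = (r.splice v w ε').p u then
      (r.splice v w ε').p v else if x = (r.splice v w ε').p v then (r.splice v w ε').p u else
      (r.splice v w ε').p x) = r.p x
    rw [eu, ev]
    split_ifs with h1 h2 h3 h4
    · rw [h1, hp]
    · rw [h2, hv]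
    · rw [h3, iw]
    · rw [h4]
    · have := hc x
      omega
  · show (if x = u ∨ x = v then ε else if x = (r.splice v w ε').p u ∨ x = (r.splice v w ε').p v
      then ((r.splice v w ε').q u ^^ (r.splice v w ε').q v ^^ ε) else (r.splice v w ε').q x) = r.q x
    rw [eu, ev, qu, qv]
    split_ifs with h1 h2
    · rcases h1 with rfl | rfl
      · exact hq.symm
      · exact hqv.symm
    · have : r.q x = r.q w := by
        rcases h2 with rfl | rfl
        · exact hqw
        · rfl
      rw [this]
      cases ε <;> cases ε' <;> cases r.q w <;> rfl
    · simp only [ArcData.splice]; rw [if_neg (by omega), if_neg (by omega)]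

theorem Valid.splice_comm (hr : r.Valid n) {u v : ℕ} (ε : Bool) (huv : u ≠ v) :
    r.splice u v ε = r.splice v u ε := by
  have hc := hr.splice_cases ε huv
  have hc' := hr.splice_cases ε huv.symm
  ext x
  · have := hc x; have := hc' x; omega
  · simp only [ArcData.splice, or_comm (a := x = v), or_comm (a := x = r.p v), Bool.xor_comm (r.q u)]

end ArcData

end

/-! ### The action of letters and rows on arc patterns -/

section

namespace ArcData

variable {n : ℕ} {r : ArcData}

theorem splice_q (r : ArcData) (u v : ℕ) (ε : Bool) (x : ℕ) : (r.splice u v ε).q x =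
    if x = u ∨ x = v then ε else if x = r.p u ∨ x = r.p v then r.q u ^^ r.q v ^^ ε else r.q x := rfl

/-- The number of decorated arcs is even. -/
def EvenDec (n : ℕ) (r : ArcData) : Prop := 4 ∣ ∑ x ∈ Finset.range (2 * n), (r.q x).toNat

/-- The sum counts every decorated arc at both ends, whence the 4 in `EvenDec`. Two arcs with
decorations `a`, `b` are replaced by arcs with decorations `ε` and `a ^^ b ^^ ε`, of the same total
parity. If `u` and `v` are already joined, `hl` says that no decoration changes. -/
theorem Valid.evenDec_splice (hr : r.Valid n) (he : r.EvenDec n) {u v : ℕ} {ε : Bool}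
    (huv : u ≠ v) (hu : u < 2 * n) (hv : v < 2 * n) (hl : r.p u = v → r.q u = ε) :
    (r.splice u v ε).EvenDec n := by
  by_cases h : r.p u = v
  · have hq := hl h
    have hv' : r.p v = u := by rw [← h, hr.inv]
    have : (r.splice u v ε).q = r.q := by
      funext x
      simp only [ArcData.splice]
      split_ifs with h1 h2
      · rcases h1 with rfl | rfl
        · exact hq.symm
        · rw [← h, hr.q_p, hq]
      · omega
      · rfl
    rwa [EvenDec, this]
  · have hu' : r.p v ≠ u := fun h' => h (by rw [← h', hr.inv])
    have hne : r.p v ≠ r.p u := fun h' => huv (by rw [← hr.inv u, ← h', hr.inv])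
    have h1 := hr.bound u
    have h2 := hr.bound v
    have hS : ({u, v, r.p u, r.p v} : Finset ℕ) ⊆ Finset.range (2 * n) := by
      intro x hx
      simp only [Finset.mem_insert, Finset.mem_singleton] at hx
      rw [Finset.mem_range]
      omega
    have hsum : ∀ f : ℕ → ℕ, ∑ x ∈ ({u, v, r.p u, r.p v} : Finset ℕ), f x =
        f u + (f v + (f (r.p u) + f (r.p v))) := by
      intro f
      rw [Finset.sum_insert, Finset.sum_insert, Finset.sum_insert, Finset.sum_singleton]
      all_goals simp only [Finset.mem_insert, Finset.mem_singleton]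
      all_goals omega
    have e1 : (r.splice u v ε).q u = ε := by simp [ArcData.splice]
    have e2 : (r.splice u v ε).q v = ε := by simp [ArcData.splice]
    have e3 : (r.splice u v ε).q (r.p u) = (r.q u ^^ r.q v ^^ ε) := by
      rw [splice_q, if_neg (by omega), if_pos (by omega)]
    have e4 : (r.splice u v ε).q (r.p v) = (r.q u ^^ r.q v ^^ ε) := by
      rw [splice_q, if_neg (by omega), if_pos (by omega)]
    have e5 : ∑ x ∈ Finset.range (2 * n) \ {u, v, r.p u, r.p v}, ((r.splice u v ε).q x).toNat =
        ∑ x ∈ Finset.range (2 * n) \ {u, v, r.p u, r.p v}, (r.q x).toNat := by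
      refine Finset.sum_congr rfl fun x hx => ?_
      simp only [Finset.mem_sdiff, Finset.mem_insert, Finset.mem_singleton, not_or] at hx
      simp only [ArcData.splice]
      rw [if_neg (by omega), if_neg (by omega)]
    unfold EvenDec at he ⊢
    rw [← Finset.sum_sdiff hS, hsum] at he ⊢
    rw [e1, e2, e3, e4, e5]
    rw [hr.q_p, hr.q_p] at he
    revert he
    cases r.q u <;> cases r.q v <;> cases ε <;> simp

/-- The pattern of the identity diagram. -/
def one (n : ℕ) : ArcData where
  p x := if x < 2 * n then 2 * n - 1 - x else x
  q _ := false

theorem one_p {x : ℕ} (hx : x < 2 * n) : (one n).p x = 2 * n - 1 - x := by simp [one, hx]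

theorem valid_one (n : ℕ) : (one n).Valid n := by
  refine ⟨fun x => ?_, fun x hx => ?_, fun x hx => ?_, fun x hx => ?_, fun x hx => ?_, fun x => ?_,
    fun x y => ?_, fun x y h => ?_⟩ <;> simp only [one] at *
  · split_ifs <;> omega
  · split_ifs; omega
  · split_ifs; omega
  · split_ifs <;> omega
  · split_ifs <;> omega
  · exact absurd h (by simp)

theorem evenDec_one (n : ℕ) : (one n).EvenDec n := by simp [EvenDec, one]

/-- The smaller one of the two positions in the south face that the generator `s` joins. -/
def lo (n s : ℕ) : ℕ := 2 * n - 2 - (s - 1)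

/-- Right multiplication by the generator `s`. -/
def act (n : ℕ) (r : ArcData) (s : ℕ) : ArcData := r.splice (lo n s) (lo n s + 1) (decide (s = 0))

/-- The pattern of a word. -/
def run (n : ℕ) (ω : List ℕ) : ArcData := ω.foldl (act n) (one n)

/-- The nodes `k` and `k'` (counted from `0`) are joined by an undecorated arc. -/
def Vert (n : ℕ) (r : ArcData) (k : ℕ) : Prop := r.p k = 2 * n - 1 - k ∧ r.q k = false

theorem Valid.valid_act (hr : r.Valid n) {s : ℕ} (hs : s < n) :
    (r.act n s).Valid n := by
  refine hr.valid_splice (by omega) (by unfold lo; omega) (fun x h1 h2 => by omega) fun h => ?_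
  simp only [decide_eq_true_eq] at h
  unfold lo; omega

/-- Undoing a splice at an undecorated arc. -/
theorem Valid.splice_undo (hr : r.Valid n) {v u w : ℕ} (ε : Bool) (hvu : v ≠ u) (hwu : w ≠ u)
    (hwv : w ≠ v) (hu : u < 2 * n) (hp : r.p v = w) (hq : r.q v = false) :
    (r.splice v u ε).splice w v false = r := by
  refine hr.splice_splice hwv hwu hvu ?_ ?_ hu
  · rw [← hp, hr.inv]
  · rw [← hp, hr.q_p, hq]

/-- Counterpart of `splice_undo` for surjectivity: a preimage under a letter is built by a splice,
and the letter then restores the given pattern. -/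
theorem Valid.splice_redo (hr : r.Valid n) {v u w : ℕ} {ε : Bool} (hvu : v ≠ u) (hwu : w ≠ u)
    (hwv : w ≠ v) (hw : w < 2 * n) (hp : r.p v = u) (hq : r.q v = ε)
    (hr' : (r.splice w v false).Valid n) : (r.splice w v false).splice v u ε = r := by
  rw [hr'.splice_comm _ hvu, hr.splice_comm _ hwv]
  refine hr.splice_splice hvu.symm hwu.symm hwv.symm ?_ ?_ hw
  · rw [← hp, hr.inv]
  · rw [← hp, hr.q_p, hq]

/-- Splicing at an undecorated arc `v, w` moves the end `u` to `w`. -/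
theorem Valid.splice_shift (hr : r.Valid n) {v u w : ℕ} (ε : Bool) (hvu : v ≠ u) (hwu : w ≠ u)
    (hwv : w ≠ v) (hu : u < 2 * n) (hp : r.p v = w) (hq : r.q v = false)
    {x : ℕ} (hxv : x ≠ v) (hxw : x ≠ w) :
    (r.splice v u ε).p (if x = u then w else x) = (if r.p x = u then w else r.p x) ∧
    (r.splice v u ε).q (if x = u then w else x) =
      (r.q x ^^ (ε && (decide (x = u) || decide (r.p x = u)))) := by
  have hw : r.p w = v := by rw [← hp, hr.inv]
  have ix := hr.inv x
  have qx := hr.q_p x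
  have iu := hr.inv u
  have hc := hr.splice_cases ε hvu
  have bu := hr.ne u hu
  have hpu : r.p u ≠ v := fun h => hwu (by rw [← hp, ← h, iu])
  have hpu' : r.p u ≠ w := fun h => hvu (by rw [← hw, ← h, iu])
  rw [splice_q]
  by_cases h1 : x = u
  · subst h1
    have := hc w
    rw [if_pos rfl]
    constructor
    · split_ifs <;> omega
    · rw [if_neg (by omega), if_pos (by omega), hq]; simp
  · rw [if_neg h1]
    by_cases h2 : r.p x = u
    · have h3 : r.p u = x := by rw [← h2, ix]
      have := hc x
      rw [if_pos h2]
      constructor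
      · omega
      · rw [if_neg (by omega), if_pos (by omega), hq]; simp [h1, h2, ← qx]
    · have := hc x
      have h3 : x ≠ r.p u := fun h => h2 (by rw [h, iu])
      rw [if_neg h2]
      constructor
      · omega
      · rw [if_neg (by omega), if_neg (by omega)]; simp [h1, h2]

theorem Valid.splice_shift_iff (hr : r.Valid n) {v u w : ℕ} (ε : Bool) (hvu : v ≠ u) (hwu : w ≠ u)
    (hwv : w ≠ v) (hu : u < 2 * n) (hp : r.p v = w) (hq : r.q v = false)
    {x y : ℕ} (hxv : x ≠ v) (hxw : x ≠ w) (hyw : y ≠ w) :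
    (r.splice v u ε).p (if x = u then w else x) = (if y = u then w else y) ↔ r.p x = y := by
  rw [(hr.splice_shift ε hvu hwu hwv hu hp hq hxv hxw).1]
  have h1 : r.p x ≠ w := fun h => hxv (by rw [← hr.inv x, h, ← hp, hr.inv])
  split_ifs <;> omega

/-- Where the node `k'` (counted from `0`) goes under right multiplication by the row from `i`
to `j`. -/
def shift (n i j k : ℕ) : ℕ :=
  if k + 1 < max j 1 then 2 * n - 1 - k else if k + 2 ≤ i then 2 * n - 1 - (k + 2) else i

theorem shift_eq (n i j k : ℕ) : (k + 1 < max j 1 ∧ shift n i j k = 2 * n - 1 - k) ∨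
    (max j 1 ≤ k + 1 ∧ k + 2 ≤ i ∧ shift n i j k = 2 * n - 1 - (k + 2)) ∨
    (max j 1 ≤ k + 1 ∧ i < k + 2 ∧ shift n i j k = i) := by
  unfold shift; split_ifs <;> omega

/-- The effect of right multiplication by a row. -/
structure RowEffect (n i j : ℕ) (r r' : ArcData) : Prop where
  valid : r'.Valid n
  cup : r'.p (lo n j) = lo n j + 1
  cup_q : r'.q (lo n j) = decide (j = 0)
  p_iff : ∀ k l, k < i → l < i →
    (r'.p (shift n i j k) = shift n i j l ↔ r.p (2 * n - 1 - k) = 2 * n - 1 - l)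
  q_eq : ∀ k, k < i → r'.q (shift n i j k) = (r.q (2 * n - 1 - k) ^^ (decide (j = 0) &&
    (decide (k = 0) || decide (r.p (2 * n - 1 - k) = 2 * n - 1))))
  vert : ∀ k, i < k → k < n → r'.Vert n k

theorem Valid.act_cup (hr : r.Valid n) (s : ℕ) :
    (r.act n s).p (lo n s) = lo n s + 1 ∧ (r.act n s).q (lo n s) = decide (s = 0) := by
  have := hr.splice_cases (decide (s = 0)) (show lo n s ≠ lo n s + 1 by omega) (lo n s)
  refine ⟨by unfold act; omega, by rw [act, splice_q, if_pos (Or.inl rfl)]⟩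

theorem Valid.vert_act (hr : r.Valid n) {k s : ℕ} (h : r.Vert n k) (hk : k < n) (hs : s < n)
    (h1 : 2 * n - 1 - k < lo n s) (h2 : r.p (lo n s) ≠ k) : (r.act n s).Vert n k := by
  have hc := hr.splice_cases (decide (s = 0)) (show lo n s ≠ lo n s + 1 by omega) k
  have h3 : r.p (2 * n - 1 - k) = k := by rw [← h.1, hr.inv]
  have h4 : k ≠ r.p (lo n s + 1) := fun h' => by
    have h5 := h.1
    rw [h', hr.inv] at h5
    omega
  have h5 : k < lo n s := by unfold lo at *; omega
  refine ⟨?_, ?_⟩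
  · have := h.1; unfold act; omega
  · rw [act, splice_q, if_neg (by omega), if_neg (by omega), h.2]

/-- The first letter meets the undecorated vertical arc at node `i` and pulls the neighbouring south
end up to the north position `i`. Each later letter meets the undecorated cup left by the previous
one; the cup moves to the left, and the end next to it jumps two nodes to the right. All other ends
stay, so the old arcs are only relabelled by `shift`. A decoration is added only by a final letter
0, to the arc at the first south node. -/
theorem Valid.rowEffect (hr : r.Valid n) {i j : ℕ} (hi : 1 ≤ i) (hin : i < n) (hj : j ≤ i)
    (hv : ∀ k, i ≤ k → k < n → r.Vert n k) : RowEffect n i j r ((row i j).foldl (act n) r) := by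
  induction j using row_induction (i := i) with
  | h0 j h =>
    rw [row_of_lt h]
    have hu := up_eq j
    -- The row is a single letter: either `j = i`, or `i = 1` and `j = 0`. Truncated subtraction
    -- gives `lo n 0 = lo n 1`, so the formula covers both.
    have hlo : lo n j = 2 * n - 1 - i := by unfold lo; omega
    have hvi := hv i le_rfl hin
    have hp : r.p (lo n j) = i := by rw [hlo, ← hvi.1, hr.inv]
    have hq : r.q (lo n j) = false := by rw [hlo, ← hvi.1, hr.q_p, hvi.2]
    have hs : ∀ k, k < i → shift n i j k =
        if 2 * n - 1 - k = lo n j + 1 then i else 2 * n - 1 - k := by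
      intro k hk
      have := shift_eq n i j k
      split_ifs <;> omega
    refine ⟨hr.valid_act (by omega), (hr.act_cup j).1, (hr.act_cup j).2, ?_, ?_, ?_⟩
    · intro k l hk hl
      rw [hs k hk, hs l hl]
      exact hr.splice_shift_iff _ (by omega) (by omega) (by omega) (by omega) hp hq (by omega) (by omega)
        (by omega)
    · intro k hk
      rw [hs k hk]
      refine (hr.splice_shift _ (by omega) (by omega) (by omega) (by omega) hp hq (by omega)
        (by omega)).2.trans
        ?_
      by_cases h0 : j = 0
      · have e1 : lo n j + 1 = 2 * n - 1 := by omega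
        have e2 : (2 * n - 1 - k = 2 * n - 1) ↔ k = 0 := by omega
        rw [e1]; simp only [e2]
      · simp [h0]
    · intro k hk hkn
      exact hr.vert_act (hv k hk.le hkn) hkn (by omega) (by omega) (by omega)
  | h1 j h ih =>
    rw [row_of_le h, List.foldl_append]
    have ih := ih h
    generalize (row i (up j)).foldl (act n) r = r₀ at ih
    have hu := up_eq j
    have hr₀ := ih.valid
    have hlo : lo n (up j) + 1 = lo n j := by unfold lo; omega
    have hlj : lo n j + 1 = 2 * n - 1 - (max j 1 - 1) := by unfold lo; omega
    have hp : r₀.p (lo n j) = lo n (up j) := by rw [← hlo, ← ih.cup, hr₀.inv]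
    have hq : r₀.q (lo n j) = false := by
      rw [← hlo, ← ih.cup, hr₀.q_p, ih.cup_q]; simp; omega
    have hs : ∀ k, k < i → shift n i j k =
        if shift n i (up j) k = lo n j + 1 then lo n (up j) else shift n i (up j) k := by
      intro k hk
      have := shift_eq n i j k
      have := shift_eq n i (up j) k
      split_ifs <;> omega
    have hne : ∀ k, k < i → shift n i (up j) k ≠ lo n j ∧ shift n i (up j) k ≠ lo n (up j) := by
      intro k hk
      have := shift_eq n i (up j) k
      omega
    refine ⟨hr₀.valid_act (by omega), (hr₀.act_cup j).1, (hr₀.act_cup j).2, ?_, ?_, ?_⟩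
    · intro k l hk hl
      rw [hs k hk, hs l hl]
      exact (hr₀.splice_shift_iff _ (by omega) (by omega) (by omega) (by omega) hp hq (hne k hk).1
        (hne k hk).2 (hne l hl).2).trans (ih.p_iff k l hk hl)
    · intro k hk
      rw [hs k hk]
      refine (hr₀.splice_shift _ (by omega) (by omega) (by omega) (by omega) hp hq (hne k hk).1
        (hne k hk).2).2.trans ?_
      rw [ih.q_eq k hk]
      -- Only the last letter of a row can be 0, so no decoration was added before.
      have hu0 : up j ≠ 0 := by omega
      by_cases h0 : j = 0
      · have e0 : shift n i (up j) 0 = lo n j + 1 := by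
          have := shift_eq n i (up j) 0
          omega
        have e1 : shift n i (up j) k = lo n j + 1 ↔ k = 0 := by
          have := shift_eq n i (up j) k
          omega
        have e2 := ih.p_iff k 0 hk (by omega)
        rw [e0, Nat.sub_zero] at e2
        simp only [e1, e2, hu0]
        simp [h0]
      · simp [h0, hu0]
    · intro k hk hkn
      refine hr₀.vert_act (ih.vert k hk hkn) hkn (by omega) (by omega) (by omega)

end ArcData

end

/-! ### Recovering a normal list from its pattern -/

section

namespace ArcData

variable {n : ℕ} {r : ArcData}

/-- The properties of the pattern of a normal list of rows that determine its last row. -/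
structure LastRow (n i j : ℕ) (r : ArcData) : Prop where
  cup : r.p (lo n j) = lo n j + 1
  cup_q : r.q (lo n j) = decide (j = 0)
  vert : ∀ k, i < k → k < n → r.Vert n k
  not_vert : ¬ r.Vert n i
  no_cup : ∀ k, 1 ≤ k → j < k → k < n → r.p (lo n k) = lo n k + 1 → r.q (lo n k) = false → False

/-- An undecorated cup to the right of the new cup, or an undecorated vertical arc at `i`, could
only be the shifted image of a cup of the old pattern at some `m` with `max j 1 ≤ m < i`, which
`hno` excludes. A row that ends in 0 flips the decoration of the arc at the first node, so for `m =
1` it is the decorated cup that must be excluded. -/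
theorem RowEffect.lastRow {i j : ℕ} {r r' : ArcData} (h : RowEffect n i j r r') (hi : 1 ≤ i)
    (hin : i < n) (hj : j ≤ i) (hno : ∀ m, max j 1 ≤ m → m < i → r.p (lo n m) = lo n m + 1 →
      r.q (lo n m) = (decide (j = 0) && decide (m = 1)) → False) :
    LastRow n i j r' := by
  have key : ∀ m, max j 1 ≤ m → m < i → r'.p (shift n i j m) = shift n i j (m - 1) →
      r'.q (shift n i j m) = false → False := by
    intro m h1 h2 h3 h4
    have h5 := (h.p_iff m (m - 1) h2 (by omega)).1 h3
    have e1 : lo n m = 2 * n - 1 - m := by unfold lo; omega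
    have e2 : lo n m + 1 = 2 * n - 1 - (m - 1) := by unfold lo; omega
    refine hno m h1 h2 (by rw [e2, e1, h5]) ?_
    rw [h.q_eq m h2, h5] at h4
    have e3 : (2 * n - 1 - (m - 1) = 2 * n - 1) ↔ m = 1 := by omega
    have e4 : m ≠ 0 := by omega
    simp only [e3, e4, decide_false, Bool.false_or] at h4
    rw [e1]
    revert h4
    cases r.q (2 * n - 1 - m) <;> cases decide (j = 0) && decide (m = 1) <;> simp
  have hvr := h.valid
  have hlo : lo n j = 2 * n - 1 - max j 1 := by unfold lo; omega
  have hcup := h.cup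
  have hcup' : r'.p (lo n j + 1) = lo n j := by rw [← hcup, hvr.inv]
  refine ⟨h.cup, h.cup_q, h.vert, ?_, ?_⟩
  · rintro ⟨h1, h2⟩
    by_cases hji : max j 1 = i
    · rw [← hji, ← hlo] at h1
      have h3 := hvr.inv (max j 1)
      rw [h1, hcup] at h3
      omega
    · refine key (i - 1) (by omega) (by omega) ?_ ?_
      · have := shift_eq n i j (i - 1)
        have := shift_eq n i j (i - 1 - 1)
        rw [show shift n i j (i - 1) = i by omega, h1]
        omega
      · have := shift_eq n i j (i - 1)
        rw [show shift n i j (i - 1) = i by omega, h2]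
  · intro k h1 h2 h3 h4 h5
    have e1 : lo n k = 2 * n - 1 - k := by unfold lo; omega
    rcases lt_or_ge i k with hik | hik
    · have h6 := (h.vert k hik h3).1
      have h7 := hvr.inv k
      rw [h6, ← e1, h4] at h7
      omega
    by_cases hk1 : k = max j 1
    · have hj0 : j = 0 := by omega
      rw [show lo n k = lo n j by omega, h.cup_q] at h5
      simp [hj0] at h5
    by_cases hk2 : k = max j 1 + 1
    · rw [show lo n k + 1 = lo n j by omega] at h4
      have h6 := hvr.inv (lo n k)
      rw [h4, hcup] at h6
      omega
    · refine key (k - 2) (by omega) (by omega) ?_ ?_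
      · have := shift_eq n i j (k - 2)
        have := shift_eq n i j (k - 2 - 1)
        rw [show shift n i j (k - 2) = lo n k by omega, h4]
        omega
      · have := shift_eq n i j (k - 2)
        rw [show shift n i j (k - 2) = lo n k by omega, h5]

theorem run_cons (n i j : ℕ) (t : List (ℕ × ℕ)) :
    run n (rowsWord ((i, j) :: t)) = (row i j).foldl (act n) (run n (rowsWord t)) := by
  simp [run, rowsWord]

theorem run_append_singleton (n : ℕ) (ω : List ℕ) (s : ℕ) :
    run n (ω ++ [s]) = (run n ω).act n s := by
  simp [run]

theorem vert_one {k : ℕ} (hk : k < n) : (one n).Vert n k := ⟨one_p (by omega), rfl⟩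

/-- As the tops increase, node `i` is still vertical before the row from `i` to `j`, so `rowEffect`
applies. As the bottoms increase, the earlier pattern has no undecorated cup at a place that
`lastRow` forbids. In the exceptional succession 1, 0 the earlier cup is undecorated, while only a
decorated one would be harmful. -/
theorem run_normal (t : List (ℕ × ℕ)) (ht : Normal n t) : (run n (rowsWord t)).Valid n ∧
    ∀ i j t', t = (i, j) :: t' → LastRow n i j (run n (rowsWord t)) ∧
      RowEffect n i j (run n (rowsWord t')) (run n (rowsWord t)) := by
  induction t with
  | nil => exact ⟨valid_one n, by simp⟩
  | cons ij t ih =>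
    obtain ⟨i, j⟩ := ij
    obtain ⟨h1, h2, h3, h4, h5⟩ := ht
    obtain ⟨hv, ih⟩ := ih h5
    have hvert : ∀ k, i ≤ k → k < n → (run n (rowsWord t)).Vert n k := by
      intro k hk hkn
      match t, ih, h4 with
      | [], _, _ => exact vert_one hkn
      | (i', j') :: t, ih, h4 => exact (ih i' j' t rfl).1.vert k (by have := h4.1; omega) hkn
    have he := hv.rowEffect h1 h2 h3 hvert
    rw [← run_cons] at he
    refine ⟨he.valid, ?_⟩
    rintro _ _ _ ⟨⟩
    refine ⟨he.lastRow h1 h2 h3 ?_, he⟩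
    intro m hm1 hm2 hm3 hm4
    match t, ih, h4 with
    | [], _, _ =>
      have e1 : lo n m = 2 * n - 1 - m := by unfold lo; omega
      change (one n).p (lo n m) = _ at hm3
      rw [one_p (by omega)] at hm3
      omega
    | (i', j') :: t, ih, h4 =>
      have hl := (ih i' j' t rfl).1
      obtain ⟨h4, h4'⟩ := h4
      by_cases hjm : j = 0 ∧ m = 1
      · have hj' : m = j' := by omega
        have := hl.cup_q
        rw [show lo n j' = lo n m by rw [hj'], hm4] at this
        simp [hjm, ← hj'] at this
      · refine hl.no_cup m (by omega) (by omega) (by omega) hm3 ?_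
        rw [hm4]
        simpa using hjm

/-- The pattern before the last letter is determined by the last row and the pattern. -/
theorem LastRow.eq_of_run_eq {i j i' j' : ℕ} (h : LastRow n i j r) (h' : LastRow n i' j' r)
    (hi : i < n) (hi' : i' < n) (hj : j ≤ i) (hj' : j' ≤ i') :
    i = i' ∧ j = j' := by
  refine ⟨?_, ?_⟩
  · by_contra hne
    rcases lt_or_gt_of_ne hne with hlt | hlt
    · exact h'.not_vert (h.vert _ hlt hi')
    · exact h.not_vert (h'.vert _ hlt hi)
  · have key : ∀ {i j i' j' : ℕ}, LastRow n i j r → LastRow n i' j' r → j' ≤ i' → i' < n →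
        j < j' → False := by
      intro i j i' j' h h' hj' hi' hlt
      refine h.no_cup j' (by omega) hlt (by omega) h'.cup ?_
      rw [h'.cup_q]
      simp; omega
    by_contra hne
    rcases lt_or_gt_of_ne hne with hlt | hlt
    · exact key h h' hj' hi' hlt
    · exact key h' h hj hi hlt

/-- Equal patterns have equal last rows, hence equal last letters. That letter is undone by a splice
that depends only on the row, so the shortened words have equal patterns as well, and induction on
the length applies. -/
theorem run_injective {t t' : List (ℕ × ℕ)} (ht : Normal n t) (ht' : Normal n t')
    (h : run n (rowsWord t) = run n (rowsWord t')) : t = t' := by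
  induction hm : (rowsWord t).length generalizing t t' with
  | zero =>
    match t, t', ht, ht' with
    | [], [], _, _ => rfl
    | (i, j) :: t, _, _, _ =>
      obtain ⟨C, hC, -⟩ := exists_row_eq_append i j
      simp [rowsWord, hC] at hm
    | [], (i, j) :: t', _, ht' =>
      refine absurd ?_ ((run_normal _ ht').2 i j t' rfl).1.not_vert
      rw [← h]
      exact vert_one ht'.2.1
  | succ m ih =>
    match t, t', ht, ht' with
    | [], _, _, _ => simp [rowsWord] at hm
    | (i, j) :: t, [], ht, _ =>
      refine absurd ?_ ((run_normal _ ht).2 i j t rfl).1.not_vert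
      rw [h]
      exact vert_one ht.2.1
    | (i, j) :: t, (i', j') :: t', ht, ht' =>
      have hl := ((run_normal _ ht).2 i j t rfl).1
      have hl' := ((run_normal _ ht').2 i' j' t' rfl).1
      rw [← h] at hl'
      obtain ⟨rfl, rfl⟩ := hl.eq_of_run_eq hl' ht.2.1 ht'.2.1 ht.2.2.1 ht'.2.2.1
      have hu := up_eq j
      have hjn : j ≤ i ∧ i < n ∧ 1 ≤ i := ⟨ht.2.2.1, ht.2.1, ht.1⟩
      by_cases hup : up j ≤ i
      · have hlo : lo n (up j) + 1 = lo n j ∧ lo n j + 1 < 2 * n := by unfold lo; omega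
        have undo : ∀ t, Normal n ((i, j) :: t) →
            (run n (rowsWord ((i, j) :: t))).splice (lo n (up j)) (lo n j) false =
              run n (rowsWord ((i, up j) :: t)) := by
          intro t ht
          have h1 := run_normal _ (ht.pred hup)
          have h2 := (h1.2 i (up j) t rfl).1
          rw [rowsWord_up hup, run_append_singleton]
          refine h1.1.splice_undo _ (by omega) (by omega) (by omega) (by omega) ?_ ?_
          · rw [← hlo.1, ← h2.cup, h1.1.inv]
          · rw [← hlo.1, ← h2.cup, h1.1.q_p, h2.cup_q]; simp; omega
        have h3 := undo t ht
        rw [h, undo t' ht'] at h3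
        have := ih (ht.pred hup) (ht'.pred hup) h3.symm (by
          rw [rowsWord_up hup] at hm; simpa using hm)
        simpa using this
      · have hup : i < up j := by omega
        have hlo : lo n j = 2 * n - 1 - i := by unfold lo; omega
        have undo : ∀ t, Normal n ((i, j) :: t) →
            (run n (rowsWord ((i, j) :: t))).splice i (lo n j) false = run n (rowsWord t) := by
          intro t ht
          have h1 := run_normal t ht.2.2.2.2
          have h2 : (run n (rowsWord t)).Vert n i := by
            match t, ht, h1 with
            | [], _, _ => exact vert_one hjn.2.1
            | (i', j') :: t, ht, h1 => exact (h1.2 i' j' t rfl).1.vert i ht.2.2.2.1.1 hjn.2.1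
          rw [rowsWord_single hup, run_append_singleton]
          refine h1.1.splice_undo _ (by omega) (by omega) (by omega) (by omega) ?_ ?_
          · rw [hlo, ← h2.1, h1.1.inv]
          · rw [hlo, ← h2.1, h1.1.q_p, h2.2]
        have h3 := undo t ht
        rw [h, undo t' ht'] at h3
        have := ih ht.2.2.2.2 ht'.2.2.2.2 h3.symm (by
          rw [rowsWord_single hup] at hm; simpa using hm)
        rw [this]

end ArcData

end

/-! ### Every valid pattern with evenly many decorated arcs comes from a normal list -/

section

namespace ArcData

variable {n : ℕ} {r : ArcData}

/-- The row is removed from its last letter backwards. If the pattern has the cup of `j`, then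
acting by `up j` creates the cup of `up j`, and acting by `j` afterwards gives the pattern back. For
a one-letter row, the cup is opened by a splice with the north position `i`; this is planar since
only undecorated vertical arcs lie in between. -/
theorem Valid.exists_row_undo (i : ℕ) (hi : 1 ≤ i) (hin : i < n) {j : ℕ} (hj : j ≤ i)
    (hr : r.Valid n) (he : r.EvenDec n) (hv : ∀ k, i < k → k < n → r.Vert n k)
    (hc : r.p (lo n j) = lo n j + 1) (hq : r.q (lo n j) = decide (j = 0)) :
    ∃ r₀ : ArcData, r₀.Valid n ∧ r₀.EvenDec n ∧ (∀ k, i ≤ k → k < n → r₀.Vert n k) ∧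
      (row i j).foldl (act n) r₀ = r := by
  induction j using row_induction (i := i) generalizing r with
  | h0 j h =>
    have hu := up_eq j
    have hlo : lo n j = 2 * n - 1 - i := by unfold lo; omega
    have hr₀ : (r.splice i (lo n j) false).Valid n := by
      refine hr.valid_splice (by omega) (by omega) (fun x h1 h2 => ?_) (by simp)
      rcases lt_or_ge x n with hx | hx
      · have h3 := hv x h1 hx
        exact ⟨by rw [h3.1]; omega, by rw [h3.1]; omega, h3.2⟩
      · have h3 := hv (2 * n - 1 - x) (by omega) (by omega)
        have h4 : r.p x = 2 * n - 1 - x := by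
          have h5 := hr.inv (2 * n - 1 - x)
          rw [h3.1] at h5
          rw [← h5]; congr 1; omega
        refine ⟨by omega, by omega, ?_⟩
        rw [← hr.q_p, h4, h3.2]
    refine ⟨r.splice i (lo n j) false, hr₀, ?_, ?_, ?_⟩
    · refine hr.evenDec_splice he (by omega) (by omega) (by omega) fun h' => ?_
      have := hr.inv i
      rw [h', hc] at this
      omega
    · intro k hk hkn
      have hcs := hr.splice_cases false (show i ≠ lo n j by omega) k
      rcases hk.eq_or_lt with rfl | hk
      · refine ⟨by omega, by rw [splice_q, if_pos (Or.inl rfl)]⟩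
      · have h3 := hv k hk hkn
        have h4 : k ≠ r.p i := fun h' => by
          have := h3.1
          rw [h', hr.inv] at this
          omega
        refine ⟨by have := h3.1; omega, ?_⟩
        rw [splice_q, if_neg (by omega), if_neg (by omega), h3.2]
    · rw [row_of_lt h]
      exact hr.splice_redo (by omega) (by omega) (by omega) (by omega) hc hq hr₀
  | h1 j h ih =>
    have hu := up_eq j
    have hlo : lo n (up j) + 1 = lo n j := by unfold lo; omega
    have hlo' : lo n j + 1 < 2 * n ∧ 2 * n - 1 - i < lo n j := by unfold lo; omega
    have hr₀ : (r.act n (up j)).Valid n := hr.valid_act (by omega)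
    have hεu : decide (up j = 0) = false := by simp; omega
    have hac := hr.act_cup (up j)
    have hcp : r.p (lo n j + 1) = lo n j := by rw [← hc, hr.inv]
    obtain ⟨r', h1, h2, h3, h4⟩ := ih h hr₀ (by
        refine hr.evenDec_splice he (by omega) (by omega) (by omega) fun h' => ?_
        have := hr.inv (lo n (up j))
        rw [h', hlo, hc] at this
        omega) (by
        intro k hk hkn
        have h3 := hv k hk hkn
        have hcs := hr.splice_cases (decide (up j = 0)) (show lo n (up j) ≠ lo n (up j) + 1 by omega) k
        have h4 : k ≠ r.p (lo n (up j)) := fun h' => by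
          have := h3.1
          rw [h', hr.inv] at this
          omega
        rw [hlo] at hcs
        refine ⟨by have := h3.1; rw [act, hlo]; omega, ?_⟩
        rw [act, hlo, splice_q, if_neg (by omega), if_neg (by omega), h3.2]) hac.1 hac.2
    refine ⟨r', h1, h2, h3, ?_⟩
    rw [row_of_le h, List.foldl_append, h4]
    have hs : r.act n (up j) = r.splice (lo n (up j)) (lo n j) false := by rw [act, hlo, hεu]
    rw [hs] at hr₀ ⊢
    exact hr.splice_redo (by omega) (by omega) (by omega) (by omega) hc hq hr₀

/-- Below every arc there is an arc that joins adjacent positions. -/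
theorem Valid.exists_adjacent (hr : r.Valid n) {x : ℕ} (hx : x < r.p x) :
    ∃ z, x ≤ z ∧ z + 1 ≤ r.p x ∧ r.p z = z + 1 := by
  induction hd : r.p x - x using Nat.strong_induction_on generalizing x with
  | _ d ih =>
    by_cases h : r.p x = x + 1
    · exact ⟨x, le_rfl, by omega, h⟩
    · have h1 := hr.side (x := x) (y := x + 1) (by omega) (by omega)
      have h2 := hr.bound (x + 1)
      have h3 := hr.bound x
      rcases lt_or_ge (x + 1) (r.p (x + 1)) with h4 | h4
      · obtain ⟨z, h5, h6, h7⟩ := ih _ (by omega) h4 rfl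
        exact ⟨z, by omega, by omega, h7⟩
      · omega

/-- Otherwise the partner map would inject the south face into the north face, hence biject, and no
two north nodes could be joined. -/
theorem Valid.exists_south_arc (hr : r.Valid n) {x : ℕ} (hx : x < r.p x) (hxn : r.p x < n) :
    ∃ y, n ≤ y ∧ y < r.p y := by
  by_contra hno
  push Not at hno
  have hmap : ∀ y ∈ Finset.Ico n (2 * n), r.p y ∈ Finset.range n := by
    intro y hy
    rw [Finset.mem_Ico] at hy
    rw [Finset.mem_range]
    by_contra h
    have h1 := hno y hy.1
    have h2 := hno (r.p y) (by omega)
    rw [hr.inv] at h2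
    exact hr.ne y hy.2 (by omega)
  have hsurj := Finset.surj_on_of_inj_on_of_card_le (s := Finset.Ico n (2 * n))
    (t := Finset.range n) (fun y _ => r.p y) hmap
    (fun a b _ _ h => by rw [← hr.inv a, h, hr.inv]) (by simp; omega)
  obtain ⟨y, hy, h⟩ := hsurj x (Finset.mem_range.2 (by omega))
  rw [Finset.mem_Ico] at hy
  rw [h, hr.inv] at hxn
  omega

/-- Some arc joins two south nodes, and an innermost one joins neighbours; the vertical arcs beyond
`i` bound its place. If all such cups are decorated, each is exposed, and this exposure pushes a cup
all the way to the left wall. -/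
theorem Valid.exists_cup (hr : r.Valid n) {i : ℕ} (hi : 1 ≤ i) (hin : i < n)
    (hv : ∀ k, i < k → k < n → r.Vert n k) (hni : ¬ r.Vert n i) :
    (∃ k, 1 ≤ k ∧ k ≤ i ∧ r.p (lo n k) = lo n k + 1 ∧ r.q (lo n k) = false) ∨
      (r.p (lo n 0) = lo n 0 + 1 ∧ r.q (lo n 0) = true) := by
  have hsouth : ∃ y, n ≤ y ∧ y < r.p y := by
    have hclosed : ∀ x, i < x → x < 2 * n - 1 - i → i < r.p x ∧ r.p x < 2 * n - 1 - i := by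
      intro x h1 h2
      rcases lt_or_ge x n with hx | hx
      · have h3 := (hv x h1 hx).1
        omega
      · have h3 := (hv (2 * n - 1 - x) (by omega) (by omega)).1
        have h5 := hr.inv (2 * n - 1 - x)
        rw [h3, show 2 * n - 1 - (2 * n - 1 - x) = x by omega] at h5
        omega
    have h0 := hr.bound 0
    have hbi := hr.bound i
    have hii := hr.inv i
    have h00 := hr.inv 0
    have hB := hr.inv (2 * n - 1 - i)
    by_cases h1 : r.p i = 2 * n - 1 - i
    -- Node `i` lies on a vertical but decorated arc. Since that arc is exposed, the arc of position
    -- 0 cannot pass over it and must return to the north face before `i`.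
    · have hq : r.q i = true := by
        by_contra h
        exact hni ⟨h1, by simpa using h⟩
      have h2 := hr.ex 0 i hq
      have h3 : r.p 0 ≠ i := fun h => by rw [h, h1] at h00; omega
      exact hr.exists_south_arc (x := 0) (by omega) (by omega)
    · by_cases h2 : r.p i < i
      · exact hr.exists_south_arc (x := r.p i) (by omega) (by omega)
      · have h3 := hclosed (r.p i)
        by_cases h4 : r.p i < 2 * n - 1 - i
        · have := h3 (by omega) h4
          omega
        · refine ⟨2 * n - 1 - i, by omega, ?_⟩
          have h5 := hclosed (r.p (2 * n - 1 - i))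
          have h6 := hr.bound (2 * n - 1 - i)
          have h7 := hr.nc i (2 * n - 1 - i)
          have h8 := hr.side (x := i) (y := 2 * n - 1 - i) (by omega) (by omega)
          rw [hB] at h5
          by_contra h9
          have := h5 (by omega) (by omega)
          omega
  obtain ⟨y, hy, hy'⟩ := hsouth
  by_contra hno
  push Not at hno
  obtain ⟨hno1, hno2⟩ := hno
  have hcup : ∀ z, n ≤ z → r.p z = z + 1 → r.q z = true := by
    intro z hz hz'
    have hb := hr.bound z
    have e : lo n (2 * n - 1 - z) = z := by unfold lo; omega
    by_contra hq
    refine absurd (by simpa using hq) (e ▸ hno1 (2 * n - 1 - z) (by omega) ?_ ?_)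
    · by_contra h
      have := (hv (2 * n - 1 - z) (by omega) (by omega)).1
      have h2 := hr.inv (2 * n - 1 - z)
      rw [this, show 2 * n - 1 - (2 * n - 1 - z) = z by omega] at h2
      omega
    · rw [e, hz']
  obtain ⟨z, hz1, hz2, hz3⟩ := hr.exists_adjacent hy'
  -- From a decorated cup at `z`, the arc at `z + 2` cannot go back over the cup, so it goes forward
  -- and contains a later cup. The process ends only at the last two positions.
  have hmax : ∀ d z, 2 * n - z = d → n ≤ z → r.p z = z + 1 → r.p (2 * n - 2) = 2 * n - 1 := by
    intro d
    induction d using Nat.strong_induction_on with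
    | _ d ih =>
      intro z hd hz hz'
      have hb := hr.bound z
      by_cases hlast : z + 2 = 2 * n
      · rw [show 2 * n - 2 = z by omega, hz']; omega
      · have hex := hr.ex (r.p (z + 2)) z (hcup z hz hz')
        have hiz := hr.inv (z + 2)
        have hiz' := hr.inv z
        have hb2 := hr.bound (z + 2)
        have h1 : r.p (z + 2) ≠ z := fun h => by rw [h, hz'] at hiz; omega
        have h2 : r.p (z + 2) ≠ z + 1 := fun h => by rw [h, ← hz', hiz'] at hiz; omega
        rw [hiz] at hex
        obtain ⟨w, hw1, hw2, hw3⟩ := hr.exists_adjacent (x := z + 2) (by omega)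
        exact ih (2 * n - w) (by omega) w rfl (by omega) hw3
  have hl := hmax _ z rfl (by omega) hz3
  have e : lo n 0 = 2 * n - 2 := by unfold lo; omega
  rw [e] at hno2
  exact hno2 (by omega) (hcup _ (by omega) (by omega))

/-- The first nodes of the two faces are left to be joined to each other, and a decoration on that
arc alone would make the number of decorated arcs odd. -/
theorem Valid.eq_one (hr : r.Valid n) (he : r.EvenDec n) (hv : ∀ k, 0 < k → k < n → r.Vert n k) :
    r = one n := by
  have hp : ∀ x, x < 2 * n → 0 < x → x < 2 * n - 1 → r.p x = 2 * n - 1 - x ∧ r.q x = false := by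
    intro x hx h1 h2
    rcases lt_or_ge x n with h | h
    · exact hv x h1 h
    · have h3 := hv (2 * n - 1 - x) (by omega) (by omega)
      have h5 := hr.inv (2 * n - 1 - x)
      rw [h3.1, show 2 * n - 1 - (2 * n - 1 - x) = x by omega] at h5
      exact ⟨h5, by rw [← hr.q_p, h5, h3.2]⟩
  have h0 : 0 < n → r.p 0 = 2 * n - 1 := by
    intro hn
    by_contra h
    have hb := hr.bound 0
    have h1 := (hp (r.p 0) (by omega) (by omega) (by omega)).1
    rw [hr.inv] at h1
    omega
  have hlast : 0 < n → r.p (2 * n - 1) = 0 := fun hn => by rw [← h0 hn, hr.inv]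
  have hq0 : r.q 0 = false := by
    rcases Nat.eq_zero_or_pos n with hn | hn
    · exact hr.out_q 0 (by omega)
    by_contra hq
    have hq : r.q 0 = true := by simpa using hq
    have hq' : r.q (2 * n - 1) = true := by rw [← h0 hn, hr.q_p, hq]
    have : ∑ x ∈ Finset.range (2 * n), (r.q x).toNat = 2 := by
      rw [show 2 * n = (2 * n - 1 - 1 + 1) + 1 by omega, Finset.sum_range_succ,
        Finset.sum_range_succ', Finset.sum_eq_zero]
      · rw [show 2 * n - 1 - 1 + 1 = 2 * n - 1 by omega, hq, hq']; rfl
      · intro x hx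
        rw [Finset.mem_range] at hx
        rw [(hp (x + 1) (by omega) (by omega) (by omega)).2]; rfl
    rw [EvenDec, this] at he
    omega
  ext x
  · rcases lt_or_ge x (2 * n) with hx | hx
    · rw [one_p hx]
      rcases Nat.eq_zero_or_pos x with rfl | h1
      · rw [h0 (by omega)]; omega
      · by_cases h2 : x = 2 * n - 1
        · rw [h2, hlast (by omega)]; omega
        · exact (hp x hx h1 (by omega)).1
    · rw [hr.out_p x hx, (valid_one n).out_p x hx]
  · show r.q x = false
    rcases lt_or_ge x (2 * n) with hx | hx
    · rcases Nat.eq_zero_or_pos x with rfl | h1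
      · exact hq0
      · by_cases h2 : x = 2 * n - 1
        · rw [h2, ← h0 (by omega), hr.q_p, hq0]
        · exact (hp x hx h1 (by omega)).2
    · exact hr.out_q x hx

/-- The last row is read off from the pattern: `i` is the last node without an undecorated vertical
arc, and `j` is the largest place of an undecorated cup, or 0 if there is none. Undoing this row
makes node `i` vertical, and the induction continues. -/
theorem Valid.exists_normal (hr : r.Valid n) (he : r.EvenDec n) (i : ℕ) (hi : i < n)
    (hv : ∀ k, i < k → k < n → r.Vert n k) :
    ∃ L, Normal n L ∧ (∀ i' j' t, L = (i', j') :: t → i' ≤ i) ∧ run n (rowsWord L) = r := by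
  induction i generalizing r with
  | zero => exact ⟨[], trivial, by simp, (hr.eq_one he hv).symm⟩
  | succ i ih =>
    by_cases hni : r.Vert n (i + 1)
    · obtain ⟨L, h1, h2, h3⟩ := ih hr he (by omega) fun k h1 h2 => by
        rcases (Nat.succ_le_of_lt h1).eq_or_lt with h | h
        · exact h ▸ hni
        · exact hv k h h2
      exact ⟨L, h1, fun i' j' t h => (h2 i' j' t h).trans (by omega), h3⟩
    obtain ⟨j, hj, hc, hq, hmax⟩ : ∃ j, j ≤ i + 1 ∧ r.p (lo n j) = lo n j + 1 ∧
        r.q (lo n j) = decide (j = 0) ∧ ∀ k, 1 ≤ k → j < k → k ≤ i + 1 →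
          r.p (lo n k) = lo n k + 1 → r.q (lo n k) = false → False := by
      classical
      by_cases hex : ∃ k, 1 ≤ k ∧ k ≤ i + 1 ∧ r.p (lo n k) = lo n k + 1 ∧ r.q (lo n k) = false
      · have hs := Nat.findGreatest_spec (P := fun k => 1 ≤ k ∧ k ≤ i + 1 ∧
          r.p (lo n k) = lo n k + 1 ∧ r.q (lo n k) = false) hex.choose_spec.2.1 hex.choose_spec
        refine ⟨_, hs.2.1, hs.2.2.1, hs.2.2.2.trans ?_, fun k h1 h2 h3 h4 h5 => ?_⟩
        · have := hs.1
          symm; simp only [decide_eq_false_iff_not]; omega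
        · exact Nat.findGreatest_is_greatest h2 h3 ⟨h1, h3, h4, h5⟩
      · rcases hr.exists_cup (by omega) hi hv hni with h | h
        · exact absurd h hex
        · exact ⟨0, by omega, h.1, by rw [h.2]; rfl, fun k h1 _ h3 h4 h5 => hex ⟨k, h1, h3, h4, h5⟩⟩
    obtain ⟨r₀, h1, h2, h3, h4⟩ := hr.exists_row_undo (i + 1) (by omega) hi hj he hv hc hq
    obtain ⟨t, ht, ht', htr⟩ := ih h1 h2 (by omega) fun k hk hkn => h3 k hk hkn
    have heff := h1.rowEffect (by omega) hi hj h3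
    rw [h4] at heff
    refine ⟨(i + 1, j) :: t, ⟨by omega, hi, hj, ?_, ht⟩, ?_, ?_⟩
    · match t, ht, ht', htr with
      | [], _, _, _ => trivial
      | (i', j') :: t, ht, ht', htr =>
        have hi' := ht' i' j' t rfl
        refine ⟨by omega, ?_⟩
        -- If the two rows did not fit, the last cup of the smaller pattern would survive as an
        -- undecorated cup beyond `j`, against the choice of `j`, or as an undecorated vertical arc
        -- at `i + 1`. When both bottoms are 0, the second decoration cancels the first.
        by_contra hno
        have hl := ((run_normal _ ht).2 i' j' t rfl).1
        rw [htr] at hl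
        have hm : max j' 1 ≤ i := by
          have := ht.1
          have := ht.2.2.1
          omega
        have h7 := ht.2.2.1
        have e1 : lo n j' = 2 * n - 1 - max j' 1 := by unfold lo; omega
        have hp := (heff.p_iff (max j' 1) (max j' 1 - 1) (by omega) (by omega)).2 (by
          rw [← e1, hl.cup]; omega)
        have hq' := heff.q_eq (max j' 1) (by omega)
        rw [← e1, hl.cup_q, hl.cup] at hq'
        have hq'' : r.q (shift n (i + 1) j (max j' 1)) = false := by
          rw [hq']
          have e2 : max j' 1 ≠ 0 := by omega
          have e3 : (lo n j' + 1 = 2 * n - 1) ↔ j' ≤ 1 := by omega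
          simp only [e2, e3, decide_false, Bool.false_or]
          by_cases hj0 : j = 0
          · have : j' = 0 ∨ 2 ≤ j' := by omega
            rcases this with h | h
            · simp [hj0, h]
            · simp [show j' ≠ 0 by omega, show ¬ j' ≤ 1 by omega]
          · simp [hj0, show j' ≠ 0 by omega]
        have s1 := shift_eq n (i + 1) j (max j' 1)
        have s2 := shift_eq n (i + 1) j (max j' 1 - 1)
        by_cases hlast : max j' 1 + 2 ≤ i + 1
        · have e2 : lo n (max j' 1 + 2) = 2 * n - 1 - (max j' 1 + 2) := by unfold lo; omega
          have e3 : shift n (i + 1) j (max j' 1) = lo n (max j' 1 + 2) := by omega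
          rw [e3] at hp hq''
          refine hmax (max j' 1 + 2) (by omega) (by omega) hlast ?_ hq''
          rw [hp]; omega
        · have e3 : shift n (i + 1) j (max j' 1) = i + 1 := by omega
          rw [e3] at hp hq''
          exact hni ⟨by rw [hp]; omega, hq''⟩
    · rintro _ _ _ ⟨⟩; exact le_rfl
    · rw [run_cons, htr, h4]

/-- Induction on normal words, letter by letter; no letter closes a loop. -/
theorem _root_.TypeD.Normal.induction {P : List ℕ → Prop} (h0 : P [])
    (h1 : ∀ ω j, j < n → (run n ω).Valid n → (run n ω).p (lo n j) ≠ lo n j + 1 → P ω →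
      P (ω ++ [j])) (L : List (ℕ × ℕ)) (hL : Normal n L) : P (rowsWord L) := by
  induction L with
  | nil => exact h0
  | cons ij t ih =>
    obtain ⟨i, j⟩ := ij
    induction j using row_induction (i := i) with
    | h0 j h =>
      obtain ⟨hi, hin, hj, ha, ht⟩ := hL
      have hu := up_eq j
      have hlo : lo n j = 2 * n - 1 - i := by unfold lo; omega
      have hr := run_normal t ht
      have hv : (run n (rowsWord t)).Vert n i := by
        match t, hr, ha with
        | [], _, _ => exact vert_one hin
        | (i', j') :: t, hr, ha => exact (hr.2 i' j' t rfl).1.vert i ha.1 hin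
      rw [rowsWord_single h]
      refine h1 _ j (by omega) hr.1 ?_ (ih ht)
      have h2 := hr.1.inv i
      rw [hv.1, ← hlo] at h2
      omega
    | h1 j h ih' =>
      have hu := up_eq j
      have hr := run_normal _ (hL.pred h)
      have hc := (hr.2 i (up j) t rfl).1.cup
      have hb : j ≤ i ∧ i < n := ⟨hL.2.2.1, hL.2.1⟩
      have hlo : lo n (up j) + 1 = lo n j := by unfold lo; omega
      rw [rowsWord_up h]
      refine h1 _ j (by omega) hr.1 ?_ (ih' (hL.pred h))
      have h2 := hr.1.inv (lo n (up j))
      rw [hc, hlo] at h2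
      omega

/-- No letter of a normal word closes a loop, so the side condition of `evenDec_splice` is vacuous.
-/
theorem evenDec_run_normal {L : List (ℕ × ℕ)} (hL : Normal n L) :
    (run n (rowsWord L)).EvenDec n := by
  refine Normal.induction (P := fun ω => (run n ω).EvenDec n) (evenDec_one n) ?_ L hL
  intro ω j hj hr hl he
  rw [run_append_singleton]
  exact hr.evenDec_splice he (by omega) (by unfold lo; omega) (by unfold lo; omega)
    fun h => absurd h hl

end ArcData

end

section

/-! ## Pictures of arc patterns -/

variable {n : ℕ}

theorem Node.pos_lt (x : Node n) : x.pos < 2 * n := by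
  rcases x with x | x <;> simp only [Node.pos] <;> omega

theorem Node.pos_injective : Function.Injective (Node.pos : Node n → ℕ) := by
  rintro (x | x) (y | y) h <;> simp only [Node.pos] at h
  · rw [Fin.ext h]
  · omega
  · omega
  · rw [Fin.ext (a := x) (b := y) (by omega)]

/-- The node at a given position. -/
def nodeAt (hn : 4 ≤ n) (x : ℕ) : Node n :=
  if h : x < n then Sum.inl ⟨x, h⟩ else Sum.inr ⟨2 * n - 1 - x, by omega⟩

theorem pos_nodeAt (hn : 4 ≤ n) {x : ℕ} (hx : x < 2 * n) : (nodeAt hn x).pos = x := by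
  unfold nodeAt
  split_ifs with h
  · rfl
  · simp only [Node.pos]; omega

theorem nodeAt_pos (hn : 4 ≤ n) (x : Node n) : nodeAt hn x.pos = x :=
  Node.pos_injective (pos_nodeAt hn x.pos_lt)

namespace ArcData

/-- The loop-free picture with the given arcs. -/
def picture (n : ℕ) (r : ArcData) : Picture n where
  E := Set.range fun x : Node n => min x.pos (r.p x.pos)
  fin := Fintype.ofFinite _
  edgeAt x := ⟨_, x, rfl⟩
  dec e := (r.q e.1).toNat

variable {r : ArcData}

theorem picture_edgeAt_surjective : Function.Surjective (picture n r).edgeAt := by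
  rintro ⟨_, x, rfl⟩; exact ⟨x, rfl⟩

/-- Arcs are named by their smaller end, and the partner map is an involution, so only the two ends
of an arc receive the same name. -/
theorem Valid.edgeAt_eq_iff (hr : r.Valid n) (x y : Node n) :
    (picture n r).edgeAt x = (picture n r).edgeAt y ↔ y.pos = x.pos ∨ y.pos = r.p x.pos := by
  have h1 := hr.inv x.pos
  have h2 := hr.inv y.pos
  rw [show (picture n r).edgeAt x = (picture n r).edgeAt y ↔
    min x.pos (r.p x.pos) = min y.pos (r.p y.pos) from Subtype.ext_iff]
  constructor
  · intro h
    rcases min_choice x.pos (r.p x.pos) with hx | hx <;>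
      rcases min_choice y.pos (r.p y.pos) with hy | hy <;> rw [hx, hy] at h
    · exact Or.inl h.symm
    · right; rw [h, h2]
    · right; exact h.symm
    · left; rw [← h1, h, h2]
  · rintro (h | h)
    · rw [h]
    · rw [h, h1, min_comm]

theorem Valid.dec_edgeAt (hr : r.Valid n) (x : Node n) :
    (picture n r).dec ((picture n r).edgeAt x) = (r.q x.pos).toNat := by
  show (r.q (min x.pos (r.p x.pos))).toNat = _
  rcases min_choice x.pos (r.p x.pos) with h | h <;> rw [h]
  rw [hr.q_p]

/-- Two nodes of the north face are joined. -/
def HasCap (n : ℕ) (r : ArcData) : Prop := ∃ x, x < n ∧ r.p x < n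

theorem Valid.aValue_ne_zero (hr : r.Valid n) (hc : r.HasCap n) : (picture n r).aValue ≠ 0 := by
  obtain ⟨x, hx, hpx⟩ := hc
  have hf : Finite {e // ∃ i j : Fin n, i ≠ j ∧ (picture n r).edgeAt (Sum.inl i) = e ∧
    (picture n r).edgeAt (Sum.inl j) = e} := Subtype.finite
  refine Nat.card_ne_zero.2 ⟨⟨⟨(picture n r).edgeAt (Sum.inl ⟨x, hx⟩), ⟨x, hx⟩, ⟨r.p x, hpx⟩, ?_,
    rfl, ?_⟩⟩, hf⟩
  · intro h
    exact hr.ne x (by omega) (Fin.ext_iff.1 h).symm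
  · rw [eq_comm, hr.edgeAt_eq_iff]; right; rfl

theorem Valid.isPseudo (hr : r.Valid n) (hn : 4 ≤ n) : (picture n r).IsPseudo := by
  refine ⟨fun e => Or.inr ?_, ?_⟩
  · obtain ⟨x, rfl⟩ := picture_edgeAt_surjective e
    have hb := hr.bound x.pos
    have hx := x.pos_lt
    have hS : {z | (picture n r).edgeAt z = (picture n r).edgeAt x} =
        {x, nodeAt hn (r.p x.pos)} := by
      ext z
      rw [Set.mem_ofPred_eq, eq_comm, hr.edgeAt_eq_iff, Set.mem_insert_iff, Set.mem_singleton_iff,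
        ← Node.pos_injective.eq_iff, ← Node.pos_injective.eq_iff, pos_nodeAt hn (by omega)]
    change Nat.card ({z | (picture n r).edgeAt z = (picture n r).edgeAt x} : Set (Node n)) = 2
    rw [hS, Nat.card_coe_set_eq, Set.ncard_pair]
    rw [Ne, ← Node.pos_injective.eq_iff, pos_nodeAt hn (by omega)]
    omega
  · intro a b c d h1 h2 h3 h4 h5
    rw [hr.edgeAt_eq_iff] at h4 h5
    have := hr.nc a.pos b.pos
    omega

theorem Valid.leftExposed (hr : r.Valid n) {x : Node n} (hx : r.q x.pos = true) :
    (picture n r).LeftExposed ((picture n r).edgeAt x) := by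
  rintro ⟨a, b, c, h1, h2, h3, h4⟩
  rw [hr.edgeAt_eq_iff] at h3 h4
  have hb : r.q b.pos = true := by
    rcases h3 with h | h
    · rw [← h, hx]
    · rw [← hr.q_p, ← h, hx]
  have := hr.ex a.pos b.pos hb
  omega

/-- A diagram of `a`-value 0 must be undecorated. A cap makes the `a`-value nonzero; the second
alternative serves the identity pattern. -/
theorem Valid.isLDecorated (hr : r.Valid n) (hn : 4 ≤ n)
    (hc : r.HasCap n ∨ ∀ x, r.q x = false) : (picture n r).IsLDecorated := by
  refine ⟨hr.isPseudo hn, fun h => ?_, fun e he => ?_⟩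
  · rcases hc with hc | hc
    · exact absurd h (hr.aValue_ne_zero hc)
    · intro e; simp [picture, hc]
  · obtain ⟨x, rfl⟩ := picture_edgeAt_surjective e
    rw [hr.dec_edgeAt] at he
    exact hr.leftExposed (by cases h : r.q x.pos <;> simp_all)

end ArcData

namespace Picture

/-- A loop has no ends, so no arc can separate it from the wall in the sense of `LeftExposed`. The
nonzero `a`-value is what permits a decorated loop. -/
theorem isLDecorated_addLoop {P : Picture n} (h : P.IsLDecorated) (ha : P.aValue ≠ 0) (m : ℕ) :
    (P.addLoop m).IsLDecorated := by
  obtain ⟨⟨h1, h2⟩, h3, h4⟩ := h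
  refine ⟨⟨?_, ?_⟩, ?_, ?_⟩
  · rintro (_ | e)
    · exact Or.inl fun x h => Option.some_ne_none _ h
    · rcases h1 e with h | h
      · exact Or.inl fun x hx => h x (Option.some_injective _ hx)
      · right
        rw [← h]
        exact Nat.card_congr (Equiv.subtypeEquivRight fun x => Option.some_inj)
  · intro a b c d i1 i2 i3 i4 i5
    exact congrArg some (h2 a b c d i1 i2 i3 (Option.some_injective _ i4)
      (Option.some_injective _ i5))
  · intro h0
    exfalso
    obtain ⟨⟨e, i, j, hij, hi, hj⟩⟩ : Nonempty {e // ∃ i j : Fin n, i ≠ j ∧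
        P.edgeAt (Sum.inl i) = e ∧ P.edgeAt (Sum.inl j) = e} := (Nat.card_ne_zero.1 ha).1
    refine Nat.card_ne_zero.2 ⟨⟨⟨some e, i, j, hij, congrArg some hi, congrArg some hj⟩⟩, ?_⟩ h0
    exact Subtype.finite
  · rintro (_ | e) he
    · rintro ⟨a, b, c, -, -, h, -⟩
      exact Option.some_ne_none _ h
    · rintro ⟨a, b, c, i1, i2, i3, i4⟩
      exact h4 e he ⟨a, b, c, i1, i2, Option.some_injective _ i3, Option.some_injective _ i4⟩

theorem isLDecorated_decorate {P : Picture n} (h : P.IsLDecorated) (ha : P.aValue ≠ 0) {e : P.E}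
    (he : P.LeftExposed e) (m : ℕ) : (P.decorate e m).IsLDecorated := by
  classical
  obtain ⟨h1, h3, h4⟩ := h
  refine ⟨h1, fun h0 => absurd h0 ha, fun (e' : P.E) he' => ?_⟩
  by_cases hee : e' = e
  · rw [hee]; exact he
  · refine h4 e' ?_
    have : (P.decorate e m).dec e' = P.dec e' := by
      simp only [decorate]
      exact Function.update_of_ne hee _ _
    rwa [this] at he'

theorem equivalent_of_map {P Q : Picture n} (f : P.E → Q.E) (hf : Function.Bijective f)
    (h : ∀ x, f (P.edgeAt x) = Q.edgeAt x) (hd : ∀ e, Q.dec (f e) = P.dec e) : Equivalent P Q :=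
  ⟨Equiv.ofBijective f hf, h, hd⟩

/-- Loop-free pictures with the same arcs and the same decorations are equivalent. -/
theorem equivalent_of_edgeAt {P Q : Picture n} (hP : Function.Surjective P.edgeAt)
    (hQ : Function.Surjective Q.edgeAt)
    (h : ∀ x y, P.edgeAt x = P.edgeAt y ↔ Q.edgeAt x = Q.edgeAt y)
    (hd : ∀ x, Q.dec (Q.edgeAt x) = P.dec (P.edgeAt x)) : Equivalent P Q := by
  choose g hg using hP
  refine equivalent_of_map (fun e => Q.edgeAt (g e)) ⟨fun e e' h' => ?_, fun e => ?_⟩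
    (fun x => (h _ _).1 (hg _)) fun e => by rw [hd, hg]
  · rw [← hg e, (h _ _).2 h', hg]
  · obtain ⟨x, rfl⟩ := hQ e
    exact ⟨P.edgeAt x, (h _ _).1 (hg _)⟩

end Picture

theorem ArcData.picture_one_equivalent (hn : 4 ≤ n) :
    Picture.Equivalent (picture n (one n)) (Picture.ident n) := by
  refine Picture.equivalent_of_edgeAt picture_edgeAt_surjective (fun e => ⟨Sum.inl e, rfl⟩) ?_ ?_
  · intro x y
    rw [(valid_one n).edgeAt_eq_iff, one_p x.pos_lt]
    rcases x with x | x <;> rcases y with y | y <;>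
      simp only [Node.pos, Picture.ident, Sum.elim_inl, Sum.elim_inr, id, Fin.ext_iff] <;> omega
  · intro x
    rw [(valid_one n).dec_edgeAt]; rfl

end

section

namespace ArcData

variable {n : ℕ} {r : ArcData}

/-! ### Concatenation with a simple diagram -/

/-- The arc at a given position. -/
def cls (hn : 4 ≤ n) (r : ArcData) (x : ℕ) : (picture n r).E := (picture n r).edgeAt (nodeAt hn x)

theorem cls_pos (hn : 4 ≤ n) (x : Node n) : cls hn r x.pos = (picture n r).edgeAt x := by
  rw [cls, nodeAt_pos]

theorem exists_cls_eq (hn : 4 ≤ n) (e : (picture n r).E) : ∃ x, x < 2 * n ∧ cls hn r x = e := by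
  obtain ⟨x, rfl⟩ := picture_edgeAt_surjective e
  exact ⟨x.pos, x.pos_lt, cls_pos hn x⟩

theorem Valid.cls_eq_iff (hr : r.Valid n) (hn : 4 ≤ n) {x y : ℕ} (hx : x < 2 * n)
    (hy : y < 2 * n) : cls hn r x = cls hn r y ↔ y = x ∨ y = r.p x := by
  rw [cls, cls, hr.edgeAt_eq_iff, pos_nodeAt hn hx, pos_nodeAt hn hy]

theorem Valid.dec_cls (hr : r.Valid n) (hn : 4 ≤ n) {x : ℕ} (hx : x < 2 * n) :
    (picture n r).dec (cls hn r x) = (r.q x).toNat := by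
  rw [cls, hr.dec_edgeAt, pos_nodeAt hn hx]

theorem lo_add (hn : 4 ≤ n) (i : Fin n) : lo n i + leftNode i + 2 = 2 * n ∧ leftNode i + 2 ≤ n := by
  unfold lo leftNode; split_ifs <;> omega

/-- The left one of the two nodes that the simple diagram joins in each face. -/
def leftFin (hn : 4 ≤ n) (i : Fin n) : Fin n := ⟨leftNode i, by have := lo_add hn i; omega⟩

/-- The right one of the two nodes that the simple diagram joins in each face. -/
def rightFin (hn : 4 ≤ n) (i : Fin n) : Fin n := ⟨leftNode i + 1, by have := lo_add hn i; omega⟩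

theorem push_single {A Z : Type} [Fintype A] [DecidableEq A] [DecidableEq Z] (f : A → Z) (a : A)
    (m : ℕ) (z : Z) : push f (fun x => if x = a then m else 0) z = if f a = z then m else 0 := by
  classical
  unfold push
  rw [Finset.sum_filter, Finset.sum_eq_single a]
  · simp
  · intro b _ hb; simp [hb]
  · intro h; exact absurd (Finset.mem_univ a) h

theorem push_simplePicture_dec {Z : Type} [DecidableEq Z] (hn : 4 ≤ n) (i : Fin n) (f : Fin n → Z)
    (z : Z) : push f (simplePicture hn i).dec z =
      (if f (leftFin hn i) = z then (decide (i.val = 0)).toNat else 0) +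
      (if f (rightFin hn i) = z then (decide (i.val = 0)).toNat else 0) := by
  have hd : (simplePicture hn i).dec = fun e : Fin n =>
      (if e = leftFin hn i then (decide (i.val = 0)).toNat else 0) +
        (if e = rightFin hn i then (decide (i.val = 0)).toNat else 0) := by
    refine funext fun e : Fin n => ?_
    show (if i.val = 0 ∧ (e.val = 0 ∨ e.val = 1) then 1 else 0) = _
    simp only [Fin.ext_iff, leftFin, rightFin]
    by_cases h0 : i.val = 0
    · have h1 : leftNode i = 0 := by simp [leftNode, h0]
      simp only [h0, h1, true_and, decide_true, Bool.toNat_true]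
      split_ifs <;> omega
    · simp [h0]
  rw [← push_single, ← push_single]
  exact (congrArg (fun d => push f d z) hd).trans (push_add _ _ _ _)

section comp

variable (hn : 4 ≤ n) (i : Fin n)

theorem simple_edgeAt_inl (x : Fin n) : (simplePicture hn i).edgeAt (Sum.inl x) =
    if x.val = leftNode i + 1 then leftFin hn i else x :=
  rfl

theorem simple_edgeAt_inr (x : Fin n) : (simplePicture hn i).edgeAt (Sum.inr x) =
    if x.val = leftNode i then rightFin hn i else x :=
  rfl

theorem simple_edgeAt_inl_left :
    (simplePicture hn i).edgeAt (Sum.inl (leftFin hn i)) = leftFin hn i :=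
  if_neg (by simp [leftFin])

theorem simple_edgeAt_inl_right :
    (simplePicture hn i).edgeAt (Sum.inl (rightFin hn i)) = leftFin hn i := if_pos rfl

theorem simple_edgeAt_inr_left :
    (simplePicture hn i).edgeAt (Sum.inr (leftFin hn i)) = rightFin hn i := if_pos rfl

theorem simple_edgeAt_inr_right :
    (simplePicture hn i).edgeAt (Sum.inr (rightFin hn i)) = rightFin hn i :=
  if_neg (by simp [rightFin])

/-- Away from the two nodes that the simple diagram joins, a node lies on the component of the
arc of the upper picture at that node. -/
theorem comp_edgeAt (P : Picture n) (x : Node n) (h1 : x.pos ≠ lo n i) (h2 : x.pos ≠ lo n i + 1) :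
    (P.comp (simplePicture hn i)).edgeAt x = Quot.mk _ (Sum.inl (P.edgeAt x)) := by
  have hl := lo_add hn i
  rcases x with x | x
  · rfl
  · simp only [Node.pos] at h1 h2
    have e1 := simple_edgeAt_inl hn i x
    have e2 := simple_edgeAt_inr hn i x
    rw [if_neg (by omega)] at e1 e2
    have := Quot.sound (Picture.Glue.glue (P := P) (Q := simplePicture hn i) x)
    rw [e1] at this
    rw [this]
    show Quot.mk _ (Sum.inr ((simplePicture hn i).edgeAt (Sum.inr x))) = _
    rw [e2]

theorem glue_lo (P : Picture n) : Quot.mk (Picture.Glue P (simplePicture hn i))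
      (Sum.inl (P.edgeAt (nodeAt hn (lo n i)))) =
    Quot.mk _ (Sum.inr (leftFin hn i)) := by
  have hl := lo_add hn i
  have e0 : nodeAt hn (lo n i) = Sum.inr (rightFin hn i) :=
    Node.pos_injective (by rw [pos_nodeAt hn (by omega)]; simp only [Node.pos, rightFin]; omega)
  have := Quot.sound (Picture.Glue.glue (P := P) (Q := simplePicture hn i) (rightFin hn i))
  rw [e0, this, simple_edgeAt_inl_right]
  rfl

theorem glue_lo_succ (P : Picture n) : Quot.mk (Picture.Glue P (simplePicture hn i))
      (Sum.inl (P.edgeAt (nodeAt hn (lo n i + 1)))) =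
    Quot.mk _ (Sum.inr (leftFin hn i)) := by
  have hl := lo_add hn i
  have e0 : nodeAt hn (lo n i + 1) = Sum.inr (leftFin hn i) :=
    Node.pos_injective (by rw [pos_nodeAt hn (by omega)]; simp only [Node.pos, leftFin]; omega)
  have := Quot.sound (Picture.Glue.glue (P := P) (Q := simplePicture hn i) (leftFin hn i))
  rw [e0, this, simple_edgeAt_inl_left]
  rfl

set_option maxHeartbeats 1600000 in
/-- A criterion for a picture to be the concatenation of an arc pattern and a simple diagram: `ρ`
is the component that meets the upper cup of the simple diagram. -/
theorem Valid.comp_simple_equivalent (hr : r.Valid n) (Q : Picture n)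
    (ι : (picture n (r.act n i)).E → Q.E) (ρ : Q.E) (hι : Function.Injective ι)
    (hedge : ∀ x, ι ((picture n (r.act n i)).edgeAt x) = Q.edgeAt x)
    (hcov : ∀ z, z = ρ ∨ ∃ e, ι e = z)
    (hloop : r.p (lo n i) = lo n i + 1 → ∀ e, ι e ≠ ρ)
    (hnl : r.p (lo n i) ≠ lo n i + 1 → ι (cls hn (r.act n i) (r.p (lo n i))) = ρ)
    (hd1 : ∀ x < 2 * n, x ≠ lo n i → x ≠ lo n i + 1 → x ≠ r.p (lo n i) → x ≠ r.p (lo n i + 1) →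
      Q.dec (ι (cls hn (r.act n i) x)) = (r.q x).toNat)
    (hd2 : Q.dec (ι (cls hn (r.act n i) (lo n i))) = (decide (i.val = 0)).toNat)
    (hd3 : Q.dec ρ = (r.q (lo n i)).toNat + (if r.p (lo n i) = lo n i + 1 then 0 else
      (r.q (lo n i + 1)).toNat) + (decide (i.val = 0)).toNat) :
    Picture.Equivalent ((picture n r).comp (simplePicture hn i)) Q := by
  classical
  have hl := lo_add hn i
  have hr' : (r.act n i).Valid n := hr.valid_act i.isLt
  have hc := hr.splice_cases (decide (i.val = 0)) (show lo n i ≠ lo n i + 1 by omega)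
  change ∀ x, _ ∨ _ at hc
  generalize hu : lo n i = u at *
  have hact : r.act n i = r.splice u (u + 1) (decide (i.val = 0)) := by rw [act, hu]
  rw [← hact] at hc
  generalize r.act n i = r' at *
  have bu := hr.bound u
  have bv := hr.bound (u + 1)
  have iu := hr.inv u
  have iv := hr.inv (u + 1)
  -- The ends of the old arcs at `u` and `u + 1`: exactly these arcs are glued to the north edge of
  -- the simple diagram.
  let K : ℕ → Prop := fun x => x = u ∨ x = u + 1 ∨ x = r.p u ∨ x = r.p (u + 1)
  have hKp : ∀ x, K x → K (r.p x) := by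
    rintro x (rfl | rfl | rfl | rfl)
    · exact Or.inr (Or.inr (Or.inl rfl))
    · exact Or.inr (Or.inr (Or.inr rfl))
    · exact Or.inl iu
    · exact Or.inr (Or.inl iv)
  have hother : ∀ x, ¬ K x → r'.p x = r.p x := by
    intro x hx
    simp only [K, not_or] at hx
    have := hc x
    omega
  -- The arcs glued to the north edge merge into `ρ`; any other arc is unchanged by the splice and
  -- keeps its positions.
  let f₁ : (picture n r).E → Q.E := fun e => if K e.1 then ρ else ι (cls hn r' e.1)
  have hf₁ : ∀ x < 2 * n, f₁ (cls hn r x) = if K x then ρ else ι (cls hn r' x) := by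
    intro x hx
    have hb := hr.bound x
    show (if K (min (nodeAt hn x).pos (r.p (nodeAt hn x).pos)) then ρ else
      ι (cls hn r' (min (nodeAt hn x).pos (r.p (nodeAt hn x).pos)))) = _
    rw [pos_nodeAt hn hx]
    rcases min_choice x (r.p x) with h | h <;> rw [h]
    by_cases hK : K x
    · rw [if_pos hK, if_pos (hKp x hK)]
    · have hK' : ¬ K (r.p x) := fun h' => hK (by have := hKp _ h'; rwa [hr.inv] at this)
      rw [if_neg hK, if_neg hK']
      congr 1
      rw [hr'.cls_eq_iff hn (by omega) hx, hother _ hK', hr.inv]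
      exact Or.inr rfl
  have hρ : ∀ x < 2 * n, x ≠ u → x ≠ u + 1 → K x → ι (cls hn r' x) = ρ := by
    intro x hx h1 h2 hK
    have hnl' : r.p u ≠ u + 1 := by
      intro h
      simp only [K] at hK
      rw [← h, iu] at hK
      omega
    rw [← hnl hnl']
    congr 1
    rw [hr'.cls_eq_iff hn hx (by omega)]
    have := hc x
    simp only [K] at hK
    omega
  -- The north edge of the simple diagram goes to `ρ`, its south edge to the new arc at `u`, and a
  -- vertical edge to the arc at its south end.
  let f₂ : Fin n → Q.E := fun e => if e.val = leftNode i then ρ else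
    if e.val = leftNode i + 1 then ι (cls hn r' u) else ι (cls hn r' (2 * n - 1 - e.val))
  have hsound : ∀ a b, Picture.Glue (picture n r) (simplePicture hn i) a b →
      Sum.elim f₁ f₂ a = Sum.elim f₁ f₂ b := by
    rintro _ _ ⟨x⟩
    have hx := Node.pos_lt (Sum.inr x : Node n)
    have e1 := hf₁ _ hx
    rw [cls_pos] at e1
    show f₁ _ = f₂ _
    rw [e1, simple_edgeAt_inl]
    have hpos : Node.pos (Sum.inr x : Node n) = 2 * n - 1 - x.val := rfl
    by_cases h1 : x.val = leftNode i + 1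
    · rw [if_pos (show K _ from Or.inl (by omega)), if_pos h1]
      simp [f₂, leftFin]
    · rw [if_neg h1]
      by_cases h2 : x.val = leftNode i
      · rw [if_pos (show K _ from Or.inr (Or.inl (by omega)))]
        simp [f₂, h2]
      · have e3 : f₂ x = ι (cls hn r' (Node.pos (Sum.inr x : Node n))) := by
          simp only [f₂, h1, h2, if_false, hpos]
        rw [e3]
        split_ifs with hK
        · exact (hρ _ hx (by omega) (by omega) hK).symm
        · rfl
  let F : ((picture n r).comp (simplePicture hn i)).E → Q.E := Quot.lift (Sum.elim f₁ f₂) hsound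
  have hcls' : ∀ x y : ℕ, x < 2 * n → y < 2 * n → (y = x ∨ y = r'.p x) →
      cls hn r' x = cls hn r' y := fun x y hx hy h => (hr'.cls_eq_iff hn hx hy).2 h
  have hFe : ∀ x, F (((picture n r).comp (simplePicture hn i)).edgeAt x) = Q.edgeAt x := by
    intro x
    have hx := x.pos_lt
    rw [← hedge, ← cls_pos hn]
    by_cases h : x.pos = u ∨ x.pos = u + 1
    · have hcu := hc u
      rw [← hcls' u x.pos (by omega) hx (by omega)]
      rcases x with x | x
      · simp only [Node.pos] at h; omega
      · show f₂ _ = _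
        rw [simple_edgeAt_inr]
        simp only [Node.pos] at h
        split_ifs with h'
        · simp [f₂, rightFin]
        · have : x.val = leftNode i + 1 := by omega
          simp [f₂, this]
    · rw [comp_edgeAt hn i _ x (by omega) (by omega)]
      show f₁ _ = _
      rw [← cls_pos hn, hf₁ _ hx]
      split_ifs with hK
      · exact (hρ _ hx (by omega) (by omega) hK).symm
      · rfl
  let lam : ((picture n r).comp (simplePicture hn i)).E :=
    Quot.mk _ (Sum.inr (leftFin hn i))
  have hFlam : F lam = ρ := by show f₂ _ = _; simp [f₂, leftFin]
  have hlamu : Quot.mk _ (Sum.inl (cls hn r u)) = lam := by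
    have := glue_lo hn i (picture n r); subst hu; exact this
  have hlamv : Quot.mk _ (Sum.inl (cls hn r (u + 1))) = lam := by
    have := glue_lo_succ hn i (picture n r); subst hu; exact this
  have hK_lam : ∀ x < 2 * n, K x → Quot.mk _ (Sum.inl (cls hn r x)) = lam := by
    intro x hx hK
    rcases hK with rfl | rfl | h | h
    · exact hlamu
    · exact hlamv
    · rw [← hlamu, (hr.cls_eq_iff hn (x := x) (y := u) hx (by omega)).2 (Or.inr (by rw [h, iu]))]
    · rw [← hlamv, (hr.cls_eq_iff hn (x := x) (y := u + 1) hx (by omega)).2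
        (Or.inr (by rw [h, iv]))]
  have hnode : ∀ x < 2 * n, x ≠ u → x ≠ u + 1 →
      ((picture n r).comp (simplePicture hn i)).edgeAt (nodeAt hn x) =
        Quot.mk _ (Sum.inl (cls hn r x)) := by
    intro x hx h1 h2
    have hp := pos_nodeAt hn hx
    rw [comp_edgeAt hn i _ _ (by omega) (by omega)]
    rfl
  have hker : ∀ x y, cls hn r' x = cls hn r' y → x < 2 * n → y < 2 * n →
      ((picture n r).comp (simplePicture hn i)).edgeAt (nodeAt hn x) =
        ((picture n r).comp (simplePicture hn i)).edgeAt (nodeAt hn y) := by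
    intro x y h hx hy
    rw [hr'.cls_eq_iff hn hx hy] at h
    rcases h with rfl | h
    · rfl
    have hsouth : ((picture n r).comp (simplePicture hn i)).edgeAt (nodeAt hn u) =
        ((picture n r).comp (simplePicture hn i)).edgeAt (nodeAt hn (u + 1)) := by
      have e0 : nodeAt hn u = Sum.inr (rightFin hn i) :=
        Node.pos_injective
          (by rw [pos_nodeAt hn (by omega)]; simp only [Node.pos, rightFin]; omega)
      have e1 : nodeAt hn (u + 1) = Sum.inr (leftFin hn i) :=
        Node.pos_injective
          (by rw [pos_nodeAt hn (by omega)]; simp only [Node.pos, leftFin]; omega)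
      rw [e0, e1]
      show Quot.mk _ (Sum.inr ((simplePicture hn i).edgeAt _)) =
        Quot.mk _ (Sum.inr ((simplePicture hn i).edgeAt _))
      rw [simple_edgeAt_inr_left, simple_edgeAt_inr_right]
    rcases hc x with h' | h' | h' | h' | h'
    · rw [h, h'.2, h'.1, hsouth]
    · rw [h, h'.2, h'.1, hsouth]
    · rw [hnode x hx (by omega) (by omega), hnode y hy (by omega) (by omega),
        hK_lam x hx (by simp only [K]; omega), hK_lam y hy (by simp only [K]; omega)]
    · rw [hnode x hx (by omega) (by omega), hnode y hy (by omega) (by omega),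
        hK_lam x hx (by simp only [K]; omega), hK_lam y hy (by simp only [K]; omega)]
    · rw [hnode x hx (by omega) (by omega), hnode y hy (by omega) (by omega),
        (hr.cls_eq_iff hn hx hy).2 (by omega)]
  -- Apart from the component `lam` of the north edge, every component reaches a node. Injectivity
  -- is thereby reduced to a comparison of end points.
  have hcovc : ∀ a : ((picture n r).comp (simplePicture hn i)).E, a = lam ∨
      ∃ x < 2 * n, ((picture n r).comp (simplePicture hn i)).edgeAt (nodeAt hn x) = a := by
    have hinl : ∀ x < 2 * n, (Quot.mk _ (Sum.inl (cls hn r x)) :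
        ((picture n r).comp (simplePicture hn i)).E) = lam ∨ ∃ y < 2 * n,
        ((picture n r).comp (simplePicture hn i)).edgeAt (nodeAt hn y) =
          Quot.mk _ (Sum.inl (cls hn r x)) := by
      intro x hx
      by_cases hK : K x
      · exact Or.inl (hK_lam x hx hK)
      · simp only [K, not_or] at hK
        exact Or.inr ⟨x, hx, hnode x hx hK.1 hK.2.1⟩
    rintro ⟨e | e⟩
    · obtain ⟨x, hx, rfl⟩ := exists_cls_eq hn e
      exact hinl x hx
    · by_cases h1 : e.val = leftNode i
      · left
        have : e = leftFin hn i := Fin.ext h1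
        rw [this]
      · right
        refine ⟨Node.pos (Sum.inr e : Node n), Node.pos_lt _, ?_⟩
        rw [nodeAt_pos]
        exact congrArg (fun z => Quot.mk _ (Sum.inr z))
          ((simple_edgeAt_inr hn i e).trans (if_neg h1))
  have hFnode : ∀ x < 2 * n, F (((picture n r).comp (simplePicture hn i)).edgeAt (nodeAt hn x)) =
      ι (cls hn r' x) := fun x hx => by rw [hFe, ← hedge]; rfl
  have hlamcase : ∀ x < 2 * n, ι (cls hn r' x) = ρ →
      ((picture n r).comp (simplePicture hn i)).edgeAt (nodeAt hn x) = lam := by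
    intro x hx h
    by_cases hlp : r.p u = u + 1
    · exact absurd h (hloop hlp _)
    · rw [← hnl hlp] at h
      have hpu : r.p u < 2 * n := by omega
      rw [hker x (r.p u) (hι h) hx hpu, hnode _ hpu (by omega) hlp]
      exact hK_lam _ hpu (by simp [K])
  have hFinj : Function.Injective F := by
    intro a b hab
    rcases hcovc a with rfl | ⟨x, hx, rfl⟩ <;> rcases hcovc b with rfl | ⟨y, hy, rfl⟩
    · rfl
    · rw [hFlam, hFnode y hy] at hab
      exact (hlamcase y hy hab.symm).symm
    · rw [hFlam, hFnode x hx] at hab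
      exact hlamcase x hx hab
    · rw [hFnode x hx, hFnode y hy] at hab
      exact hker x y (hι hab) hx hy
  have hFsurj : Function.Surjective F := by
    intro z
    rcases hcov z with rfl | ⟨e, rfl⟩
    · exact ⟨lam, hFlam⟩
    · obtain ⟨x, rfl⟩ := picture_edgeAt_surjective e
      exact ⟨_, (hFe x).trans (hedge x).symm⟩
  have hρne : ∀ x < 2 * n, ¬ K x → ι (cls hn r' x) ≠ ρ := by
    intro x hx hK h
    by_cases hlp : r.p u = u + 1
    · exact hloop hlp _ h
    · rw [← hnl hlp] at h
      have := (hr'.cls_eq_iff hn hx (by omega)).1 (hι h)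
      rw [hother x hK] at this
      have h2 := hKp (r.p x)
      rw [hr.inv] at h2
      simp only [K] at *
      omega
  have hρu : ι (cls hn r' u) ≠ ρ := by
    intro h
    by_cases hlp : r.p u = u + 1
    · exact hloop hlp _ h
    · rw [← hnl hlp] at h
      have := (hr'.cls_eq_iff hn (by omega) (by omega)).1 (hι h)
      have := hc u
      omega
  have hdec : ∀ z, Q.dec z = push f₁ (picture n r).dec z + push f₂ (simplePicture hn i).dec z := by
    intro z
    rw [push_simplePicture_dec]
    have g1 : f₂ (leftFin hn i) = ρ := by simp [f₂, leftFin]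
    have g2 : f₂ (rightFin hn i) = ι (cls hn r' u) := by simp [f₂, rightFin]
    rw [g1, g2]
    have hcz : z = ρ ∨ z = ι (cls hn r' u) ∨ ∃ x < 2 * n, ¬ K x ∧ z = ι (cls hn r' x) := by
      rcases hcov z with h | ⟨e, rfl⟩
      · exact Or.inl h
      · obtain ⟨x, hx, rfl⟩ := exists_cls_eq hn e
        by_cases hK : K x
        · by_cases h : x = u ∨ x = u + 1
          · have := hc u
            exact Or.inr (Or.inl (congrArg ι (hcls' u x (by omega) hx (by omega)).symm))
          · exact Or.inl (hρ x hx (by omega) (by omega) hK)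
        · exact Or.inr (Or.inr ⟨x, hx, hK, rfl⟩)
    rcases hcz with rfl | rfl | ⟨x, hx, hK, rfl⟩
    · rw [if_pos rfl, if_neg hρu, hd3]
      have hfil : (Finset.univ.filter fun e => f₁ e = z) = {cls hn r u, cls hn r (u + 1)} := by
        ext e
        obtain ⟨x, hx, rfl⟩ := exists_cls_eq hn e
        rw [Finset.mem_filter, hf₁ x hx, Finset.mem_insert, Finset.mem_singleton,
          hr.cls_eq_iff hn hx (by omega), hr.cls_eq_iff hn hx (by omega)]
        have ix := hr.inv x
        constructor
        · rintro ⟨-, h⟩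
          split_ifs at h with hK
          · rcases hK with h | h | h | h
            · exact Or.inl (Or.inl h.symm)
            · exact Or.inr (Or.inl h.symm)
            · exact Or.inl (Or.inr (by rw [h, iu]))
            · exact Or.inr (Or.inr (by rw [h, iv]))
          · exact absurd h (hρne x hx hK)
        · intro h
          refine ⟨Finset.mem_univ _, if_pos ?_⟩
          rcases h with (h | h) | (h | h)
          · exact Or.inl h.symm
          · exact Or.inr (Or.inr (Or.inl (by rw [h, ix])))
          · exact Or.inr (Or.inl h.symm)
          · exact Or.inr (Or.inr (Or.inr (by rw [h, ix])))
      unfold push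
      rw [hfil]
      -- If `u` and `u + 1` are joined, both name the same arc, whose decorations are counted once;
      -- this is the reason for the case distinction in `hd3`.
      by_cases hlp : r.p u = u + 1
      · have : cls hn r u = cls hn r (u + 1) :=
          (hr.cls_eq_iff hn (by omega) (by omega)).2 (Or.inr hlp.symm)
        rw [← this, if_pos hlp, Finset.pair_eq_singleton, Finset.sum_singleton,
          hr.dec_cls hn (by omega)]
        omega
      · have : cls hn r u ≠ cls hn r (u + 1) := fun h => by
          have := (hr.cls_eq_iff hn (by omega) (by omega)).1 h
          omega
        rw [if_neg hlp, Finset.sum_pair this, hr.dec_cls hn (by omega), hr.dec_cls hn (by omega)]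
        omega
    · rw [if_neg hρu.symm, if_pos rfl, hd2]
      have : push f₁ (picture n r).dec (ι (cls hn r' u)) = 0 := by
        refine Finset.sum_eq_zero fun e he => ?_
        exfalso
        obtain ⟨x, hx, rfl⟩ := exists_cls_eq hn e
        rw [Finset.mem_filter, hf₁ x hx] at he
        split_ifs at he with hK
        · exact hρu he.2.symm
        · have h1 := (hr'.cls_eq_iff hn hx (by omega)).1 (hι he.2)
          rw [hother x hK] at h1
          have h2 := hKp (r.p x)
          rw [hr.inv] at h2
          simp only [K] at *
          omega
      rw [this]
      omega
    · have hxu : ι (cls hn r' u) ≠ ι (cls hn r' x) := fun h => by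
        have h1 := (hr'.cls_eq_iff hn (by omega) hx).1 (hι h)
        have := hc u
        simp only [K] at hK
        omega
      rw [if_neg (hρne x hx hK).symm, if_neg hxu]
      have hfil : (Finset.univ.filter fun e => f₁ e = ι (cls hn r' x)) = {cls hn r x} := by
        ext e
        obtain ⟨y, hy, rfl⟩ := exists_cls_eq hn e
        rw [Finset.mem_filter, hf₁ y hy, Finset.mem_singleton, hr.cls_eq_iff hn hy hx]
        constructor
        · rintro ⟨-, h⟩
          split_ifs at h with hKy
          · exact absurd h.symm (hρne x hx hK)
          · have := (hr'.cls_eq_iff hn hy hx).1 (hι h)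
            rwa [hother y hKy] at this
        · intro h
          have hKy : ¬ K y := by
            rcases h with rfl | h
            · exact hK
            · exact fun h' => hK (h ▸ hKp y h')
          refine ⟨Finset.mem_univ _, ?_⟩
          rw [if_neg hKy]
          exact congrArg ι ((hr'.cls_eq_iff hn hy hx).2 (by rw [hother y hKy]; exact h))
      unfold push
      rw [hfil, Finset.sum_singleton, hr.dec_cls hn hx]
      simp only [K, not_or] at hK
      rw [hd1 x hx hK.1 hK.2.1 hK.2.2.1 hK.2.2.2]
      omega
  refine Picture.equivalent_of_map F ⟨hFinj, hFsurj⟩ hFe fun a => ?_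
  rw [hdec]
  exact congrArg₂ (· + ·)
    (push_inj F hFinj (fun e => Quot.mk (Picture.Glue (picture n r) (simplePicture hn i))
      (Sum.inl e)) (picture n r).dec a)
    (push_inj F hFinj (fun e => Quot.mk (Picture.Glue (picture n r) (simplePicture hn i))
      (Sum.inr e)) (simplePicture hn i).dec a)

end comp

end ArcData

end

section

variable {n : ℕ}

/-! ## Products with simple diagrams -/

/-- The class of a picture in the diagram algebra, and `0` if it is not `L`-decorated. -/
def hat (P : Picture n) : PHat n :=
  open Classical in if h : P.IsLDecorated then PHat.of (.mk P h) else 0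

theorem hat_eq {P : Picture n} (h : P.IsLDecorated) : hat P = PHat.of (.mk P h) := dif_pos h

theorem hat_mul {P Q R : Picture n} (hP : P.IsLDecorated) (hQ : Q.IsLDecorated)
    (hR : R.IsLDecorated) (h : Picture.Equivalent (P.comp Q) R) : hat P * hat Q = hat R := by
  rw [hat_eq hP, hat_eq hQ, hat_eq hR, PHat.of, PHat.of, PHat.of, ← map_mul]
  congr 1
  refine Subtype.ext ?_
  show MonoidAlgebra.of _ _ _ * MonoidAlgebra.of _ _ _ = MonoidAlgebra.of _ _ _
  rw [← map_mul]
  exact congrArg _ (Quotient.sound h)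

theorem hat_eq_one {P : Picture n} (hP : P.IsLDecorated)
    (h : Picture.Equivalent P (Picture.ident n)) : hat P = 1 := by
  rw [hat_eq hP, PHat.of, ← map_one (RingQuot.mkAlgHom ℤ[X] (HatRel n))]
  congr 1
  refine Subtype.ext ?_
  show MonoidAlgebra.of _ _ _ = 1
  rw [← map_one (MonoidAlgebra.of ℤ[X] (Diagram n))]
  exact congrArg _ (Quotient.sound h)

theorem simpleHat_eq (hn : 4 ≤ n) (i : Fin n) : simpleHat hn i = hat (simplePicture hn i) :=
  (hat_eq _).symm

theorem hat_decorate_two {P : Picture n} (e : P.E) (h : (P.decorate e 2).IsLDecorated)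
    (h' : P.IsLDecorated) : hat (P.decorate e 2) = hat P := by
  rw [hat_eq h, hat_eq h']
  exact RingQuot.mkAlgHom_rel _ (.cancel P e h h')

theorem hat_addLoop_zero {P : Picture n} (h : (P.addLoop 0).IsLDecorated) (h' : P.IsLDecorated) :
    hat (P.addLoop 0) = (X : ℤ[X]) • hat P := by
  rw [hat_eq h, hat_eq h', PHat.of, PHat.of, ← map_smul]
  exact RingQuot.mkAlgHom_rel _ (.loop P h h')

/-- In this form the cancellation relation applies, after which the undecorated loop contributes δ.
-/
theorem Picture.addLoop_two (P : Picture n) :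
    P.addLoop 2 = (P.addLoop 0).decorate (none : Option P.E) 2 := by
  classical
  unfold Picture.decorate Picture.addLoop
  congr 1
  funext e
  rcases e with _ | e
  · exact (@Function.update_self (Option P.E) (fun _ => ℕ)
      (fun a b => Classical.propDecidable (a = b)) none _ _).symm
  · exact (@Function.update_of_ne (Option P.E) (fun _ => ℕ)
      (fun a b => Classical.propDecidable (a = b)) _ _ (Option.some_ne_none e) _
      (fun e => e.elim 0 P.dec)).symm

theorem Picture.decorate_zero (P : Picture n) (e : P.E) : P.decorate e 0 = P := by
  classical
  unfold Picture.decorate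
  congr 1
  exact Function.update_eq_self _ _

namespace ArcData

variable {r : ArcData}

/-- The counting of `exists_south_arc` with the faces exchanged. It ensures a nonzero `a`-value
wherever decorations may occur. -/
theorem Valid.hasCap (hr : r.Valid n) {x : ℕ} (hx : n ≤ x) (hpx : n ≤ r.p x) (hx' : x < 2 * n) :
    r.HasCap n := by
  by_contra hno
  simp only [HasCap, not_exists, not_and, not_lt] at hno
  have hmap : ∀ y ∈ Finset.range n, r.p y ∈ Finset.Ico n (2 * n) := by
    intro y hy
    have := Finset.mem_range.1 hy
    exact Finset.mem_Ico.2 ⟨hno y this, hr.lt y (by omega)⟩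
  have hinj : Set.InjOn r.p (Finset.range n : Set ℕ) := fun a _ b _ h => by
    rw [← hr.inv a, h, hr.inv]
  obtain ⟨y, hy, rfl⟩ := Finset.surj_on_of_inj_on_of_card_le (fun a _ => r.p a) hmap
    (fun a b ha hb h => hinj (by simpa using ha) (by simpa using hb) h)
    (by simp; omega) x (Finset.mem_Ico.2 ⟨hx, hx'⟩)
  rw [hr.inv] at hpx
  have := Finset.mem_range.1 hy
  omega

theorem lo_bounds (hn : 4 ≤ n) {s : ℕ} (hs : s < n) : lo n s + 1 < 2 * n ∧ n ≤ lo n s := by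
  unfold lo; omega

theorem Valid.hasCap_of_cup (hr : r.Valid n) (hn : 4 ≤ n) {s : ℕ} (hs : s < n)
    (h : r.p (lo n s) = lo n s + 1) :
    r.HasCap n := by
  have := lo_bounds hn hs
  exact hr.hasCap (x := lo n s) (by omega) (by omega) (by omega)

theorem Valid.hasCap_act (hr : r.Valid n) (hn : 4 ≤ n) {s : ℕ} (hs : s < n) :
    (r.act n s).HasCap n :=
  (hr.valid_act hs).hasCap_of_cup hn hs (hr.act_cup s).1

theorem Valid.isLDecorated_of_hasCap (hr : r.Valid n) (hn : 4 ≤ n) (h : r.HasCap n) :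
    (picture n r).IsLDecorated := hr.isLDecorated hn (Or.inl h)

theorem Valid.isLDecorated_act (hr : r.Valid n) (hn : 4 ≤ n) (i : Fin n) :
    (picture n (r.act n i)).IsLDecorated :=
  (hr.valid_act i.isLt).isLDecorated_of_hasCap hn (hr.hasCap_act hn i.isLt)

/-- The arc that a splice creates out of two arcs is left exposed if one of these is decorated. -/
theorem Valid.leftExposed_splice (hr : r.Valid n) (hn : 4 ≤ n) (i : Fin n)
    (hl : r.p (lo n i) ≠ lo n i + 1)
    (hq : r.q (lo n i) = true ∨ r.q (lo n i + 1) = true) :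
    (picture n (r.act n i)).LeftExposed (cls hn (r.act n i) (r.p (lo n i))) := by
  have hr' := hr.valid_act i.isLt
  have hc := hr.splice_cases (decide (i.val = 0)) (show lo n i ≠ lo n i + 1 by omega)
  change ∀ x, _ ∨ _ at hc
  have hlo := lo_add hn i
  have hact : r.act n i = r.splice (lo n i) (lo n i + 1) (decide (i.val = 0)) := rfl
  rw [← hact] at hc
  generalize r.act n i = r' at *
  generalize lo n i = u at *
  have bu := hr.bound u
  have bv := hr.bound (u + 1)
  have iu := hr.inv u
  have iv := hr.inv (u + 1)
  rintro ⟨a, b, c, h1, h2, h3, h4⟩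
  rw [cls, eq_comm, hr'.edgeAt_eq_iff, pos_nodeAt hn (by omega)] at h3
  rw [hr'.edgeAt_eq_iff] at h4
  have h4' : c.pos = r'.p a.pos := by omega
  have hz : ∀ z, z = r.p u ∨ z = r.p (u + 1) → r.q z = true →
      ¬ (a.pos < z ∧ z < r'.p a.pos) := by
    intro z hz hqz h
    have := hr.ex a.pos z hqz
    rcases hc a.pos with h' | h' | h' | h' | h' <;> omega
  have hex : ∀ z, z = r.p u ∨ z = r.p (u + 1) → r.q z = true → b.pos = z ∨ b.pos = r'.p z →
      False := by
    intro z hz1 hz2 hb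
    have h5 := hz z hz1 hz2
    rcases hb with hb | hb
    · omega
    · have := hr'.side (x := a.pos) (y := z) (fun h => by rw [h] at hb; omega)
        (fun h => by rw [h, hr'.inv] at hb; omega)
      omega
  have hpu : r'.p (r.p u) = r.p (u + 1) ∧ r'.p (r.p (u + 1)) = r.p u := by
    have h5 := hc (r.p u)
    have h6 := hc (r.p (u + 1))
    constructor
    · rcases h5 with h' | h' | h' | h' | h' <;> omega
    · rcases h6 with h' | h' | h' | h' | h' <;> omega
  rcases hq with hq | hq
  · exact hex (r.p u) (Or.inl rfl) (by rw [hr.q_p, hq]) h3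
  · refine hex (r.p (u + 1)) (Or.inr rfl) (by rw [hr.q_p, hq]) ?_
    omega

/-- Multiplication by a simple diagram that creates no loop. -/
theorem Valid.hat_mul_simpleHat (hr : r.Valid n) (hn : 4 ≤ n) (hP : (picture n r).IsLDecorated)
    (i : Fin n) (hl : r.p (lo n i) ≠ lo n i + 1) :
    hat (picture n r) * simpleHat hn i = hat (picture n (r.act n i)) := by
  classical
  have hr' := hr.valid_act i.isLt
  have hL := hr.isLDecorated_act hn i
  have ha := hr'.aValue_ne_zero (hr.hasCap_act hn i.isLt)
  have hlo := lo_add hn i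
  have bu := hr.bound (lo n i)
  have bv := hr.bound (lo n i + 1)
  have iu := hr.inv (lo n i)
  have iv := hr.inv (lo n i + 1)
  have hc := hr.splice_cases (decide (i.val = 0)) (show lo n i ≠ lo n i + 1 by omega)
  change ∀ x, _ ∨ _ at hc
  have hact : r.act n i = r.splice (lo n i) (lo n i + 1) (decide (i.val = 0)) := rfl
  rw [← hact] at hc
  have hcu := hc (lo n i)
  have hcpu := hc (r.p (lo n i))
  have hq' : (r.act n i).q (r.p (lo n i)) =
      (r.q (lo n i) ^^ r.q (lo n i + 1) ^^ decide (i.val = 0)) := by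
    rw [hact, splice_q, if_neg (by omega), if_pos (Or.inl rfl)]
  -- Concatenation adds up decorations whereas patterns keep parities only; `m` is the surplus on
  -- the merged arc.
  have key : ∀ m, (r.q (lo n i)).toNat + (r.q (lo n i + 1)).toNat + (decide (i.val = 0)).toNat =
      ((r.act n i).q (r.p (lo n i))).toNat + m →
      Picture.Equivalent ((picture n r).comp (simplePicture hn i))
        ((picture n (r.act n i)).decorate (cls hn (r.act n i) (r.p (lo n i))) m) := by
    intro m hm
    have hdec : ∀ x < 2 * n, x ≠ r.p (lo n i) → x ≠ r.p (lo n i + 1) →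
        ((picture n (r.act n i)).decorate (cls hn (r.act n i) (r.p (lo n i))) m).dec
          (cls hn (r.act n i) x) = ((r.act n i).q x).toNat := by
      intro x hx h1 h2
      have hne : cls hn (r.act n i) x ≠ cls hn (r.act n i) (r.p (lo n i)) := fun h => by
        rw [hr'.cls_eq_iff hn hx (by omega)] at h
        have := hr'.inv x
        rcases h with h | h
        · omega
        · rw [← h] at this
          omega
      rw [← hr'.dec_cls hn hx]
      exact Function.update_of_ne hne _ _
    refine hr.comp_simple_equivalent hn i _ id (cls hn (r.act n i) (r.p (lo n i)))
      Function.injective_id (fun x => rfl) (fun z => Or.inr ⟨z, rfl⟩) (fun h => absurd h hl)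
      (fun _ => rfl) ?_ ?_ ?_
    · intro x hx h1 h2 h3 h4
      refine (hdec x hx h3 h4).trans ?_
      rw [hact, splice_q, if_neg (by omega), if_neg (by omega)]
    · refine (hdec (lo n i) (by omega) (by omega) (by omega)).trans ?_
      rw [(hr.act_cup i).2]
    · rw [if_neg hl, hm]
      rw [← hr'.dec_cls hn (by omega)]
      exact Function.update_self (β := fun _ => ℕ) (cls hn (r.act n i) (r.p (lo n i))) _ _
  rw [simpleHat_eq]
  -- The surplus is 0 or 2. If it is 2, one of the old arcs was decorated, so the merged arc is
  -- exposed and the intermediate picture is a legitimate `L`-decorated diagram.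
  have hcase : ((r.q (lo n i)).toNat + (r.q (lo n i + 1)).toNat + (decide (i.val = 0)).toNat =
      ((r.act n i).q (r.p (lo n i))).toNat + 0) ∨
      (((r.q (lo n i)).toNat + (r.q (lo n i + 1)).toNat + (decide (i.val = 0)).toNat =
      ((r.act n i).q (r.p (lo n i))).toNat + 2) ∧
        (r.q (lo n i) = true ∨ r.q (lo n i + 1) = true)) := by
    rw [hq']
    cases r.q (lo n i) <;> cases r.q (lo n i + 1) <;> cases decide (i.val = 0) <;> decide
  rcases hcase with h | ⟨h, hq⟩
  · have := key 0 h
    rw [Picture.decorate_zero] at this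
    exact hat_mul hP (simplePicture_isLDecorated hn i) hL this
  · have hex := hr.leftExposed_splice hn i hl hq
    have hL2 := Picture.isLDecorated_decorate hL ha hex 2
    rw [hat_mul hP (simplePicture_isLDecorated hn i) hL2 (key 2 h), hat_decorate_two _ hL2 hL]

theorem Valid.hat_mul_simpleHat_loop (hr : r.Valid n) (hn : 4 ≤ n) (i : Fin n)
    (hl : r.p (lo n i) = lo n i + 1) :
    hat (picture n r) * simpleHat hn i = hat ((picture n (r.act n i)).addLoop
      ((r.q (lo n i)).toNat + (decide (i.val = 0)).toNat)) := by
  have hr' := hr.valid_act i.isLt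
  have hL := hr.isLDecorated_act hn i
  have ha := hr'.aValue_ne_zero (hr.hasCap_act hn i.isLt)
  rw [simpleHat_eq]
  refine hat_mul (hr.isLDecorated_of_hasCap hn (hr.hasCap_of_cup hn i.isLt hl))
    (simplePicture_isLDecorated hn i) (Picture.isLDecorated_addLoop hL ha _) ?_
  have iu := hr.inv (lo n i)
  have hlo := lo_add hn i
  refine hr.comp_simple_equivalent hn i _ some none (Option.some_injective _) (fun x => rfl)
    ?_ (fun _ e => Option.some_ne_none e) (fun h => absurd hl h) ?_ ?_ ?_
  · rintro (_ | e)
    · exact Or.inl rfl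
    · exact Or.inr ⟨e, rfl⟩
  · intro x hx h1 h2 h3 h4
    show (picture n (r.act n i)).dec _ = _
    rw [hr'.dec_cls hn hx, act, splice_q, if_neg (by omega), if_neg (by omega)]
  · show (picture n (r.act n i)).dec _ = _
    rw [hr'.dec_cls hn (by omega), (hr.act_cup i).2]
  · rw [if_pos hl]
    rfl

theorem Valid.act_eq_self (hr : r.Valid n) {s : ℕ} (hl : r.p (lo n s) = lo n s + 1)
    (hq : r.q (lo n s) = decide (s = 0)) : r.act n s = r := by
  have iu := hr.inv (lo n s)
  rw [hl] at iu
  have hqv : r.q (lo n s + 1) = decide (s = 0) := by rw [← hl, hr.q_p, hq]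
  have hc := hr.splice_cases (decide (s = 0)) (show lo n s ≠ lo n s + 1 by omega)
  ext x
  · unfold act
    rcases hc x with ⟨h, h'⟩ | ⟨h, h'⟩ | h | h | h
    · rw [h', h, hl]
    · rw [h', h, iu]
    · omega
    · omega
    · omega
  · rw [act, splice_q]
    split_ifs with h h'
    · rcases h with rfl | rfl
      · rw [hq]
      · rw [hqv]
    · rw [hl, iu] at h'; omega
    · rfl

/-- The closed loop carries no decoration or two cancelling ones, and the splice returns the same
pattern. -/
theorem Valid.hat_mul_simpleHat_smul (hr : r.Valid n) (hn : 4 ≤ n) (i : Fin n)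
    (hl : r.p (lo n i) = lo n i + 1) (hq : r.q (lo n i) = decide (i.val = 0)) :
    hat (picture n r) * simpleHat hn i = (X : ℤ[X]) • hat (picture n r) := by
  have hc := hr.hasCap_of_cup hn i.isLt hl
  have hL := hr.isLDecorated_of_hasCap hn hc
  have ha := hr.aValue_ne_zero hc
  rw [hr.hat_mul_simpleHat_loop hn i hl, hr.act_eq_self hl hq, hq,
    ← hat_addLoop_zero (Picture.isLDecorated_addLoop hL ha 0) hL]
  cases decide (i.val = 0)
  · rfl
  · have h2 := Picture.isLDecorated_addLoop hL ha 2
    have h3 := Picture.addLoop_two (picture n r)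
    show hat ((picture n r).addLoop 2) = _
    rw [h3] at h2 ⊢
    exact hat_decorate_two _ h2 (Picture.isLDecorated_addLoop hL ha 0)

theorem isLDecorated_one (hn : 4 ≤ n) : (picture n (one n)).IsLDecorated :=
  (valid_one n).isLDecorated hn (Or.inr fun _ => rfl)

theorem one_no_cup (hn : 4 ≤ n) {s : ℕ} (hs : s < n) : (one n).p (lo n s) ≠ lo n s + 1 := by
  have := lo_bounds hn hs
  rw [one_p (by omega)]
  omega

theorem simpleHat_eq_act_one (hn : 4 ≤ n) (i : Fin n) :
    simpleHat hn i = hat (picture n ((one n).act n i)) := by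
  rw [← (valid_one n).hat_mul_simpleHat hn (isLDecorated_one hn) i (one_no_cup hn i.isLt),
    hat_eq_one (isLDecorated_one hn) (picture_one_equivalent hn), one_mul]

theorem simpleHat_sq (hn : 4 ≤ n) (i : Fin n) :
    simpleHat hn i * simpleHat hn i = (X : ℤ[X]) • simpleHat hn i := by
  have hc := (valid_one n).act_cup i
  have := ((valid_one n).valid_act i.isLt).hat_mul_simpleHat_smul hn i hc.1 hc.2
  rwa [← simpleHat_eq_act_one] at this

/-- Joined generators act at places that overlap in one position, so the two last factors form a
zigzag and `splice_splice` applies, directly or after exchanging the arguments of the splices. -/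
theorem simpleHat_braid (hn : 4 ≤ n) (i j : Fin n) (h : Joined i j) :
    simpleHat hn i * simpleHat hn j * simpleHat hn i = simpleHat hn i := by
  have h1 := (valid_one n).valid_act i.isLt
  have hL1 := (valid_one n).isLDecorated_act hn i
  have hc := (valid_one n).act_cup i
  rw [simpleHat_eq_act_one hn i]
  nth_rw 2 [← simpleHat_eq_act_one hn i]
  generalize (one n).act n i = r at *
  have h2 := h1.valid_act j.isLt
  have hij : lo n j = lo n i + 1 ∨ lo n i = lo n j + 1 := by
    have := i.isLt; have := j.isLt
    unfold Joined at h; unfold lo; omega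
  have hloi := lo_add hn i
  have hloj := lo_add hn j
  have iu := h1.inv (lo n i)
  rw [hc.1] at iu
  have hcj := h1.act_cup j
  have iuj := h2.inv (lo n j)
  rw [hcj.1] at iuj
  rw [h1.hat_mul_simpleHat hn hL1 j, h2.hat_mul_simpleHat hn (h1.isLDecorated_act hn j) i]
  · congr 2
    rcases hij with hij | hij
    · rw [act, act, hij]
      exact h1.splice_splice (by omega) (by omega) (by omega) hc.1 hc.2 (by omega)
    · rw [act, h2.splice_comm _ (by omega), act, h1.splice_comm _ (by omega), ← hij]
      exact h1.splice_splice (by omega) (by omega) (by omega) iu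
        (by rw [← hc.2, ← h1.q_p, iu]) (by omega)
  · rcases hij with hij | hij
    · rw [← hij]; intro h; rw [← h, h2.inv] at hcj; omega
    · rw [hij, iuj]; omega
  · rcases hij with hij | hij
    · rw [hij, iu]; omega
    · intro h; rw [← hij] at h; rw [← h, h1.inv] at hc; omega

theorem act_one_p (hn : 4 ≤ n) {s x : ℕ} (hs : s < n) : ((one n).act n s).p x =
    if x = lo n s then lo n s + 1 else if x = lo n s + 1 then lo n s else
    if x = 2 * n - 1 - lo n s then 2 * n - 2 - lo n s else
    if x = 2 * n - 2 - lo n s then 2 * n - 1 - lo n s else (one n).p x := by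
  have := lo_bounds hn hs
  simp only [act, splice, one_p (show lo n s < 2 * n by omega), one_p this.1]
  rw [show 2 * n - 1 - (lo n s + 1) = 2 * n - 2 - lo n s by omega]

theorem act_one_q (hn : 4 ≤ n) {s x : ℕ} (hs : s < n) : ((one n).act n s).q x =
    if x = lo n s ∨ x = lo n s + 1 ∨ x = 2 * n - 1 - lo n s ∨ x = 2 * n - 2 - lo n s then
      decide (s = 0) else false := by
  have := lo_bounds hn hs
  rw [act, splice_q, one_p (show lo n s < 2 * n by omega), one_p this.1,
    show 2 * n - 1 - (lo n s + 1) = 2 * n - 2 - lo n s by omega]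
  simp only [one, Bool.false_bne]
  split_ifs <;> first | rfl | omega

theorem act_one_comm (hn : 4 ≤ n) {s t : ℕ} (hs : s < n) (ht : t < n) (h : lo n s + 2 ≤ lo n t) :
    ((one n).act n s).act n t = ((one n).act n t).act n s := by
  have h1 := lo_bounds hn hs
  have h2 := lo_bounds hn ht
  have ps : ((one n).act n s).p (lo n t) = 2 * n - 1 - lo n t := by
    rw [act_one_p hn hs, if_neg (by omega), if_neg (by omega), if_neg (by omega), if_neg (by omega),
      one_p (by omega)]
  have ps' : ((one n).act n s).p (lo n t + 1) = 2 * n - 2 - lo n t := by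
    rw [act_one_p hn hs, if_neg (by omega), if_neg (by omega), if_neg (by omega), if_neg (by omega),
      one_p (by omega)]
    omega
  have pt : ((one n).act n t).p (lo n s) = 2 * n - 1 - lo n s := by
    rw [act_one_p hn ht, if_neg (by omega), if_neg (by omega), if_neg (by omega), if_neg (by omega),
      one_p (by omega)]
  have pt' : ((one n).act n t).p (lo n s + 1) = 2 * n - 2 - lo n s := by
    rw [act_one_p hn ht, if_neg (by omega), if_neg (by omega), if_neg (by omega), if_neg (by omega),
      one_p (by omega)]
    omega
  have qs : ((one n).act n s).q (lo n t) = false := by rw [act_one_q hn hs, if_neg (by omega)]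
  have qs' : ((one n).act n s).q (lo n t + 1) = false := by rw [act_one_q hn hs, if_neg (by omega)]
  have qt : ((one n).act n t).q (lo n s) = false := by rw [act_one_q hn ht, if_neg (by omega)]
  have qt' : ((one n).act n t).q (lo n s + 1) = false := by rw [act_one_q hn ht, if_neg (by omega)]
  ext x
  · show (((one n).act n s).splice _ _ _).p x = (((one n).act n t).splice _ _ _).p x
    simp only [splice, ps, ps', pt, pt']
    rw [act_one_p hn hs, act_one_p hn ht]
    split_ifs <;> omega
  · show (((one n).act n s).splice _ _ _).q x = (((one n).act n t).splice _ _ _).q x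
    rw [splice_q, splice_q, ps, ps', pt, pt', qs, qs', qt, qt', act_one_q hn hs, act_one_q hn ht]
    simp only [Bool.false_bne]
    split_ifs <;> first | rfl | omega

theorem simpleHat_comm_of_lo (hn : 4 ≤ n) (i j : Fin n) (h : lo n i + 2 ≤ lo n j) :
    simpleHat hn i * simpleHat hn j = simpleHat hn j * simpleHat hn i := by
  have key : ∀ s t : Fin n, lo n s + 2 ≤ lo n t ∨ lo n t + 2 ≤ lo n s →
      simpleHat hn s * simpleHat hn t = hat (picture n (((one n).act n s).act n t)) := by
    intro s t hst
    have hs := lo_bounds hn s.isLt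
    have ht := lo_bounds hn t.isLt
    rw [simpleHat_eq_act_one hn s]
    refine ((valid_one n).valid_act s.isLt).hat_mul_simpleHat hn
      ((valid_one n).isLDecorated_act hn s) t ?_
    rw [act_one_p hn s.isLt, one_p (by omega)]
    split_ifs <;> omega
  rw [key i j (Or.inl h), key j i (Or.inr h), act_one_comm hn i.isLt j.isLt h]

/-- Both products of `d_1` and `d_{\bar 1}` contain a loop with one decoration. -/
theorem simpleHat_mul_eq_addLoop (hn : 4 ≤ n) (i j : Fin n) (h : lo n i = lo n j)
    (hij : i.val = 0 ↔ j.val ≠ 0) : ∃ P : Picture n, (P.addLoop 1).IsLDecorated ∧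
      simpleHat hn i * simpleHat hn j = hat (P.addLoop 1) := by
  have hr := (valid_one n).valid_act i.isLt
  have hc := (valid_one n).act_cup i
  have hr' := hr.valid_act j.isLt
  refine ⟨_, Picture.isLDecorated_addLoop (hr.isLDecorated_act hn j)
    (hr'.aValue_ne_zero (hr.hasCap_act hn j.isLt)) 1, ?_⟩
  rw [simpleHat_eq_act_one hn i, hr.hat_mul_simpleHat_loop hn j (by rw [← h]; exact hc.1),
    ← h, hc.2]
  by_cases hi : i.val = 0
  · have := hij.1 hi
    simp [hi, this]
  · have : j.val = 0 := by tauto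
    simp [hi, this]

/-- The class of the diagram of a normal word is the product of the simple diagrams. -/
theorem hat_run_normal (hn : 4 ≤ n) {L : List (ℕ × ℕ)} (hL : Normal n L) :
    (picture n (run n (rowsWord L))).IsLDecorated ∧ ∀ ω : List (Fin n),
      ω.map Fin.val = rowsWord L →
        hat (picture n (run n (rowsWord L))) = (ω.map (simpleHat hn)).prod := by
  refine Normal.induction (P := fun w => (picture n (run n w)).IsLDecorated ∧ ∀ ω : List (Fin n),
      ω.map Fin.val = w → hat (picture n (run n w)) = (ω.map (simpleHat hn)).prod) ?_ ?_ L hL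
  · refine ⟨isLDecorated_one hn, fun ω hω => ?_⟩
    rw [List.map_eq_nil_iff] at hω
    subst hω
    exact hat_eq_one (isLDecorated_one hn) (picture_one_equivalent hn)
  · rintro w j hj hr hl ⟨hP, ih⟩
    rw [run_append_singleton]
    refine ⟨hr.isLDecorated_act hn ⟨j, hj⟩, fun ω hω => ?_⟩
    obtain ⟨ω, s, rfl, hω1, hs⟩ := List.map_eq_append_iff.1 hω
    obtain ⟨i, rfl, rfl⟩ : ∃ i, s = [i] ∧ i.val = j := by
      obtain ⟨i, s', rfl, h1, h2⟩ := List.map_eq_cons_iff.1 hs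
      rw [List.map_eq_nil_iff] at h2
      exact ⟨i, by rw [h2], h1⟩
    rw [← hr.hat_mul_simpleHat hn hP i hl, ih ω hω1]
    simp

end ArcData

end

section

/-! ## Linear independence of diagrams -/

/-- A linear map that respects the defining relations of a quotient algebra between any two
factors descends to that algebra. -/
theorem exists_ringQuot_factor {R A M : Type*} [CommSemiring R] [Semiring A] [Algebra R A]
    [AddCommMonoid M] [Module R M] (r : A → A → Prop) (T : A →ₗ[R] M)
    (h : ∀ x y, r x y → ∀ a b, T (a * x * b) = T (a * y * b)) :
    ∃ T' : RingQuot r →ₗ[R] M, ∀ x, T' (RingQuot.mkAlgHom R r x) = T x := by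
  -- Being indistinguishable by `T` in every two-sided context is a ring congruence that contains
  -- `r`. Elements identified in the quotient are therefore congruent, and the trivial context gives
  -- equal values of `T`.
  let c : RingCon A :=
    { r := fun x y => ∀ a b, T (a * x * b) = T (a * y * b)
      iseqv := ⟨fun _ _ _ => rfl, fun h a b => (h a b).symm,
        fun h h' a b => (h a b).trans (h' a b)⟩
      add' := fun {w x y z} h1 h2 a b => by
        rw [mul_add, mul_add, add_mul, add_mul, map_add, map_add, h1, h2]
      mul' := fun {w x y z} h1 h2 a b => by
        have e1 := h1 a (y * b)
        have e2 := h2 (a * x) b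
        simp only [mul_assoc] at e1 e2 ⊢
        rw [e1, e2] }
  have hc : ∀ x y, RingQuot.mkAlgHom R r x = RingQuot.mkAlgHom R r y → T x = T y := by
    intro x y hxy
    have h1 : ∀ z, RingQuot.mkAlgHom R r z = RingQuot.mkRingHom r z := fun z => by
      rw [← RingQuot.mkAlgHom_coe R r]; rfl
    rw [h1, h1] at hxy
    have hr : ∀ ⦃x y⦄, r x y → c.mk' x = c.mk' y := fun x y hr => (c.eq).2 (h x y hr)
    have h2 : c.mk' x = c.mk' y :=
      ((RingQuot.lift_mkRingHom_apply c.mk' hr x).symm.trans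
        (congrArg (RingQuot.lift ⟨c.mk', hr⟩) hxy)).trans (RingQuot.lift_mkRingHom_apply c.mk' hr y)
    have h3 := (c.eq).1 h2 1 1
    simpa using h3
  have hs := RingQuot.mkAlgHom_surjective R r
  have hT : ∀ x, T (Function.surjInv hs (RingQuot.mkAlgHom R r x)) = T x := fun x =>
    hc _ _ (Function.surjInv_eq hs _)
  refine ⟨⟨⟨fun z => T (Function.surjInv hs z), fun y z => ?_⟩, fun c z => ?_⟩, hT⟩
  · obtain ⟨y, rfl⟩ := hs y
    obtain ⟨z, rfl⟩ := hs z
    rw [← map_add, hT, hT, hT, map_add]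
  · obtain ⟨z, rfl⟩ := hs z
    show T (Function.surjInv hs (c • RingQuot.mkAlgHom R r z)) = c • T (Function.surjInv hs _)
    rw [← map_smul, hT, hT, map_smul]

theorem push_option {A C : Type} [Fintype A] [DecidableEq C] (f : Option A → C) (w : Option A → ℕ)
    (c : C) : push f w c =
      (if f none = c then w none else 0) + push (fun a => f (some a)) (fun a => w (some a)) c := by
  classical
  simp only [push, Finset.sum_filter, Fintype.sum_option]
  congr 1
  · split_ifs <;> rfl
  · refine Finset.sum_congr rfl fun a _ => ?_
    split_ifs <;> rfl

namespace Picture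

variable {n : ℕ}

/-- Loops and extra decorations of a factor persist under concatenation on either side. Hence a
defining relation keeps its shape inside any product, and the value need only be compared for single
pictures. -/
theorem addLoop_comp (P Q : Picture n) (m : ℕ) :
    Equivalent ((P.addLoop m).comp Q) ((P.comp Q).addLoop m) := by
  classical
  let f : Quot (Glue (P.addLoop m) Q) → Option (Quot (Glue P Q)) :=
    Quot.lift (Sum.elim (fun e : Option P.E => e.map fun e => Quot.mk _ (Sum.inl e))
      (fun e => some (Quot.mk _ (Sum.inr e)))) (by
        rintro _ _ ⟨i⟩; exact congrArg some (Quot.sound (Glue.glue (P := P) (Q := Q) i)))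
  let g : Option (Quot (Glue P Q)) → Quot (Glue (P.addLoop m) Q) := fun c =>
    c.elim (Quot.mk _ (Sum.inl none)) (Quot.lift (Sum.elim
      (fun e => Quot.mk _ (Sum.inl (some e))) (fun e => Quot.mk _ (Sum.inr e))) (by
        rintro _ _ ⟨i⟩; exact Quot.sound (Glue.glue (P := P.addLoop m) (Q := Q) i)))
  have e1 : Function.LeftInverse g f := by rintro ⟨(_ | e) | e⟩ <;> rfl
  have e2 : Function.RightInverse g f := by rintro (_ | ⟨⟨e | e⟩⟩) <;> rfl
  refine ⟨⟨f, g, e1, e2⟩, ?_, fun c => ?_⟩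
  · rintro (i | i) <;> rfl
  · have h1 := push_inj f e1.injective (fun e => Quot.mk (Glue (P.addLoop m) Q) (Sum.inl e))
      (P.addLoop m).dec c
    have h2 := push_inj f e1.injective (fun e => Quot.mk (Glue (P.addLoop m) Q) (Sum.inr e))
      Q.dec c
    refine Eq.trans ?_ (congrArg₂ (· + ·) h1 h2)
    show ((P.comp Q).addLoop m).dec (f c) = _
    generalize f c = d
    have h3 := push_option (fun a : Option P.E => f (Quot.mk (Glue (P.addLoop m) Q) (Sum.inl a)))
      (P.addLoop m).dec d
    refine Eq.trans ?_ (congrArg₂ (· + ·) h3.symm rfl)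
    rcases d with _ | d
    · show m = (if none = none then m else 0) +
        push (fun a => some (Quot.mk _ (Sum.inl a))) P.dec none
        + push (fun a => some (Quot.mk _ (Sum.inr a))) Q.dec none
      simp [push]
    · show _ = (if none = some d then m else 0) +
        push (fun a => some (Quot.mk _ (Sum.inl a))) P.dec (some d)
        + push (fun a => some (Quot.mk _ (Sum.inr a))) Q.dec (some d)
      rw [if_neg (by simp), zero_add, push_inj _ (Option.some_injective _),
        push_inj _ (Option.some_injective _)]
      rfl

theorem comp_addLoop (P Q : Picture n) (m : ℕ) :
    Equivalent (P.comp (Q.addLoop m)) ((P.comp Q).addLoop m) := by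
  classical
  let f : Quot (Glue P (Q.addLoop m)) → Option (Quot (Glue P Q)) :=
    Quot.lift (Sum.elim (fun e => some (Quot.mk _ (Sum.inl e)))
      (fun e : Option Q.E => e.map fun e => Quot.mk _ (Sum.inr e))) (by
        rintro _ _ ⟨i⟩; exact congrArg some (Quot.sound (Glue.glue (P := P) (Q := Q) i)))
  let g : Option (Quot (Glue P Q)) → Quot (Glue P (Q.addLoop m)) := fun c =>
    c.elim (Quot.mk _ (Sum.inr none)) (Quot.lift (Sum.elim
      (fun e => Quot.mk _ (Sum.inl e)) (fun e => Quot.mk _ (Sum.inr (some e)))) (by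
        rintro _ _ ⟨i⟩; exact Quot.sound (Glue.glue (P := P) (Q := Q.addLoop m) i)))
  have e1 : Function.LeftInverse g f := by rintro ⟨e | (_ | e)⟩ <;> rfl
  have e2 : Function.RightInverse g f := by rintro (_ | ⟨⟨e | e⟩⟩) <;> rfl
  refine ⟨⟨f, g, e1, e2⟩, ?_, fun c => ?_⟩
  · rintro (i | i) <;> rfl
  · have h1 := push_inj f e1.injective (fun e => Quot.mk (Glue P (Q.addLoop m)) (Sum.inl e)) P.dec c
    have h2 := push_inj f e1.injective (fun e => Quot.mk (Glue P (Q.addLoop m)) (Sum.inr e))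
      (Q.addLoop m).dec c
    refine Eq.trans ?_ (congrArg₂ (· + ·) h1 h2)
    show ((P.comp Q).addLoop m).dec (f c) = _
    generalize f c = d
    have h3 := push_option (fun a : Option Q.E => f (Quot.mk (Glue P (Q.addLoop m)) (Sum.inr a)))
      (Q.addLoop m).dec d
    refine Eq.trans ?_ (congrArg₂ (· + ·) rfl h3.symm)
    rcases d with _ | d
    · show m = push (fun a => some (Quot.mk _ (Sum.inl a))) P.dec none +
        ((if none = none then m else 0) + push (fun a => some (Quot.mk _ (Sum.inr a))) Q.dec none)
      simp [push]
    · show _ = push (fun a => some (Quot.mk _ (Sum.inl a))) P.dec (some d) +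
        ((if none = some d then m else 0) +
        push (fun a => some (Quot.mk _ (Sum.inr a))) Q.dec (some d))
      rw [if_neg (by simp), zero_add, push_inj _ (Option.some_injective _),
        push_inj _ (Option.some_injective _)]
      rfl

theorem decorate_dec (P : Picture n) (e x : P.E) (m : ℕ) :
    open Classical in (P.decorate e m).dec x = P.dec x + if x = e then m else 0 := by
  classical
  show Function.update P.dec e (P.dec e + m) x = _
  by_cases h : x = e
  · subst h; simp
  · simp [h]

theorem decorate_comp (P Q : Picture n) (e : P.E) (m : ℕ) :
    Equivalent ((P.decorate e m).comp Q) ((P.comp Q).decorate (Quot.mk _ (Sum.inl e)) m) := by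
  classical
  let f : Quot (Glue (P.decorate e m) Q) → Quot (Glue P Q) :=
    Quot.lift (fun a => Quot.mk _ a) (by
      rintro _ _ ⟨i⟩; exact Quot.sound (Glue.glue (P := P) (Q := Q) i))
  let g : Quot (Glue P Q) → Quot (Glue (P.decorate e m) Q) :=
    Quot.lift (fun a => Quot.mk _ a) (by
      rintro _ _ ⟨i⟩; exact Quot.sound (Glue.glue (P := P.decorate e m) (Q := Q) i))
  have e1 : Function.LeftInverse g f := by rintro ⟨e⟩; rfl
  have e2 : Function.RightInverse g f := by rintro ⟨e⟩; rfl
  refine ⟨⟨f, g, e1, e2⟩, ?_, fun c => ?_⟩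
  · rintro (i | i) <;> rfl
  · have h1 := push_inj f e1.injective (fun e' => Quot.mk (Glue (P.decorate e m) Q) (Sum.inl e'))
      (P.decorate e m).dec c
    have h2 := push_inj f e1.injective (fun e' => Quot.mk (Glue (P.decorate e m) Q) (Sum.inr e'))
      Q.dec c
    refine Eq.trans ?_ (congrArg₂ (· + ·) h1 h2)
    refine (decorate_dec (P.comp Q) (Quot.mk _ (Sum.inl e)) (f c) m).trans ?_
    generalize f c = d
    rw [show (P.decorate e m).dec = fun x : P.E => P.dec x + if x = e then m else 0 from
      funext fun x => decorate_dec P e x m]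
    show push (fun e => Quot.mk (Glue P Q) (Sum.inl e)) P.dec d +
      push (fun e => Quot.mk (Glue P Q) (Sum.inr e)) Q.dec d +
        (if d = Quot.mk _ (Sum.inl e) then m else 0) =
      push (fun e => Quot.mk (Glue P Q) (Sum.inl e)) (fun x => P.dec x + if x = e then m else 0) d +
      push (fun e => Quot.mk (Glue P Q) (Sum.inr e)) Q.dec d
    rw [push_add, ArcData.push_single]
    simp only [eq_comm (a := d)]
    omega

theorem comp_decorate (P Q : Picture n) (e : Q.E) (m : ℕ) :
    Equivalent (P.comp (Q.decorate e m)) ((P.comp Q).decorate (Quot.mk _ (Sum.inr e)) m) := by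
  classical
  let f : Quot (Glue P (Q.decorate e m)) → Quot (Glue P Q) :=
    Quot.lift (fun a => Quot.mk _ a) (by
      rintro _ _ ⟨i⟩; exact Quot.sound (Glue.glue (P := P) (Q := Q) i))
  let g : Quot (Glue P Q) → Quot (Glue P (Q.decorate e m)) :=
    Quot.lift (fun a => Quot.mk _ a) (by
      rintro _ _ ⟨i⟩; exact Quot.sound (Glue.glue (P := P) (Q := Q.decorate e m) i))
  have e1 : Function.LeftInverse g f := by rintro ⟨e⟩; rfl
  have e2 : Function.RightInverse g f := by rintro ⟨e⟩; rfl
  refine ⟨⟨f, g, e1, e2⟩, ?_, fun c => ?_⟩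
  · rintro (i | i) <;> rfl
  · have h1 := push_inj f e1.injective (fun e' => Quot.mk (Glue P (Q.decorate e m)) (Sum.inl e'))
      P.dec c
    have h2 := push_inj f e1.injective (fun e' => Quot.mk (Glue P (Q.decorate e m)) (Sum.inr e'))
      (Q.decorate e m).dec c
    refine Eq.trans ?_ (congrArg₂ (· + ·) h1 h2)
    refine (decorate_dec (P.comp Q) (Quot.mk _ (Sum.inr e)) (f c) m).trans ?_
    generalize f c = d
    rw [show (Q.decorate e m).dec = fun x : Q.E => Q.dec x + if x = e then m else 0 from
      funext fun x => decorate_dec Q e x m]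
    show push (fun e => Quot.mk (Glue P Q) (Sum.inl e)) P.dec d +
      push (fun e => Quot.mk (Glue P Q) (Sum.inr e)) Q.dec d +
        (if d = Quot.mk _ (Sum.inr e) then m else 0) =
      push (fun e => Quot.mk (Glue P Q) (Sum.inl e)) P.dec d +
      push (fun e => Quot.mk (Glue P Q) (Sum.inr e)) (fun x => Q.dec x + if x = e then m else 0) d
    rw [push_add, ArcData.push_single]
    simp only [eq_comm (a := d)]
    omega

/-- The arcs of a picture and the parities of their decorations. -/
def key (P : Picture n) : (Node n → Node n → Prop) × (Node n → Prop) :=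
  (fun x y => P.edgeAt x = P.edgeAt y, fun x => Odd (P.dec (P.edgeAt x)))

open Classical in
/-- The factor for the loops of a picture. -/
def weight (P : Picture n) : ℤ[X] :=
  ∏ e, if P.IsLoop e then (if Even (P.dec e) then X else 0) else 1

/-- The value of a picture: its arcs and the parities of their decorations, multiplied by `δ` for
each evenly decorated loop and by `0` for each oddly decorated loop. -/
def value (P : Picture n) : ((Node n → Node n → Prop) × (Node n → Prop)) →₀ ℤ[X] :=
  Finsupp.single P.key P.weight

theorem Equivalent.value_eq {P Q : Picture n} (h : Equivalent P Q) : P.value = Q.value := by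
  classical
  obtain ⟨σ, h1, h2⟩ := h
  have hk : P.key = Q.key := by
    unfold key
    congr 1
    · funext x y
      rw [← h1, ← h1, σ.injective.eq_iff]
    · funext x
      rw [← h1, h2]
  have hw : P.weight = Q.weight := by
    unfold weight
    refine Fintype.prod_equiv σ _ _ fun e => ?_
    have : Q.IsLoop (σ e) ↔ P.IsLoop e := by
      unfold IsLoop
      refine forall_congr' fun x => ?_
      rw [← h1, σ.injective.ne_iff]
    simp only [this, h2]
  rw [value, value, hk, hw]

theorem value_addLoop (P : Picture n) (m : ℕ) :
    (P.addLoop m).value = (if Even m then (X : ℤ[X]) else 0) • P.value := by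
  classical
  have hk : (P.addLoop m).key = P.key := by
    unfold key
    congr 1
    funext x y
    exact propext (Option.some_injective _).eq_iff
  have hw : (P.addLoop m).weight = (if Even m then (X : ℤ[X]) else 0) * P.weight := by
    refine (Fintype.prod_option (α := P.E) _).trans ?_
    congr 1
    · rw [if_pos (show (P.addLoop m).IsLoop (none : Option P.E) from
        fun x h => Option.some_ne_none _ h)]
      rfl
    · refine Finset.prod_congr rfl fun e _ => ?_
      have : (P.addLoop m).IsLoop (some e) ↔ P.IsLoop e :=
        forall_congr' fun x => (Option.some_injective _).ne_iff
      simp only [this]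
      rfl
  rw [value, value, hk, hw, Finsupp.smul_single, smul_eq_mul]

theorem value_decorate_two (P : Picture n) (e : P.E) : (P.decorate e 2).value = P.value := by
  classical
  have hp : ∀ x : P.E, Even ((P.decorate e 2).dec x) ↔ Even (P.dec x) := by
    intro x
    rw [decorate_dec P e x 2]
    by_cases h : x = e
    · simp [h, Nat.even_add]
    · simp [h]
  have hk : (P.decorate e 2).key = P.key := by
    unfold key
    congr 1
    funext x
    rw [← Nat.not_even_iff_odd, ← Nat.not_even_iff_odd]
    exact propext (not_congr (hp _))
  have hw : (P.decorate e 2).weight = P.weight := by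
    unfold weight
    refine Finset.prod_congr rfl fun x _ => ?_
    have : (P.decorate e 2).IsLoop x ↔ P.IsLoop x := Iff.rfl
    have hx := hp x
    simp only [this, hx]
  rw [value, value, hk, hw]

end Picture

variable {n : ℕ}

/-- The value of a diagram. -/
def Diagram.value : Diagram n → ((Node n → Node n → Prop) × (Node n → Prop)) →₀ ℤ[X] :=
  Quotient.lift Picture.value fun _ _ h => Picture.Equivalent.value_eq h

/-- The linear extension of the value of diagrams. -/
def valueMap (n : ℕ) : MonoidAlgebra ℤ[X] (Diagram n) →ₗ[ℤ[X]]
    ((Node n → Node n → Prop) × (Node n → Prop)) →₀ ℤ[X] :=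
  (Finsupp.linearCombination ℤ[X] Diagram.value).comp
    (MonoidAlgebra.coeffLinearEquiv ℤ[X]).toLinearMap

theorem valueMap_of (D : Diagram n) :
    valueMap n (MonoidAlgebra.of ℤ[X] (Diagram n) D) = D.value := by
  show Finsupp.linearCombination ℤ[X] Diagram.value (Finsupp.single D 1) = _
  rw [Finsupp.linearCombination_single, one_smul]

theorem valueMap_mul_mul {x y : MonoidAlgebra ℤ[X] (Diagram n)}
    (h : ∀ D D', valueMap n (MonoidAlgebra.of _ _ D * x * MonoidAlgebra.of _ _ D') =
      valueMap n (MonoidAlgebra.of _ _ D * y * MonoidAlgebra.of _ _ D'))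
    (a b : MonoidAlgebra ℤ[X] (Diagram n)) : valueMap n (a * x * b) = valueMap n (a * y * b) := by
  induction a using MonoidAlgebra.induction_on with
  | of D =>
    induction b using MonoidAlgebra.induction_on with
    | of D' => exact h D D'
    | add a b ha hb => rw [mul_add, mul_add, map_add, map_add, ha, hb]
    | smul c b hb => rw [mul_smul_comm, mul_smul_comm, map_smul, map_smul, hb]
  | add a b ha hb => rw [add_mul, add_mul, add_mul, add_mul, map_add, map_add, ha, hb]
  | smul c a ha =>
    rw [smul_mul_assoc, smul_mul_assoc, smul_mul_assoc, smul_mul_assoc, map_smul, map_smul, ha]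

theorem Diagram.value_mul_addLoop_mul (D D' : Diagram n) (P : Picture n) (m : ℕ) :
    (D * Diagram.mk (P.addLoop m) * D').value =
      (if Even m then (X : ℤ[X]) else 0) • (D * Diagram.mk P * D').value := by
  obtain ⟨A, rfl⟩ := Quotient.exists_rep D
  obtain ⟨B, rfl⟩ := Quotient.exists_rep D'
  show ((A.comp (P.addLoop m)).comp B).value = _ • ((A.comp P).comp B).value
  rw [(Picture.comp_congr (Picture.comp_addLoop A P m) ((Picture.setoid n).refl B)).value_eq,
    (Picture.addLoop_comp _ _ _).value_eq, Picture.value_addLoop]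

theorem Diagram.value_mul_decorate_mul (D D' : Diagram n) (P : Picture n) (e : P.E) :
    (D * Diagram.mk (P.decorate e 2) * D').value = (D * Diagram.mk P * D').value := by
  obtain ⟨A, rfl⟩ := Quotient.exists_rep D
  obtain ⟨B, rfl⟩ := Quotient.exists_rep D'
  show ((A.comp (P.decorate e 2)).comp B).value = ((A.comp P).comp B).value
  exact (Picture.comp_congr (Picture.comp_decorate A P e 2) ((Picture.setoid n).refl B)).value_eq.trans
    ((Picture.decorate_comp (A.comp P) B _ _).value_eq.trans (Picture.value_decorate_two _ _))

theorem HatRel.valueMap_eq {x y : PL n} (h : HatRel n x y) (D D' : Diagram n) :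
    valueMap n (MonoidAlgebra.of _ _ D * x.1 * MonoidAlgebra.of _ _ D') =
      valueMap n (MonoidAlgebra.of _ _ D * y.1 * MonoidAlgebra.of _ _ D') := by
  have key : ∀ E : LDiagram n, valueMap n
      (MonoidAlgebra.of _ _ D * (PL.of E).1 * MonoidAlgebra.of _ _ D') = (D * E.1 * D').value := by
    intro E
    rw [← valueMap_of, map_mul (MonoidAlgebra.of _ _), map_mul (MonoidAlgebra.of _ _)]
    rfl
  cases h with
  | loop P h h' =>
    have h1 : ((X : ℤ[X]) • PL.of (.mk _ h') : PL n).1 = (X : ℤ[X]) • (PL.of (.mk _ h')).1 := rfl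
    rw [h1, mul_smul_comm, smul_mul_assoc, map_smul, key, key]
    exact Diagram.value_mul_addLoop_mul D D' P 0
  | cancel P e h h' =>
    rw [key, key]
    exact Diagram.value_mul_decorate_mul D D' P e
  -- Both sides contain a loop with one decoration, so both values vanish.
  | absorb P e h h' =>
    rw [key, key]
    refine (Diagram.value_mul_addLoop_mul D D' (P.decorate e 1) 1).trans
      (Eq.trans ?_ (Diagram.value_mul_addLoop_mul D D' P 1).symm)
    simp

theorem exists_value_hat (n : ℕ) : ∃ T : PHat n →ₗ[ℤ[X]]
    ((Node n → Node n → Prop) × (Node n → Prop)) →₀ ℤ[X],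
    ∀ x : PL n, T (RingQuot.mkAlgHom ℤ[X] (HatRel n) x) = valueMap n x.1 := by
  refine exists_ringQuot_factor (HatRel n) ((valueMap n).comp (PL n).val.toLinearMap) ?_
  intro x y h a b
  exact valueMap_mul_mul h.valueMap_eq a.1 b.1

theorem valueMap_mul_addLoop_mul (a b : MonoidAlgebra ℤ[X] (Diagram n)) (P : Picture n) :
    valueMap n (a * MonoidAlgebra.of _ _ (Diagram.mk (P.addLoop 1)) * b) = 0 := by
  rw [valueMap_mul_mul (y := 0)]
  · simp
  · intro D D'
    rw [← map_mul, ← map_mul, valueMap_of]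
    refine (Diagram.value_mul_addLoop_mul D D' P 1).trans ?_
    simp

/-- The value of diagrams is defined on the loop-free diagram algebra. -/
theorem exists_value (hn : 4 ≤ n) : ∃ T : LFD hn →ₗ[ℤ[X]]
    ((Node n → Node n → Prop) × (Node n → Prop)) →₀ ℤ[X],
    ∀ (P : Picture n) (h : P.IsLDecorated) (hD : hat P ∈ DTL hn),
      T (RingQuot.mkAlgHom ℤ[X] (LoopRel hn) ⟨hat P, hD⟩) = P.value := by
  obtain ⟨T₁, hT₁⟩ := exists_value_hat n
  have key : ∀ (P : Picture n) (h : (P.addLoop 1).IsLDecorated) (a b : PHat n),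
      T₁ (a * PHat.of (.mk _ h) * b) = 0 := by
    intro P h a b
    obtain ⟨a, rfl⟩ := RingQuot.mkAlgHom_surjective ℤ[X] (HatRel n) a
    obtain ⟨b, rfl⟩ := RingQuot.mkAlgHom_surjective ℤ[X] (HatRel n) b
    rw [PHat.of, ← map_mul, ← map_mul, hT₁]
    exact valueMap_mul_addLoop_mul a.1 b.1 P
  have hT : ∃ T : LFD hn →ₗ[ℤ[X]] ((Node n → Node n → Prop) × (Node n → Prop)) →₀ ℤ[X],
      ∀ x : DTL hn, T (RingQuot.mkAlgHom ℤ[X] (LoopRel hn) x) = T₁ x.1 := by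
    refine exists_ringQuot_factor (LoopRel hn) (T₁.comp (DTL hn).val.toLinearMap) ?_
    rintro _ _ ⟨P, h, hD⟩ a b
    rw [mul_zero, zero_mul, map_zero]
    exact key P h a.1 b.1
  obtain ⟨T₂, hT₂⟩ := hT
  refine ⟨T₂, fun P h hD => ?_⟩
  rw [hT₂]
  show T₁ (hat P) = _
  rw [hat_eq h, PHat.of, hT₁]
  exact valueMap_of _

namespace ArcData

theorem value_picture (r : ArcData) :
    (picture n r).value = Finsupp.single (picture n r).key 1 := by
  rw [Picture.value, Picture.weight, Finset.prod_eq_one]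
  intro e _
  refine if_neg fun h => ?_
  obtain ⟨x, hx⟩ := picture_edgeAt_surjective e
  exact h x hx

theorem Valid.eq_of_key_eq {r r' : ArcData} (hr : r.Valid n) (hr' : r'.Valid n) (hn : 4 ≤ n)
    (h : (picture n r).key = (picture n r').key) : r = r' := by
  have h1 : ∀ x y, (picture n r).edgeAt x = (picture n r).edgeAt y ↔
      (picture n r').edgeAt x = (picture n r').edgeAt y := fun x y =>
    iff_of_eq (congrFun (congrFun (congrArg Prod.fst h) x) y)
  have h2 : ∀ x, Odd ((picture n r).dec ((picture n r).edgeAt x)) ↔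
      Odd ((picture n r').dec ((picture n r').edgeAt x)) := fun x =>
    iff_of_eq (congrFun (congrArg Prod.snd h) x)
  ext x
  · rcases lt_or_ge x (2 * n) with hx | hx
    · have hb := hr.bound x
      have h3 := (h1 (nodeAt hn x) (nodeAt hn (r.p x))).1
        ((hr.edgeAt_eq_iff _ _).2 (Or.inr (by rw [pos_nodeAt hn hx, pos_nodeAt hn (by omega)])))
      rw [hr'.edgeAt_eq_iff, pos_nodeAt hn hx, pos_nodeAt hn (by omega)] at h3
      omega
    · rw [hr.out_p x hx, hr'.out_p x hx]
  · rcases lt_or_ge x (2 * n) with hx | hx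
    · have h3 := h2 (nodeAt hn x)
      rw [hr.dec_edgeAt, hr'.dec_edgeAt, pos_nodeAt hn hx] at h3
      cases hq : r.q x <;> cases hq' : r'.q x <;> simp [hq, hq'] at h3 ⊢
    · rw [hr.out_q x hx, hr'.out_q x hx]

end ArcData

end

section

variable {n : ℕ}

/-! ## The homomorphism onto the loop-free diagram algebra -/

namespace PFTL

theorem b_sq (i : Fin n) : b i * b i = (X : ℤ[X]) • b i := by
  rw [b, ← map_mul, ← map_smul, TL.b, ← map_mul, ← map_smul, RingQuot.mkAlgHom_rel _ (TLRel.sq i)]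

theorem b_comm (i j : Fin n) (h : ¬ Joined i j) : b i * b j = b j * b i := by
  rw [b, b, ← map_mul, ← map_mul, TL.b, TL.b, ← map_mul, ← map_mul,
    RingQuot.mkAlgHom_rel _ (TLRel.comm i j h)]

theorem b_braid (i j : Fin n) (h : Joined i j) : b i * b j * b i = b i := by
  rw [b, b, ← map_mul, ← map_mul, TL.b, TL.b, ← map_mul, ← map_mul,
    RingQuot.mkAlgHom_rel _ (TLRel.braid i j h)]

theorem b_pair (i j : Fin n) (hi : i.val = 1) (hj : j.val = 0) : b i * b j = 0 := by
  rw [b, b, ← map_mul, RingQuot.mkAlgHom_rel _ (PairRel.pair i j hi hj), map_zero]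

theorem b_pair_symm (i j : Fin n) (hi : i.val = 0) (hj : j.val = 1) : b i * b j = 0 := by
  rw [b_comm i j (by unfold Joined; omega), b_pair j i hj hi]

end PFTL

namespace LFD

variable (hn : 4 ≤ n)

theorem d_sq (i : Fin n) : d hn i * d hn i = (X : ℤ[X]) • d hn i := by
  rw [d, ← map_mul, ← map_smul]
  exact congrArg _ (Subtype.ext (ArcData.simpleHat_sq hn i))

theorem d_braid (i j : Fin n) (h : Joined i j) : d hn i * d hn j * d hn i = d hn i := by
  rw [d, d, ← map_mul, ← map_mul]
  exact congrArg _ (Subtype.ext (ArcData.simpleHat_braid hn i j h))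

theorem d_pair (i j : Fin n) (h : ArcData.lo n i = ArcData.lo n j) (hij : i.val = 0 ↔ j.val ≠ 0) :
    d hn i * d hn j = 0 := by
  obtain ⟨P, hP, he⟩ := ArcData.simpleHat_mul_eq_addLoop hn i j h hij
  rw [hat_eq hP] at he
  have hD : PHat.of (.mk _ hP) ∈ DTL hn := by
    rw [← he]
    exact mul_mem (Algebra.subset_adjoin ⟨i, rfl⟩) (Algebra.subset_adjoin ⟨j, rfl⟩)
  rw [d, d, ← map_mul, ← map_zero (RingQuot.mkAlgHom ℤ[X] (LoopRel hn)),
    ← RingQuot.mkAlgHom_rel _ (LoopRel.decorated P hP hD)]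
  exact congrArg _ (Subtype.ext he)

/-- Distinct generators that are not joined either act at disjoint places, or are `d_1` and `d_{\bar
1}`. In the latter case both products contain a decorated loop and vanish. -/
theorem d_comm (i j : Fin n) (h : ¬ Joined i j) : d hn i * d hn j = d hn j * d hn i := by
  by_cases hij : i = j
  · rw [hij]
  have key : ∀ i j : Fin n, ArcData.lo n i + 2 ≤ ArcData.lo n j →
      d hn i * d hn j = d hn j * d hn i := by
    intro i j h
    rw [d, d, ← map_mul, ← map_mul]
    exact congrArg _ (Subtype.ext (ArcData.simpleHat_comm_of_lo hn i j h))
  have hc : ArcData.lo n i + 2 ≤ ArcData.lo n j ∨ ArcData.lo n j + 2 ≤ ArcData.lo n i ∨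
      (ArcData.lo n i = ArcData.lo n j ∧ (i.val = 0 ↔ j.val ≠ 0)) := by
    have := Fin.val_ne_of_ne hij
    have := i.isLt
    have := j.isLt
    unfold Joined at h
    unfold ArcData.lo
    omega
  rcases hc with h | h | ⟨h, h'⟩
  · exact key i j h
  · exact (key j i h).symm
  · rw [d_pair hn i j h h', d_pair hn j i h.symm (by omega)]

end LFD

/-- The homomorphism from the pair-free Temperley-Lieb algebra to the loop-free diagram algebra. -/
theorem exists_diagramHom (hn : 4 ≤ n) :
    ∃ φ : PFTL n →ₐ[ℤ[X]] LFD hn, ∀ i, φ (PFTL.b i) = LFD.d hn i := by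
  have h1 : ∀ ⦃x y⦄, TLRel n x y → FreeAlgebra.lift ℤ[X] (LFD.d hn) x =
      FreeAlgebra.lift ℤ[X] (LFD.d hn) y := by
    rintro _ _ (i | ⟨i, j, h⟩ | ⟨i, j, h⟩)
    · simp only [map_mul, map_smul, FreeAlgebra.lift_ι_apply, LFD.d_sq]
    · simp only [map_mul, FreeAlgebra.lift_ι_apply, LFD.d_comm hn i j h]
    · simp only [map_mul, FreeAlgebra.lift_ι_apply, LFD.d_braid hn i j h]
  let ψ : TL n →ₐ[ℤ[X]] LFD hn := RingQuot.liftAlgHom ℤ[X] ⟨FreeAlgebra.lift ℤ[X] (LFD.d hn), h1⟩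
  have hψ : ∀ i, ψ (TL.b i) = LFD.d hn i := fun i => by
    rw [TL.b, RingQuot.liftAlgHom_mkAlgHom_apply, FreeAlgebra.lift_ι_apply]
  have h2 : ∀ ⦃x y⦄, PairRel n x y → ψ x = ψ y := by
    rintro _ _ ⟨i, j, hi, hj⟩
    rw [map_mul, hψ, hψ, map_zero]
    exact LFD.d_pair hn i j (by unfold ArcData.lo; omega) (by omega)
  refine ⟨RingQuot.liftAlgHom ℤ[X] ⟨ψ, h2⟩, fun i => ?_⟩
  rw [PFTL.b, RingQuot.liftAlgHom_mkAlgHom_apply, hψ]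

theorem diagramHom_surjective (hn : 4 ≤ n) (φ : PFTL n →ₐ[ℤ[X]] LFD hn)
    (hφ : ∀ i, φ (PFTL.b i) = LFD.d hn i) : Function.Surjective φ := by
  intro z
  obtain ⟨⟨x, hx⟩, rfl⟩ := RingQuot.mkAlgHom_surjective ℤ[X] (LoopRel hn) z
  suffices h : RingQuot.mkAlgHom ℤ[X] (LoopRel hn) ⟨x, hx⟩ ∈ φ.range from h
  induction hx using Algebra.adjoin_induction with
  | mem x hx =>
    obtain ⟨i, rfl⟩ := hx
    exact ⟨PFTL.b i, hφ i⟩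
  | algebraMap c =>
    have : (⟨algebraMap ℤ[X] (PHat n) c, algebraMap_mem _ c⟩ : DTL hn) =
      algebraMap ℤ[X] (DTL hn) c := rfl
    exact ⟨algebraMap _ _ c, by rw [AlgHom.toRingHom_eq_coe, RingHom.coe_coe, AlgHom.commutes, this,
      AlgHom.commutes]⟩
  | add x y hx hy ihx ihy =>
    have := add_mem ihx ihy
    rwa [← map_add] at this
  | mul x y hx hy ihx ihy =>
    have := mul_mem ihx ihy
    rwa [← map_mul] at this

/-! ## The monomial basis -/

/-- The generator with the given number, and `0` if there is none. -/
def gen (n k : ℕ) : PFTL n := if h : k < n then PFTL.b ⟨k, h⟩ else 0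

/-- The monomial of a word. -/
def mon (n : ℕ) (ω : List ℕ) : PFTL n := (ω.map (gen n)).prod

theorem gen_val (i : Fin n) : gen n i = PFTL.b i := dif_pos i.isLt

theorem mon_map_val (ω : List (Fin n)) : mon n (ω.map Fin.val) = (ω.map PFTL.b).prod := by
  rw [mon, List.map_map]
  congr 2
  funext i
  exact gen_val i

theorem mon_append (ω ω' : List ℕ) : mon n (ω ++ ω') = mon n ω * mon n ω' := by
  simp [mon]

theorem mon_commEq {ω ω' : List ℕ} (h : CommEq ω ω') : mon n ω = mon n ω' := by
  induction h with
  | refl => rfl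
  | tail _ h ih =>
    obtain ⟨l, r, s, t, -, hst, rfl, rfl⟩ := h
    have : gen n s * gen n t = gen n t * gen n s := by
      unfold gen
      split_ifs with hs ht
      · exact PFTL.b_comm _ _ hst
      all_goals simp
    rw [ih, mon_append, mon_append, mon_append, mon_append]
    simp only [mon, List.map_cons, List.map_nil, List.prod_cons, List.prod_nil, mul_one, this]

/-- Every monomial is zero or a power of `δ` times the monomial of a normal word, which is shorter
or commutation equivalent. -/
theorem mon_eq (hn : 4 ≤ n) (ω : List ℕ) (hω : ∀ s ∈ ω, s < n) : mon n ω = 0 ∨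
    ∃ k L, Normal n L ∧ mon n ω = (X : ℤ[X]) ^ k • mon n (rowsWord L) ∧
      ((rowsWord L).length < ω.length ∨ (k = 0 ∧ CommEq ω (rowsWord L))) := by
  induction hm : ω.length using Nat.strong_induction_on generalizing ω with
  | _ m ih =>
    subst hm
    rcases reducible_or_normal (by omega) ω hω with ⟨l, x, r, hx, hc⟩ | ⟨L, hL, hc⟩
    · have hlen := hc.perm.length_eq
      have hmem : ∀ s, s ∈ l ++ x ++ r → s < n := fun s hs => hω s (hc.perm.mem_iff.2 hs)
      -- This treats the factors `ss` and `sts`, whose monomials are δ or 1 times a single letter;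
      -- the factors `01` and `10` give zero.
      have step : ∀ (s k : ℕ), s ∈ x → 1 < x.length → mon n x = (X : ℤ[X]) ^ k • mon n [s] →
          mon n ω = 0 ∨ ∃ k L, Normal n L ∧ mon n ω = (X : ℤ[X]) ^ k • mon n (rowsWord L) ∧
            ((rowsWord L).length < ω.length ∨ (k = 0 ∧ CommEq ω (rowsWord L))) := by
        intro s k hs hxl hxs
        have hlt : (l ++ [s] ++ r).length < ω.length := by
          rw [hlen]; simp only [List.length_append, List.length_singleton]; omega
        have he : mon n ω = (X : ℤ[X]) ^ k • mon n (l ++ [s] ++ r) := by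
          rw [mon_commEq hc, mon_append, mon_append, mon_append, mon_append, hxs, mul_smul_comm,
            smul_mul_assoc]
        have hmem' : ∀ t ∈ l ++ [s] ++ r, t < n := by
          intro t ht
          apply hmem
          simp only [List.mem_append, List.mem_singleton] at ht ⊢
          rcases ht with (h | rfl) | h
          · exact Or.inl (Or.inl h)
          · exact Or.inl (Or.inr hs)
          · exact Or.inr h
        rcases ih _ hlt _ hmem' rfl with h0 | ⟨k', L, hL, h1, h2⟩
        · left; rw [he, h0, smul_zero]
        · refine Or.inr ⟨k + k', L, hL, by rw [he, h1, smul_smul, pow_add], Or.inl ?_⟩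
          rcases h2 with h2 | ⟨-, h2⟩
          · omega
          · rw [← h2.perm.length_eq]; exact hlt
      have zero : mon n x = 0 → mon n ω = 0 := fun h => by
        rw [mon_commEq hc, mon_append, mon_append, h, mul_zero, zero_mul]
      rcases hx with ⟨s, rfl⟩ | ⟨s, t, hst, rfl⟩ | rfl | rfl
      · refine step s 1 (by simp) (by simp) ?_
        have hs : s < n := hmem s (by simp)
        simp only [mon, List.map_cons, List.map_nil, List.prod_cons, List.prod_nil, mul_one, gen,
          dif_pos hs, PFTL.b_sq, pow_one]
      · refine step s 0 (by simp) (by simp) ?_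
        have hs : s < n := hmem s (by simp)
        have ht : t < n := hmem t (by simp)
        have := PFTL.b_braid (⟨s, hs⟩ : Fin n) ⟨t, ht⟩ hst
        simp only [mon, List.map_cons, List.map_nil, List.prod_cons, List.prod_nil, mul_one, gen,
          dif_pos hs, dif_pos ht, pow_zero, one_smul]
        rw [← mul_assoc, this]
      · refine Or.inl (zero ?_)
        have h0 : 0 < n := by omega
        have h1 : 1 < n := by omega
        simp only [mon, List.map_cons, List.map_nil, List.prod_cons, List.prod_nil, mul_one, gen,
          dif_pos h0, dif_pos h1]
        exact PFTL.b_pair_symm _ _ rfl rfl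
      · refine Or.inl (zero ?_)
        have h0 : 0 < n := by omega
        have h1 : 1 < n := by omega
        simp only [mon, List.map_cons, List.map_nil, List.prod_cons, List.prod_nil, mul_one, gen,
          dif_pos h0, dif_pos h1]
        exact PFTL.b_pair _ _ rfl rfl
    · exact Or.inr ⟨0, L, hL, by rw [pow_zero, one_smul, mon_commEq hc], Or.inr ⟨rfl, hc⟩⟩

/-- Normal lists of rows. -/
abbrev NormalList (n : ℕ) : Type := {L : List (ℕ × ℕ) // Normal n L}

/-- The word of a normal list of rows. -/
def NormalList.word (L : NormalList n) : List (Fin n) :=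
  (rowsWord L.1).attach.map fun s => ⟨s.1, L.2.lt_of_mem s.2⟩

theorem NormalList.map_val_word (L : NormalList n) : L.word.map Fin.val = rowsWord L.1 := by
  rw [word, List.map_map]
  exact List.attach_map_subtype_val _

theorem NormalList.prod_word (L : NormalList n) :
    (L.word.map PFTL.b).prod = mon n (rowsWord L.1) := by
  rw [← mon_map_val, L.map_val_word]

theorem map_mon_word (hn : 4 ≤ n) (φ : PFTL n →ₐ[ℤ[X]] LFD hn)
    (hφ : ∀ i, φ (PFTL.b i) = LFD.d hn i) (L : NormalList n) :
    ∃ hD : hat (ArcData.picture n (ArcData.run n (rowsWord L.1))) ∈ DTL hn,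
      φ (mon n (rowsWord L.1)) = RingQuot.mkAlgHom ℤ[X] (LoopRel hn) ⟨_, hD⟩ := by
  have key : ∀ ω : List (Fin n), ∃ hD : (ω.map (simpleHat hn)).prod ∈ DTL hn,
      φ (ω.map PFTL.b).prod = RingQuot.mkAlgHom ℤ[X] (LoopRel hn) ⟨_, hD⟩ := by
    intro ω
    induction ω with
    | nil => exact ⟨one_mem _, by
        simp only [List.map_nil, List.prod_nil, map_one]
        exact (map_one _).symm⟩
    | cons i ω ih =>
      obtain ⟨hD, ih⟩ := ih
      refine ⟨?_, ?_⟩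
      · rw [List.map_cons, List.prod_cons]
        exact mul_mem (Algebra.subset_adjoin ⟨i, rfl⟩) hD
      · rw [List.map_cons, List.prod_cons, map_mul, ih, hφ, LFD.d, ← map_mul]
        rfl
  obtain ⟨hD, h⟩ := key L.word
  have he := (ArcData.hat_run_normal hn L.2).2 L.word L.map_val_word
  refine ⟨by rw [he]; exact hD, ?_⟩
  rw [← L.prod_word, h]
  exact congrArg _ (Subtype.ext he.symm)

/-- The images of the monomials of normal words in the loop-free diagram algebra are linearly
independent. -/
theorem linearIndependent_map_mon (hn : 4 ≤ n) (φ : PFTL n →ₐ[ℤ[X]] LFD hn)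
    (hφ : ∀ i, φ (PFTL.b i) = LFD.d hn i) :
    LinearIndependent ℤ[X] fun L : NormalList n => φ (mon n (rowsWord L.1)) := by
  obtain ⟨T, hT⟩ := exists_value hn
  refine LinearIndependent.of_comp T ?_
  -- The diagram of a normal word has no loops, so its value is the basis vector at its key.
  -- Distinct normal lists have distinct keys.
  have h : (T ∘ fun L : NormalList n => φ (mon n (rowsWord L.1))) =
      (fun k => Finsupp.single k (1 : ℤ[X])) ∘ fun L : NormalList n =>
        (ArcData.picture n (ArcData.run n (rowsWord L.1))).key := by
    funext L
    obtain ⟨hD, h⟩ := map_mon_word hn φ hφ L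
    rw [Function.comp_apply, h, hT _ (ArcData.hat_run_normal hn L.2).1, ArcData.value_picture]
    rfl
  rw [h]
  refine (Finsupp.linearIndependent_single_one ℤ[X] _).comp _ fun L L' hL => ?_
  exact Subtype.ext (ArcData.run_injective L.2 L'.2
    ((ArcData.run_normal _ L.2).1.eq_of_key_eq (ArcData.run_normal _ L'.2).1 hn hL))

theorem span_mon (hn : 4 ≤ n) :
    Submodule.span ℤ[X] (Set.range fun L : NormalList n => mon n (rowsWord L.1)) = ⊤ := by
  set S := Submodule.span ℤ[X] (Set.range fun L : NormalList n => mon n (rowsWord L.1)) with hS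
  have hmon : ∀ ω : List (Fin n), mon n (ω.map Fin.val) ∈ S := by
    intro ω
    rcases mon_eq hn (ω.map Fin.val) (by simp) with h | ⟨k, L, hL, h, -⟩
    · rw [h]; exact zero_mem _
    · rw [h]; exact Submodule.smul_mem _ _ (Submodule.subset_span ⟨⟨L, hL⟩, rfl⟩)
  have hmul : ∀ x y, x ∈ S → y ∈ S → x * y ∈ S := by
    intro x y hx hy
    have h := Submodule.mul_mem_mul hx hy
    rw [hS, Submodule.span_mul_span] at h
    refine Submodule.span_le.2 ?_ h
    rintro _ ⟨_, ⟨L, rfl⟩, _, ⟨L', rfl⟩, rfl⟩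
    have := hmon (L.word ++ L'.word)
    rwa [List.map_append, mon_append, L.map_val_word, L'.map_val_word] at this
  rw [eq_top_iff]
  rintro z -
  obtain ⟨y, rfl⟩ := RingQuot.mkAlgHom_surjective ℤ[X] (PairRel n) z
  obtain ⟨x, rfl⟩ := RingQuot.mkAlgHom_surjective ℤ[X] (TLRel n) y
  have hone : (1 : PFTL n) ∈ S := by simpa [mon] using hmon []
  induction x using FreeAlgebra.induction with
  | grade0 c =>
    rw [AlgHom.commutes, AlgHom.commutes, Algebra.algebraMap_eq_smul_one]
    exact Submodule.smul_mem _ _ hone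
  | grade1 i =>
    have := hmon [i]
    rwa [mon_map_val, List.map_singleton, List.prod_singleton] at this
  | mul a b ha hb => rw [map_mul, map_mul]; exact hmul _ _ ha hb
  | add a b ha hb => rw [map_add, map_add]; exact add_mem ha hb

/-- The monomial basis, and the isomorphism with the loop-free diagram algebra. -/
theorem exists_basis (hn : 4 ≤ n) : ∃ (φ : PFTL n ≃ₐ[ℤ[X]] LFD hn)
    (B : Module.Basis (NormalList n) ℤ[X] (PFTL n)),
    (∀ i, φ (PFTL.b i) = LFD.d hn i) ∧ ∀ L, B L = mon n (rowsWord L.1) := by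
  obtain ⟨φ, hφ⟩ := exists_diagramHom hn
  have hli := linearIndependent_map_mon hn φ hφ
  let B := Module.Basis.mk (LinearIndependent.of_comp φ.toLinearMap hli) (span_mon hn).ge
  have hB : ∀ L, B L = mon n (rowsWord L.1) := fun L => by rw [Module.Basis.mk_apply]
  have hinj : Function.Injective φ := by
    -- The map `φ` turns coordinates in the monomial basis into coefficients over an independent
    -- family, so it is injective.
    have hc : ∀ x, φ x = Finsupp.linearCombination ℤ[X]
        (fun L : NormalList n => φ (mon n (rowsWord L.1))) (B.repr x) := by
      intro x
      conv_lhs => rw [← B.linearCombination_repr x]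
      rw [Finsupp.linearCombination_apply, Finsupp.linearCombination_apply, map_finsuppSum]
      simp only [map_smul, hB]
    intro x y h
    rw [hc, hc] at h
    exact B.repr.injective (hli h)
  exact ⟨AlgEquiv.ofBijective φ ⟨hinj, diagramHom_surjective hn φ hφ⟩, B, hφ, hB⟩

end

section

variable {n : ℕ}

/-! ## Normal words in the Coxeter group -/

theorem coxMatrix_apply (i j : Fin n) :
    coxMatrix n i j = if i = j then 1 else if Joined i j then 3 else 2 := rfl

theorem coxMatrix_eq_two {i j : Fin n} (hij : i ≠ j) (h : ¬ Joined i j) : coxMatrix n i j = 2 := by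
  rw [coxMatrix_apply, if_neg hij, if_neg h]

theorem simple_comm {i j : Fin n} (h : coxMatrix n i j = 2) :
    (cs n).simple i * (cs n).simple j = (cs n).simple j * (cs n).simple i := by
  have h1 := (cs n).simple_mul_simple_pow i j
  rw [h, pow_two] at h1
  have h2 := eq_inv_of_mul_eq_one_left h1
  rw [mul_inv_rev, CoxeterSystem.inv_simple, CoxeterSystem.inv_simple] at h2
  exact h2

theorem simple_braid {i j : Fin n} (hij : i ≠ j) (h : Joined i j) :
    (cs n).simple i * (cs n).simple j * (cs n).simple i =
      (cs n).simple j * (cs n).simple i * (cs n).simple j := by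
  have h1 := (cs n).simple_mul_simple_pow i j
  rw [coxMatrix_apply, if_neg hij, if_pos h, pow_succ, pow_two] at h1
  have h2 : (cs n).simple i * (cs n).simple j * (cs n).simple i *
      ((cs n).simple j * (cs n).simple i * (cs n).simple j) = 1 := by
    rw [← h1]; simp only [mul_assoc]
  rw [eq_inv_of_mul_eq_one_left h2]
  simp only [mul_inv_rev, CoxeterSystem.inv_simple, mul_assoc]

/-- A commutation class of words over the numbers is a commutation class of words in the
generators. -/
theorem exists_commMove {ω : List (Fin n)} {v : List ℕ} (h : CommEq (ω.map Fin.val) v) :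
    ∃ ω' : List (Fin n), ω'.map Fin.val = v ∧ Relation.ReflTransGen CommMove ω ω' := by
  induction h with
  | refl => exact ⟨ω, rfl, .refl⟩
  | tail _ h ih =>
    obtain ⟨ω₁, h1, ih⟩ := ih
    obtain ⟨l, r, s, t, hne, hst, rfl, rfl⟩ := h
    obtain ⟨ω₂, r', rfl, h2, rfl⟩ := List.map_eq_append_iff.1 h1
    obtain ⟨l', x, rfl, rfl, h3⟩ := List.map_eq_append_iff.1 h2
    obtain ⟨s', x', rfl, rfl, h4⟩ := List.map_eq_cons_iff.1 h3
    obtain ⟨t', x'', rfl, rfl, h5⟩ := List.map_eq_cons_iff.1 h4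
    obtain rfl := List.map_eq_nil_iff.1 h5
    refine ⟨l' ++ [t', s'] ++ r', by simp, ih.tail ⟨l', r', s', t', ?_, rfl, rfl⟩⟩
    exact coxMatrix_eq_two (fun h => hne (congrArg Fin.val h)) hst

theorem CommMove.wordProd_eq {ω ω' : List (Fin n)} (h : Relation.ReflTransGen CommMove ω ω') :
    (cs n).wordProd ω = (cs n).wordProd ω' ∧ ω.Perm ω' := by
  induction h with
  | refl => exact ⟨rfl, List.Perm.refl _⟩
  | tail _ h ih =>
    obtain ⟨l, r, s, t, hst, rfl, rfl⟩ := h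
    refine ⟨ih.1.trans ?_, ih.2.trans ?_⟩
    · simp only [CoxeterSystem.wordProd_append, CoxeterSystem.wordProd_cons,
        CoxeterSystem.wordProd_nil, mul_one, simple_comm hst]
    · exact ((List.Perm.swap t s []).append_left l).append_right r

/-- The specialization of the pair-free Temperley-Lieb algebra at `δ = 2`, with the coefficients
of the basis elements. -/
theorem exists_specialization {ι : Type} (B : Module.Basis ι ℤ[X] (PFTL n)) :
    ∃ (A : Type) (_ : Ring A) (f : PFTL n →+* A) (c : ι → A →+ ℤ),
      (∀ x, f ((X : ℤ[X]) • x) = 2 * f x) ∧ ∀ i x, c i (f x) = (B.repr x i).eval 2 := by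
  let r : PFTL n → PFTL n → Prop := fun x y => x = (X : ℤ[X]) • 1 ∧ y = 2
  -- Coefficients evaluated at 2 are not linear over `ℤ[X]`, so the factorisation through the
  -- quotient is carried out over `ℕ`, where additivity suffices.
  let T : ι → PFTL n →ₗ[ℕ] ℤ := fun i => AddMonoidHom.toNatLinearMap
    { toFun := fun x => (B.repr x i).eval 2
      map_zero' := by simp
      map_add' := by simp }
  have hT : ∀ i x y, r x y → ∀ a b, T i (a * x * b) = T i (a * y * b) := by
    rintro i _ _ ⟨rfl, rfl⟩ a b
    show (B.repr (a * (X : ℤ[X]) • 1 * b) i).eval 2 = (B.repr (a * 2 * b) i).eval 2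
    rw [mul_smul_comm, smul_mul_assoc, mul_one, mul_two, add_mul]
    simp [two_mul]
  choose T' hT' using fun i => exists_ringQuot_factor r (T i) (hT i)
  have h1 : RingQuot.mkAlgHom ℕ r ((X : ℤ[X]) • 1) = RingQuot.mkAlgHom ℕ r 2 :=
    RingQuot.mkAlgHom_rel ℕ ⟨rfl, rfl⟩
  have h2 : ∀ x, RingQuot.mkAlgHom ℕ r ((X : ℤ[X]) • x) = 2 * RingQuot.mkAlgHom ℕ r x := by
    intro x
    rw [show (X : ℤ[X]) • x = ((X : ℤ[X]) • 1) * x by rw [smul_mul_assoc, one_mul], map_mul, h1,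
      map_ofNat]
  exact ⟨RingQuot r, Algebra.semiringToRing ℤ[X], (RingQuot.mkAlgHom ℕ r : PFTL n →+* RingQuot r),
    fun i => (T' i).toAddMonoidHom, h2, fun i x => hT' i x⟩

/-- At δ = 2 one has `(1 - b)² = 1 - 2b + 2b = 1`. For joined generators the triple product reduces
to an expression symmetric in the two, which is the braid relation. -/
theorem isLiftable_one_sub {A : Type} [Ring A] (f : PFTL n →+* A)
    (hf : ∀ x, f ((X : ℤ[X]) • x) = 2 * f x) :
    (coxMatrix n).IsLiftable fun i => 1 - f (PFTL.b i) := by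
  have hsq : ∀ i, (1 - f (PFTL.b i)) * (1 - f (PFTL.b i)) = (1 : A) := by
    intro i
    have h : f (PFTL.b i) * f (PFTL.b i) = 2 * f (PFTL.b i) := by rw [← map_mul, PFTL.b_sq, hf]
    have h' : (1 - f (PFTL.b i)) * (1 - f (PFTL.b i)) =
        1 - 2 * f (PFTL.b i) + f (PFTL.b i) * f (PFTL.b i) := by noncomm_ring
    rw [h', h, sub_add_cancel]
  intro i j
  rw [coxMatrix_apply]
  split_ifs with h h'
  · rw [h, pow_one, hsq]
  · have hb : ∀ i j : Fin n, Joined i j →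
        (1 - f (PFTL.b i)) * (1 - f (PFTL.b j)) * (1 - f (PFTL.b i)) =
        1 - f (PFTL.b i) - f (PFTL.b j) + f (PFTL.b i) * f (PFTL.b j) +
          f (PFTL.b j) * f (PFTL.b i) := by
      intro i j h
      have h1 : f (PFTL.b i) * f (PFTL.b i) = 2 * f (PFTL.b i) := by rw [← map_mul, PFTL.b_sq, hf]
      have h2 : f (PFTL.b i) * f (PFTL.b j) * f (PFTL.b i) = f (PFTL.b i) := by
        rw [← map_mul, ← map_mul, PFTL.b_braid i j h]
      have h3 : (1 - f (PFTL.b i)) * (1 - f (PFTL.b j)) * (1 - f (PFTL.b i)) =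
          1 - 2 * f (PFTL.b i) - f (PFTL.b j) + f (PFTL.b i) * f (PFTL.b j) +
            f (PFTL.b j) * f (PFTL.b i) + f (PFTL.b i) * f (PFTL.b i) -
              f (PFTL.b i) * f (PFTL.b j) * f (PFTL.b i) := by noncomm_ring
      rw [h3, h1, h2]
      noncomm_ring
    have h1 := hb i j h'
    have h2 := hb j i (by unfold Joined at *; omega)
    have h3 : (1 - f (PFTL.b i)) * (1 - f (PFTL.b j)) * (1 - f (PFTL.b i)) =
        (1 - f (PFTL.b j)) * (1 - f (PFTL.b i)) * (1 - f (PFTL.b j)) := by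
      rw [h1, h2]; abel
    have h4 : ((1 - f (PFTL.b i)) * (1 - f (PFTL.b j))) ^ 3 =
        ((1 - f (PFTL.b i)) * (1 - f (PFTL.b j)) * (1 - f (PFTL.b i))) *
          ((1 - f (PFTL.b j)) * (1 - f (PFTL.b i)) * (1 - f (PFTL.b j))) := by
      rw [pow_succ, pow_two]; simp only [mul_assoc]
    rw [h4, ← h3]
    have hi := hsq i
    have hj := hsq j
    clear h1 h2 h3 h4
    generalize 1 - f (PFTL.b i) = x at *
    generalize 1 - f (PFTL.b j) = y at *
    calc x * y * x * (x * y * x) = x * y * (x * x) * y * x := by simp only [mul_assoc]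
      _ = x * (y * y) * x := by rw [hi]; simp only [mul_assoc, one_mul]
      _ = 1 := by rw [hj, mul_one, hi]
  · have hc : (1 - f (PFTL.b i)) * (1 - f (PFTL.b j)) =
        (1 - f (PFTL.b j)) * (1 - f (PFTL.b i)) := by
      have : f (PFTL.b i) * f (PFTL.b j) = f (PFTL.b j) * f (PFTL.b i) := by
        rw [← map_mul, ← map_mul, PFTL.b_comm i j h']
      rw [sub_mul, sub_mul, mul_sub, mul_sub, this]
      noncomm_ring
    rw [pow_two]
    nth_rw 2 [hc]
    rw [mul_assoc, ← mul_assoc (1 - f (PFTL.b j)), hsq, one_mul, hsq]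

/-- The leading term of a product of reflections. -/
theorem prod_one_sub {A : Type} [Ring A] (f : PFTL n →+* A) (ω : List (Fin n)) :
    ∃ y ∈ AddSubgroup.closure {a | ∃ ω' : List (Fin n), ω'.length < ω.length ∧
        a = f (ω'.map PFTL.b).prod},
      (ω.map fun i => 1 - f (PFTL.b i)).prod = (-1) ^ ω.length * f (ω.map PFTL.b).prod + y := by
  induction ω using List.reverseRecOn with
  | nil => exact ⟨0, zero_mem _, by simp⟩
  | append_singleton ω s ih =>
    obtain ⟨y, hy, ih⟩ := ih
    have hle : AddSubgroup.closure {a | ∃ ω' : List (Fin n), ω'.length < ω.length ∧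
        a = f (ω'.map PFTL.b).prod} ≤ AddSubgroup.closure {a | ∃ ω' : List (Fin n),
        ω'.length < (ω ++ [s]).length ∧ a = f (ω'.map PFTL.b).prod} := by
      refine AddSubgroup.closure_mono ?_
      rintro _ ⟨ω', h, rfl⟩
      exact ⟨ω', by simp; omega, rfl⟩
    have hmul : y * f (PFTL.b s) ∈ AddSubgroup.closure {a | ∃ ω' : List (Fin n),
        ω'.length < (ω ++ [s]).length ∧ a = f (ω'.map PFTL.b).prod} := by
      clear ih
      induction hy using AddSubgroup.closure_induction with
      | mem x hx =>
        obtain ⟨ω', h, rfl⟩ := hx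
        exact AddSubgroup.subset_closure ⟨ω' ++ [s], by simp; omega, by simp⟩
      | zero => rw [zero_mul]; exact zero_mem _
      | add x y _ _ hx hy => rw [add_mul]; exact add_mem hx hy
      | neg x _ hx => rw [neg_mul]; exact neg_mem hx
    have htop : (-1) ^ ω.length * f (ω.map PFTL.b).prod ∈ AddSubgroup.closure {a |
        ∃ ω' : List (Fin n), ω'.length < (ω ++ [s]).length ∧ a = f (ω'.map PFTL.b).prod} := by
      have := AddSubgroup.subset_closure (k := {a | ∃ ω' : List (Fin n),
        ω'.length < (ω ++ [s]).length ∧ a = f (ω'.map PFTL.b).prod}) ⟨ω, by simp, rfl⟩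
      rcases neg_one_pow_eq_or A ω.length with h | h <;> rw [h]
      · rwa [one_mul]
      · rw [neg_one_mul]; exact neg_mem this
    refine ⟨(-1) ^ ω.length * f (ω.map PFTL.b).prod + (y - y * f (PFTL.b s)),
      add_mem htop (sub_mem (hle hy) hmul), ?_⟩
    rw [List.map_append, List.prod_append, ih, List.map_append, List.prod_append]
    simp only [List.map_cons, List.map_nil, List.prod_cons, List.prod_nil, mul_one,
      List.length_append, List.length_singleton, pow_succ, map_mul]
    noncomm_ring

/-- A word that represents the same group element as a normal word, and is not longer, is
commutation equivalent to it. -/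
theorem commEq_of_wordProd_eq (hn : 4 ≤ n) (L : NormalList n) (ω : List (Fin n))
    (h : (cs n).wordProd ω = (cs n).wordProd L.word) (hl : ω.length ≤ L.word.length) :
    CommEq (ω.map Fin.val) (rowsWord L.1) := by
  obtain ⟨-, B, -, hB⟩ := exists_basis hn
  obtain ⟨A, _, f, c, hf, hc⟩ := exists_specialization B
  have hlift := isLiftable_one_sub f hf
  let F := (cs n).lift ⟨_, hlift⟩
  have hF : ∀ ω : List (Fin n),
      F ((cs n).wordProd ω) = (ω.map fun i => 1 - f (PFTL.b i)).prod := by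
    intro ω
    rw [CoxeterSystem.wordProd, map_list_prod, List.map_map]
    congr 2
    funext i
    exact (cs n).lift_apply_simple hlift i
  have hlen : ∀ L : NormalList n, L.word.length = (rowsWord L.1).length := fun L => by
    rw [← L.map_val_word, List.length_map]
  -- By `mon_eq`, a nonzero coefficient at `L` means that the word reduces to `L`. Since it is not
  -- longer than `L.word`, it cannot have been shortened, so only commutations were used.
  have hmon : ∀ ω : List (Fin n), ω.length ≤ L.word.length → c L (f (ω.map PFTL.b).prod) ≠ 0 →
      CommEq (ω.map Fin.val) (rowsWord L.1) := by
    intro ω hω hne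
    rw [← mon_map_val, hc] at hne
    rcases mon_eq hn (ω.map Fin.val) (by simp) with h | ⟨k, L', hL', h, h'⟩
    · simp [h] at hne
    · have hBL : mon n (rowsWord L') = B ⟨L', hL'⟩ := (hB ⟨L', hL'⟩).symm
      rw [h, hBL, map_smul, B.repr_self, Finsupp.smul_single, Finsupp.single_apply] at hne
      split_ifs at hne with hLL
      · subst hLL
        rcases h' with h' | ⟨-, h'⟩
        · have := hlen ⟨L', hL'⟩
          rw [List.length_map] at h'
          dsimp only at this
          omega
        · exact h'
      · simp at hne
  -- Commutations preserve the length, so a shorter word contributes nothing to the coefficient at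
  -- `L`.
  have hlow : ∀ m ≤ L.word.length, ∀ y ∈ AddSubgroup.closure {a | ∃ ω' : List (Fin n),
      ω'.length < m ∧ a = f (ω'.map PFTL.b).prod}, c L y = 0 := by
    intro m hm y hy
    induction hy using AddSubgroup.closure_induction with
    | mem x hx =>
      obtain ⟨ω', h, rfl⟩ := hx
      by_contra hne
      have := (hmon ω' (by omega) hne).perm.length_eq
      rw [List.length_map, ← hlen L] at this
      omega
    | zero => exact map_zero _
    | add x y _ _ hx hy => rw [map_add, hx, hy, add_zero]
    | neg x _ hx => rw [map_neg, hx, neg_zero]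
  have hcoef : ∀ ω : List (Fin n), ω.length ≤ L.word.length → ∃ ε : ℤ, (ε = 1 ∨ ε = -1) ∧
      c L (F ((cs n).wordProd ω)) = ε * c L (f (ω.map PFTL.b).prod) := by
    intro ω hω
    obtain ⟨y, hy, h⟩ := prod_one_sub f ω
    rw [hF, h, map_add, hlow _ hω y hy, add_zero]
    rcases neg_one_pow_eq_or A ω.length with h | h <;> rw [h]
    · exact ⟨1, Or.inl rfl, by simp⟩
    · exact ⟨-1, Or.inr rfl, by simp⟩
  -- Computed from `L.word`, the coefficient of the group element at `L` is a sign; computed from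
  -- `ω`, it is up to sign the coefficient of the monomial of `ω`, which therefore cannot vanish.
  refine hmon ω hl fun h0 => ?_
  obtain ⟨ε, hε, h1⟩ := hcoef ω hl
  obtain ⟨ε', hε', h2⟩ := hcoef L.word le_rfl
  rw [h, h2, h0, L.prod_word, ← hB, hc, B.repr_self, Finsupp.single_eq_same] at h1
  rcases hε' with rfl | rfl <;> simp at h1

/-- A reduced expression of the same element is not longer, hence commutation equivalent to the
normal word, hence of the same length. -/
theorem NormalList.isReducedExpr_word (hn : 4 ≤ n) (L : NormalList n) :
    IsReducedExpr L.word ((cs n).wordProd L.word) := by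
  refine ⟨?_, rfl⟩
  obtain ⟨ω, h1, h2⟩ := (cs n).exists_isReduced ((cs n).wordProd L.word)
  have hle := (cs n).length_wordProd_le L.word
  rw [CoxeterSystem.IsReduced, ← h2] at h1
  have h3 := (commEq_of_wordProd_eq hn L ω h2.symm (by omega)).perm.length_eq
  rw [← L.map_val_word, List.length_map, List.length_map] at h3
  rw [CoxeterSystem.IsReduced]
  omega

theorem NormalList.commEq (hn : 4 ≤ n) (L : NormalList n) {ω : List (Fin n)}
    (h : IsReducedExpr ω ((cs n).wordProd L.word)) : CommEq (ω.map Fin.val) (rowsWord L.1) := by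
  refine commEq_of_wordProd_eq hn L ω h.2 ?_
  have h1 := h.1
  rw [CoxeterSystem.IsReduced, h.2] at h1
  rw [← h1]
  exact (cs n).length_wordProd_le _

theorem NormalList.mon_ne_zero (hn : 4 ≤ n) (L : NormalList n) : mon n (rowsWord L.1) ≠ 0 := by
  obtain ⟨-, B, -, hB⟩ := exists_basis hn
  rw [← hB]
  exact B.ne_zero L

theorem NormalList.isFC (hn : 4 ≤ n) (L : NormalList n) : IsFC ((cs n).wordProd L.word) := by
  intro ω ω' h h'
  obtain ⟨ω₁, h1, h2⟩ := exists_commMove ((L.commEq hn h).trans (L.commEq hn h').symm)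
  rw [List.map_injective_iff.2 Fin.val_injective h1] at h2
  exact h2

/-- Otherwise the monomial would contain the factor `b_{\bar 1} b_1 = 0`, but it is a basis element.
-/
theorem NormalList.not_heapTypeI (hn : 4 ≤ n) (L : NormalList n) :
    ¬ HeapTypeI ((cs n).wordProd L.word) := by
  rintro ⟨ω, i, j, hi, hj, h, l, r, rfl⟩
  refine L.mon_ne_zero hn ?_
  rw [← mon_commEq (L.commEq hn h), mon_map_val]
  simp only [List.map_append, List.prod_append, List.map_cons, List.map_nil, List.prod_cons,
    List.prod_nil, mul_one, PFTL.b_pair_symm i j hi hj, mul_zero, zero_mul]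

theorem NormalList.eq_of_wordProd_eq (hn : 4 ≤ n) {L L' : NormalList n}
    (h : (cs n).wordProd L.word = (cs n).wordProd L'.word) : L = L' := by
  obtain ⟨-, B, -, hB⟩ := exists_basis hn
  have h1 := L'.commEq hn (h ▸ L.isReducedExpr_word hn)
  rw [L.map_val_word] at h1
  refine B.injective ?_
  rw [hB, hB, mon_commEq h1]

/-- Every fully commutative element of type II is represented by a normal word. -/
theorem exists_normalList (hn : 4 ≤ n) (w : W n) (hw : IsFC w) (hw' : ¬ HeapTypeI w) :
    ∃ L : NormalList n, (cs n).wordProd L.word = w := by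
  obtain ⟨ω, h1, h2⟩ := (cs n).exists_isReduced w
  have hω : IsReducedExpr ω w := ⟨h1, h2.symm⟩
  have hred : ∀ ω' : List (Fin n), (cs n).wordProd ω' = w → ω'.length ≤ ω.length →
      IsReducedExpr ω' w ∧ ω'.length = ω.length := by
    intro ω' h hl
    have h3 := (cs n).length_wordProd_le ω'
    rw [CoxeterSystem.IsReduced, ← h2] at h1
    rw [h] at h3
    exact ⟨⟨by rw [CoxeterSystem.IsReduced, h]; omega, h⟩, by omega⟩
  rcases reducible_or_normal (n := n) (by omega) (ω.map Fin.val) (by simp) with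
    ⟨l, x, r, hx, hc⟩ | ⟨L, hL, hc⟩
  -- A factor `ss` contradicts reducedness. A factor `sts` gives, by the braid relation, a reduced
  -- expression with a different number of letters `s`, which no commutations can reach. The factors
  -- `01` and `10` give type I.
  · exfalso
    obtain ⟨ω₁, e1, hm⟩ := exists_commMove hc
    obtain ⟨hp, hperm⟩ := CommMove.wordProd_eq hm
    have hlen := hperm.length_eq
    rw [← h2] at hp
    obtain ⟨ω₂, r', rfl, e2, rfl⟩ := List.map_eq_append_iff.1 e1
    obtain ⟨l', x', rfl, rfl, e3⟩ := List.map_eq_append_iff.1 e2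
    have hrep : ∀ y : List (Fin n), (cs n).wordProd y = (cs n).wordProd x' →
        (cs n).wordProd (l' ++ y ++ r') = w := fun y hy => by
      rw [hp, CoxeterSystem.wordProd_append, CoxeterSystem.wordProd_append, hy,
        CoxeterSystem.wordProd_append, CoxeterSystem.wordProd_append]
    simp only [List.length_append] at hlen
    rcases hx with ⟨s, rfl⟩ | ⟨s, t, hst, rfl⟩ | rfl | rfl
    · obtain ⟨a, x₁, rfl, ha, e4⟩ := List.map_eq_cons_iff.1 e3
      obtain ⟨b, x₂, rfl, hb, e5⟩ := List.map_eq_cons_iff.1 e4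
      obtain rfl := List.map_eq_nil_iff.1 e5
      obtain rfl : a = b := Fin.ext (ha.trans hb.symm)
      have := (hred (l' ++ [] ++ r') (hrep [] (by
        rw [CoxeterSystem.wordProd_cons, CoxeterSystem.wordProd_singleton,
          CoxeterSystem.simple_mul_simple_self, CoxeterSystem.wordProd_nil]))
          (by simp at hlen ⊢; omega)).2
      simp at hlen this
      omega
    · obtain ⟨a, x₁, rfl, ha, e4⟩ := List.map_eq_cons_iff.1 e3
      obtain ⟨b, x₂, rfl, hb, e5⟩ := List.map_eq_cons_iff.1 e4
      obtain ⟨a', x₃, rfl, ha', e6⟩ := List.map_eq_cons_iff.1 e5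
      obtain rfl := List.map_eq_nil_iff.1 e6
      obtain rfl : a = a' := Fin.ext (ha.trans ha'.symm)
      have hj : Joined a b := by subst ha hb; exact hst
      have hab : a ≠ b := fun h => by subst h; unfold Joined at hj; omega
      have h3 := (hred (l' ++ [b, a, b] ++ r') (hrep _ (by
        simp only [CoxeterSystem.wordProd_cons, CoxeterSystem.wordProd_nil, mul_one, ← mul_assoc]
        exact (simple_braid hab hj).symm)) (by simp at hlen ⊢; omega)).1
      have h4 := (hred (l' ++ [a, b, a] ++ r') hp.symm (by simp at hlen ⊢; omega)).1
      have h5 := (CommMove.wordProd_eq (hw _ _ h3 h4)).2.count_eq a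
      simp [List.count_append, hab.symm] at h5
    · obtain ⟨a, x₁, rfl, ha, e4⟩ := List.map_eq_cons_iff.1 e3
      obtain ⟨b, x₂, rfl, hb, e5⟩ := List.map_eq_cons_iff.1 e4
      obtain rfl := List.map_eq_nil_iff.1 e5
      exact hw' ⟨_, a, b, ha, hb, (hred _ hp.symm (by simp at hlen ⊢; omega)).1, l', r', rfl⟩
    · obtain ⟨a, x₁, rfl, ha, e4⟩ := List.map_eq_cons_iff.1 e3
      obtain ⟨b, x₂, rfl, hb, e5⟩ := List.map_eq_cons_iff.1 e4
      obtain rfl := List.map_eq_nil_iff.1 e5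
      have h2 : coxMatrix n b a = 2 := coxMatrix_eq_two
        (fun h => by rw [Fin.ext_iff] at h; omega) (by unfold Joined; omega)
      exact hw' ⟨_, b, a, hb, ha, (hred (l' ++ [b, a] ++ r') (hrep _ (by
        simp only [CoxeterSystem.wordProd_cons, CoxeterSystem.wordProd_nil, mul_one]
        exact simple_comm h2)) (by simp at hlen ⊢; omega)).1, l', r', rfl⟩
  · obtain ⟨ω₁, e1, hm⟩ := exists_commMove hc
    refine ⟨⟨L, hL⟩, ?_⟩
    have : ω₁ = NormalList.word ⟨L, hL⟩ := List.map_injective_iff.2 Fin.val_injective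
      (e1.trans (NormalList.map_val_word ⟨L, hL⟩).symm)
    rw [← this, ← (CommMove.wordProd_eq hm).1, h2]

/-- The normal words represent the fully commutative elements of type II. -/
def normalEquiv (hn : 4 ≤ n) : NormalList n ≃ FCII n :=
  Equiv.ofBijective (fun L => ⟨(cs n).wordProd L.word, L.isFC hn, L.not_heapTypeI hn⟩)
    ⟨fun _ _ h => NormalList.eq_of_wordProd_eq hn (congrArg Subtype.val h), fun w => by
      obtain ⟨L, hL⟩ := exists_normalList hn w.1 w.2.1 w.2.2
      exact ⟨L, Subtype.ext hL⟩⟩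

end

section

variable {n : ℕ}

/-! ## Admissible diagrams -/

theorem sum_node_pos (f : ℕ → ℕ) : ∑ x : Node n, f x.pos = ∑ k ∈ Finset.range (2 * n), f k := by
  refine Finset.sum_bij (fun x _ => x.pos) (fun x _ => Finset.mem_range.2 x.pos_lt)
    (fun x _ y _ h => Node.pos_injective h) (fun k hk => ?_) fun _ _ => rfl
  have hk := Finset.mem_range.1 hk
  by_cases h : k < n
  · exact ⟨Sum.inl ⟨k, h⟩, Finset.mem_univ _, rfl⟩
  · exact ⟨Sum.inr ⟨2 * n - 1 - k, by omega⟩, Finset.mem_univ _, by simp only [Node.pos]; omega⟩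

/-- Every arc has two ends. -/
theorem Picture.IsPseudo.sum_dec {P : Picture n} (h : P.IsPseudo) (hl : ∀ e, ¬ P.IsLoop e) :
    ∑ x, P.dec (P.edgeAt x) = 2 * ∑ e, P.dec e := by
  classical
  rw [← Finset.sum_fiberwise Finset.univ P.edgeAt, Finset.mul_sum]
  refine Finset.sum_congr rfl fun e _ => ?_
  have h2 := (h.1 e).resolve_left (hl e)
  rw [Nat.card_eq_fintype_card, Fintype.card_subtype] at h2
  rw [Finset.sum_congr rfl fun x hx => by rw [(Finset.mem_filter.1 hx).2], Finset.sum_const, h2,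
    smul_eq_mul]

namespace ArcData

theorem Valid.even_dec {r : ArcData} (hr : r.Valid n) (hn : 4 ≤ n) (he : r.EvenDec n) :
    Even (∑ e, (picture n r).dec e) := by
  have h := (hr.isPseudo hn).sum_dec fun e h => by
    obtain ⟨x, hx⟩ := picture_edgeAt_surjective e
    exact h x hx
  have h2 : ∑ x : Node n, (picture n r).dec ((picture n r).edgeAt x) =
      ∑ k ∈ Finset.range (2 * n), (r.q k).toNat := by
    rw [← sum_node_pos]
    exact Finset.sum_congr rfl fun x _ => hr.dec_edgeAt x
  rw [EvenDec, ← h2, h] at he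
  rw [even_iff_two_dvd]
  omega

/-- A loop-free picture with at most one decoration on each arc is the picture of an arc
pattern. -/
theorem exists_valid_of_isLDecorated (hn : 4 ≤ n) {P : Picture n} (hP : P.IsLDecorated)
    (hl : ∀ e, ¬ P.IsLoop e) (hd : ∀ e, P.dec e ≤ 1) :
    ∃ r : ArcData, r.Valid n ∧ Picture.Equivalent P (picture n r) ∧
      ∀ x : Node n, (r.q x.pos).toNat = P.dec (P.edgeAt x) := by
  classical
  have hex : ∀ x : Node n, ∃ y, y ≠ x ∧ ∀ z, P.edgeAt z = P.edgeAt x ↔ z = x ∨ z = y := by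
    intro x
    have h := (hP.1.1 (P.edgeAt x)).resolve_left (hl _)
    rw [Nat.card_eq_fintype_card, Fintype.card_subtype] at h
    obtain ⟨a, b, hab, hs⟩ := Finset.card_eq_two.1 h
    have hz : ∀ z, P.edgeAt z = P.edgeAt x ↔ z = a ∨ z = b := fun z => by
      simpa using Finset.ext_iff.1 hs z
    rcases (hz x).1 rfl with rfl | rfl
    · exact ⟨b, hab.symm, hz⟩
    · exact ⟨a, hab, fun z => (hz z).trans or_comm⟩
  choose mate hne hmate using hex
  have hinv : ∀ x, mate (mate x) = x := fun x => by
    have h1 := (hmate x (mate x)).2 (Or.inr rfl)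
    exact (((hmate (mate x) x).1 h1.symm).resolve_left (hne x).symm).symm
  have hedge : ∀ x, P.edgeAt (mate x) = P.edgeAt x := fun x => (hmate x _).2 (Or.inr rfl)
  let r : ArcData :=
    { p := fun x => if x < 2 * n then (mate (nodeAt hn x)).pos else x
      q := fun x => decide (x < 2 * n) && decide (P.dec (P.edgeAt (nodeAt hn x)) = 1) }
  have hp : ∀ x : Node n, r.p x.pos = (mate x).pos := fun x => by
    simp only [r, if_pos x.pos_lt, nodeAt_pos]
  have hq : ∀ x : Node n, r.q x.pos = decide (P.dec (P.edgeAt x) = 1) := fun x => by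
    simp [r, x.pos_lt, nodeAt_pos]
  have hpo : ∀ x, 2 * n ≤ x → r.p x = x := fun x hx => if_neg (by omega)
  have hqo : ∀ x, 2 * n ≤ x → r.q x = false := fun x hx => by
    simp [r, show ¬ x < 2 * n by omega]
  have hall : ∀ x, (∃ y : Node n, y.pos = x) ∨ 2 * n ≤ x := fun x => by
    rcases lt_or_ge x (2 * n) with h | h
    · exact Or.inl ⟨_, pos_nodeAt hn h⟩
    · exact Or.inr h
  have hr : r.Valid n := by
    refine ⟨fun x => ?_, fun x hx => ?_, fun x hx => ?_, hpo, hqo, fun x => ?_, fun x y => ?_,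
      fun x y h => ?_⟩
    · rcases hall x with ⟨x, rfl⟩ | h
      · rw [hp, hp, hinv]
      · rw [hpo x h, hpo x h]
    · rcases hall x with ⟨x, rfl⟩ | h
      · rw [hp]; exact Node.pos_lt _
      · omega
    · rcases hall x with ⟨x, rfl⟩ | h
      · rw [hp]; exact fun h => hne x (Node.pos_injective h)
      · omega
    · rcases hall x with ⟨x, rfl⟩ | h
      · rw [hp, hq, hq, hedge]
      · rw [hpo x h]
    · rintro ⟨h1, h2, h3⟩
      rcases hall x with ⟨x, rfl⟩ | h
      · rcases hall y with ⟨y, rfl⟩ | h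
        · rw [hp] at h2 h3
          rw [hp] at h3
          have h4 := hP.1.2 x y (mate x) (mate y) h1 h2 h3 (hedge x).symm (hedge y).symm
          rcases (hmate x y).1 h4.symm with h | h <;> subst h <;> omega
        · rw [hpo y h] at h3; omega
      · rw [hpo x h] at h2; omega
    · rintro ⟨h1, h2⟩
      rcases hall y with ⟨y, rfl⟩ | h'
      · rcases hall x with ⟨x, rfl⟩ | h'
        · rw [hp] at h2
          rw [hq, decide_eq_true_eq] at h
          exact hP.2.2 _ (by omega) ⟨x, y, mate x, h1, h2, rfl, (hedge x).symm⟩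
        · rw [hpo x h'] at h2; omega
      · rw [hqo y h'] at h; exact Bool.false_ne_true h
  have hqd : ∀ x : Node n, (r.q x.pos).toNat = P.dec (P.edgeAt x) := fun x => by
    rw [hq]
    have := hd (P.edgeAt x)
    by_cases h : P.dec (P.edgeAt x) = 1
    · simp [h]
    · simp [h]; omega
  refine ⟨r, hr, ?_, hqd⟩
  refine Picture.equivalent_of_edgeAt (fun e => ?_) picture_edgeAt_surjective (fun x y => ?_)
    fun x => ?_
  · by_contra h
    exact hl e fun x hx => h ⟨x, hx⟩
  · rw [hr.edgeAt_eq_iff, hp, Node.pos_injective.eq_iff, Node.pos_injective.eq_iff, eq_comm, hmate]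
  · rw [hr.dec_edgeAt, hqd]

end ArcData

/-- The diagram of a normal word. -/
def NormalList.diagram (hn : 4 ≤ n) (L : NormalList n) : LDiagram n :=
  .mk _ (ArcData.hat_run_normal hn L.2).1

theorem NormalList.diagram_admissible (hn : 4 ≤ n) (L : NormalList n) :
    ∃ (P : Picture n) (h : P.IsLDecorated), L.diagram hn = LDiagram.mk P h ∧
      P.IsIrreducible ∧ (∀ e, ¬ P.IsLoop e) ∧ Even (∑ e, P.dec e) := by
  have hl : ∀ e, ¬ (ArcData.picture n (ArcData.run n (rowsWord L.1))).IsLoop e := fun e h => by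
    obtain ⟨x, hx⟩ := ArcData.picture_edgeAt_surjective e
    exact h x hx
  refine ⟨_, _, rfl, ⟨fun e h => absurd h (hl e), fun e => ?_, fun e _ h => absurd h (hl e)⟩, hl,
    (ArcData.run_normal _ L.2).1.even_dec hn (ArcData.evenDec_run_normal L.2)⟩
  exact Bool.toNat_le _

/-- Equivalent pictures have the same value, whose support is the key; the key determines the
pattern and the pattern determines the normal list. -/
theorem NormalList.diagram_injective (hn : 4 ≤ n) :
    Function.Injective (NormalList.diagram hn : NormalList n → LDiagram n) := by
  intro L L' h
  have h1 : Picture.Equivalent (ArcData.picture n (ArcData.run n (rowsWord L.1)))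
      (ArcData.picture n (ArcData.run n (rowsWord L'.1))) :=
    Quotient.exact (congrArg Subtype.val h)
  have h2 := h1.value_eq
  rw [ArcData.value_picture, ArcData.value_picture] at h2
  exact Subtype.ext (ArcData.run_injective L.2 L'.2
    ((ArcData.run_normal _ L.2).1.eq_of_key_eq (ArcData.run_normal _ L'.2).1 hn
      (Finsupp.single_left_injective one_ne_zero h2)))

theorem NormalList.exists_diagram_eq (hn : 4 ≤ n) (D : AdmissibleII n) :
    ∃ L : NormalList n, L.diagram hn = D.1 := by
  obtain ⟨D, P, hP, rfl, hirr, hl, he⟩ := D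
  obtain ⟨r, hr, hPr, hq⟩ := ArcData.exists_valid_of_isLDecorated hn hP hl hirr.2.1
  have hre : r.EvenDec n := by
    rw [ArcData.EvenDec, ← sum_node_pos, Finset.sum_congr rfl fun x _ => hq x, hP.1.sum_dec hl]
    obtain ⟨k, hk⟩ := he
    exact ⟨k, by omega⟩
  -- For `n - 1` there are no nodes beyond, so the condition on vertical arcs is vacuous.
  obtain ⟨L, hL, -, h⟩ := hr.exists_normal hre (n - 1) (by omega) fun k h1 h2 => by omega
  refine ⟨⟨L, hL⟩, Subtype.ext (Quotient.sound ?_)⟩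
  subst h
  exact (Picture.setoid n).symm hPr

/-- The normal words correspond to the admissible diagrams of type II. -/
def diagramEquiv (hn : 4 ≤ n) : NormalList n ≃ AdmissibleII n :=
  Equiv.ofBijective (fun L => ⟨L.diagram hn, L.diagram_admissible hn⟩)
    ⟨fun _ _ h => NormalList.diagram_injective hn (congrArg Subtype.val h), fun D => by
      obtain ⟨L, hL⟩ := NormalList.exists_diagram_eq hn D
      exact ⟨L, Subtype.ext hL⟩⟩

end

end TypeD

end

theorem mainTheorem3 (n : ℕ) (hn : 4 ≤ n) :
    ∃ φ : TypeD.PFTL n ≃ₐ[ℤ[X]] TypeD.LFD hn,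
      (∀ i, φ (TypeD.PFTL.b i) = TypeD.LFD.d hn i) ∧
      ∃ (B : Module.Basis (TypeD.FCII n) ℤ[X] (TypeD.PFTL n))
        (β : TypeD.FCII n ≃ TypeD.AdmissibleII n),
        (∀ (w : TypeD.FCII n) (ω : List (Fin n)), TypeD.IsReducedExpr ω w.1 →
          B w = (ω.map TypeD.PFTL.b).prod) ∧
        ∀ w : TypeD.FCII n, TypeD.IsImage hn (β w).1 (φ (B w)) := by
  obtain ⟨φ, B, hφ, hB⟩ := TypeD.exists_basis hn
  -- Normal lists mediate: the basis is transported to the group elements, and the bijection to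
  -- diagrams passes through the normal word. Any reduced expression is commutation equivalent to
  -- that word, whence the independence of the monomial.
  refine ⟨φ, hφ, B.reindex (TypeD.normalEquiv hn),
    (TypeD.normalEquiv hn).symm.trans (TypeD.diagramEquiv hn), ?_, ?_⟩
  · intro w ω hω
    obtain ⟨L, rfl⟩ := (TypeD.normalEquiv hn).surjective w
    rw [Module.Basis.reindex_apply, Equiv.symm_apply_apply, hB, ← TypeD.mon_commEq (L.commEq hn hω),
      TypeD.mon_map_val]
  · intro w
    obtain ⟨L, rfl⟩ := (TypeD.normalEquiv hn).surjective w
    rw [Module.Basis.reindex_apply, Equiv.trans_apply, Equiv.symm_apply_apply, hB]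
    obtain ⟨hD, h⟩ := TypeD.map_mon_word hn φ.toAlgHom hφ L
    have he := TypeD.hat_eq (TypeD.ArcData.hat_run_normal hn L.2).1
    refine ⟨by rw [he] at hD; exact hD, h.trans (congrArg _ (Subtype.ext he))⟩
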